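/- For integers $\ell\ge 0$ and $d\ge 2$ let $G_{\ell;d}=\binom{\ell+\frac d2-1}{\ell}^{-1}P_\ell^{(\frac d2-1,\frac d2-1)}$ be the Gegenbauer polynomial normalized by $G_{\ell;d}(1)=1$, where $P_\ell^{(\alpha,\beta)}$ are the standard Jacobi polynomials. Let $(d,q)$ be integers with either $d=2$ and ($q=3$ or $q\ge 5$), or $d\ge 3$ and $q\ge 3$, and put $$c_{q;d}:=\Big(2^{\frac d2-1}\,\Gamma\big(\tfrac d2\big)\Big)^q\int_0^{\infty}J_{\frac d2-1}(\psi)^q\,\psi^{-q\left(\frac d2-1\right)+d-1}\,d\psi ,$$ where $J_{\frac d2-1}$ is the Bessel function of the first kind of order $\frac d2-1$ and the integral is understood as $\lim_{R\to\infty}\int_0^R$. This integral converges absolutely if $(d,q)\ne(2,3),(3,3)$, and converges conditionally (it converges, but not absolutely) if $(d,q)=(2,3)$ or $(d,q)=(3,3)$. Moreover, as $\ell\to\infty$, $$\int_0^{\pi/2}G_{\ell;d}(\cos\vartheta)^q(\sin\vartheta)^{d-1}\,d\vartheta=\frac{c_{q;d}}{\ell^d}\,(1+o(1)).$$ In the remaining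 case $d=2$, $q=4$, as $\ell\to\infty$, $$\int_0^{\pi/2}G_{\ell;2}(\cos\vartheta)^4\sin\vartheta\,d\vartheta=\frac{3}{2\pi^2}\,\frac{\log\ell}{\ell^2}\,(1+o(1)).$$ -/

import Mathlib

open MeasureTheory Filter Topology Set Asymptotics

noncomputable section

/-- The Jacobi polynomial `P_n^{(a,b)}` in the standard normalization,
`P_n^{(a,b)}(x) = (1/n!) ∑_{k=0}^n (n choose k) (n+a+b+1)_k (a+k+1)_{n-k} ((x-1)/2)^k`,
where `(y)_k = y (y+1) ⋯ (y+k-1)`. -/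
def jacobiPoly (n : ℕ) (a b : ℝ) : Polynomial ℝ :=
  Polynomial.C ((n.factorial : ℝ)⁻¹) *
    ∑ k ∈ Finset.range (n + 1),
      Polynomial.C ((n.choose k : ℝ)
          * (ascPochhammer ℝ k).eval ((n : ℝ) + a + b + 1)
          * (ascPochhammer ℝ (n - k)).eval (a + (k : ℝ) + 1))
        * (Polynomial.C (1 / 2 : ℝ) * (Polynomial.X - 1)) ^ k

/-- The Gegenbauer polynomial `G_{ℓ;d} = α⁻¹ P_ℓ^{(d/2-1, d/2-1)}` with
`α = (ℓ + d/2 - 1 choose ℓ)`, so that `G_{ℓ;d}(1) = 1`. -/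
def gegenbauerPoly (l d : ℕ) : Polynomial ℝ :=
  Polynomial.C ((Ring.choose ((l : ℝ) + (d : ℝ) / 2 - 1) l)⁻¹) *
    jacobiPoly l ((d : ℝ) / 2 - 1) ((d : ℝ) / 2 - 1)

/-- The moment `∫_0^{π/2} G_{ℓ;d}(cos ϑ)^q (sin ϑ)^{d-1} dϑ` (used for `d ≥ 2`). -/
def gegenbauerMoment (d q l : ℕ) : ℝ :=
  ∫ t in (0 : ℝ)..(Real.pi / 2),
    ((gegenbauerPoly l d).eval (Real.cos t)) ^ q * (Real.sin t) ^ (d - 1)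

/-- The Bessel function of the first kind of real order `v ≥ 0`, at `x ≥ 0`:
`J_v(x) = ∑_m (-1)^m / (m! Γ(m+v+1)) (x/2)^{2m+v}`. -/
def besselJ (v x : ℝ) : ℝ :=
  ∑' m : ℕ, (-1 : ℝ) ^ m / ((m.factorial : ℝ) * Real.Gamma ((m : ℝ) + v + 1))
    * (x / 2) ^ (2 * (m : ℝ) + v)

/-- The integrand `J_{d/2-1}(ψ)^q ψ^{-q(d/2-1)+d-1}`, for `ψ > 0`. -/
def besselIntegrand (d q : ℕ) (x : ℝ) : ℝ :=
  (besselJ ((d : ℝ) / 2 - 1) x) ^ q * x ^ (-(q : ℝ) * ((d : ℝ) / 2 - 1) + (d : ℝ) - 1)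

/-- `∫_0^∞ f` converges absolutely. -/
def AbsolutelyConvergent (f : ℝ → ℝ) : Prop :=
  IntegrableOn f (Ioi 0)

/-- `∫_0^∞ f` converges conditionally: `f` is integrable on every `(0, R]`, the integrals
`∫_0^R f` have a finite limit as `R → ∞`, but `f` is not integrable on `(0, ∞)`. -/
def ConditionallyConvergent (f : ℝ → ℝ) : Prop :=
  (∀ R : ℝ, 0 < R → IntegrableOn f (Ioc 0 R)) ∧
    (∃ I : ℝ, Tendsto (fun R : ℝ => ∫ x in (0 : ℝ)..R, f x) atTop (𝓝 I)) ∧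
      ¬ AbsolutelyConvergent f

/-- The improper integral `∫_0^∞ f = lim_{R → ∞} ∫_0^R f`; meaningful when `∫_0^∞ f` converges
absolutely or conditionally. -/
def improperIntegral (f : ℝ → ℝ) : ℝ :=
  limUnder atTop (fun R : ℝ => ∫ x in (0 : ℝ)..R, f x)

/-- `c_{q;d} = (2^{d/2-1} (d/2-1)!)^q ∫_0^∞ J_{d/2-1}(ψ)^q ψ^{-q(d/2-1)+d-1} dψ`,
with `(d/2-1)! = Γ(d/2)`. -/
def momentConst (d q : ℕ) : ℝ :=
  ((2 : ℝ) ^ ((d : ℝ) / 2 - 1) * Real.Gamma ((d : ℝ) / 2)) ^ q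
    * improperIntegral (besselIntegrand d q)

end

/-! Put y(t) = G(cos t), p = (d - 1)/2 and N = l + p. The function y solves y'' + (d - 1) cot t · y'
+ l(l + d - 1) y = 0. The first-order term is friction on (0, π/2), so the energy decreases, which
gives |y| ≤ 1 and |y'| ≤ N. The Liouville transform u = sin^p · y solves u'' + (N² + p(1 - p)/sin²)
u = 0. Its energy u'² + N² u² stays within fixed factors of itself on [1/(2N), π/2], so it is of
exact order N^(2 - 2p) there (`IsOscillator.energy_le`, `gegenbauerOsc_energy_le`,
`exists_le_energy`).

After the substitution t = x/N the moment becomes N^(-d) times an integral over [0, πN/2]. The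
integrand tends pointwise to Φ(x)^q x^(d-1), with Φ the normalized Bessel function (Mehler–Heine,
`gegenbauerScaled_tendsto`). Passing to the limit needs tails small uniformly in l. If (q - 2)p > 1
the amplitude bound suffices (`exists_absolute_tail_bound`). If q = 3, oscillation is used: u³ is a
derivative up to an error caused by p(1 - p)/sin² (`exists_cubic_tail_bound`). The same tails show
that the improper Bessel integral converges, and the moments times N^d have that integral as their
limit (`exists_limit_moment`). All Bessel bounds are inherited from the polynomials.

Absolute convergence fails for q = 3, d ≤ 3 because u⁴ has a positive mean, of order N^(-4p): ∫ Φ⁴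
x^(2d-3) grows at least logarithmically, and its integrand is dominated by |Φ|³ x^(d-1).

Asymptotic equivalence also needs the constant to be nonzero. By Gegenbauer's product formula,
Φ(x)Φ(rx) averages Φ over the third side of a triangle with sides r and 1. Gaussian-regularized
moments are therefore iterated averages of a Gaussian, that is, smoothed densities of a walk with
unit steps. They are bounded below uniformly in the regularization, and an Abelian argument carries
the bound to the improper integral (`besselMoment_pos`).

For d = 2, q = 4 the mean 3/8 · (E/N²)² of u⁴, with E the energy at the equator, is integrated
against 1/sin and produces log N. Exact Legendre values at the equator and Wallis' product give E/N
→ 2/π, hence the constant 3/8 · (2/π)² = 3/(2π²). -/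

/-! ### Hypergeometric form and differential equation of the Gegenbauer polynomials. -/

/-- Coefficients of the Gegenbauer polynomial in powers of `(1 - x) / 2`. -/
noncomputable def gegenbauerCoeff (d l k : ℕ) : ℝ :=
  (-1) ^ k * (l.choose k : ℝ) * (ascPochhammer ℝ k).eval ((l : ℝ) + d - 1)
    / (ascPochhammer ℝ k).eval ((d : ℝ) / 2)

/-- The Gegenbauer polynomial in the variable `(1 - x) / 2`. -/
noncomputable def gegenbauerShift (d l : ℕ) : Polynomial ℝ :=
  ∑ k ∈ Finset.range (l + 1), Polynomial.C (gegenbauerCoeff d l k) * Polynomial.X ^ k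

theorem ascPochhammer_half_pos {d : ℕ} (hd : 0 < d) (k : ℕ) :
    0 < (ascPochhammer ℝ k).eval ((d : ℝ) / 2) :=
  ascPochhammer_pos k _ (by positivity)

theorem gegenbauerCoeff_zero (d l : ℕ) : gegenbauerCoeff d l 0 = 1 := by
  simp [gegenbauerCoeff]

theorem gegenbauerCoeff_eq_zero {d l k : ℕ} (h : l < k) : gegenbauerCoeff d l k = 0 := by
  simp [gegenbauerCoeff, Nat.choose_eq_zero_of_lt h]

theorem gegenbauerShift_coeff (d l k : ℕ) :
    (gegenbauerShift d l).coeff k = gegenbauerCoeff d l k := by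
  simp only [gegenbauerShift, Polynomial.finsetSum_coeff, Polynomial.coeff_C_mul,
    Polynomial.coeff_X_pow, mul_ite, mul_one, mul_zero, Finset.sum_ite_eq, Finset.mem_range]
  split_ifs with h
  · rfl
  · exact (gegenbauerCoeff_eq_zero (by omega)).symm

theorem gegenbauerShift_eval (d l : ℕ) (z : ℝ) :
    (gegenbauerShift d l).eval z = ∑ k ∈ Finset.range (l + 1), gegenbauerCoeff d l k * z ^ k := by
  simp [gegenbauerShift, Polynomial.eval_finsetSum]

/-- The hypergeometric equation in coefficient form; it drives both the differential equation and
the Mehler–Heine limit. No bound k ≤ l is needed: the factor l - k vanishes at k = l and both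
coefficients are zero beyond. -/
theorem gegenbauerCoeff_succ {d : ℕ} (hd : 0 < d) (l k : ℕ) :
    gegenbauerCoeff d l (k + 1) * (((k : ℝ) + 1) * (k + (d : ℝ) / 2))
      = -(((l : ℝ) - k) * (l + d - 1 + k)) * gegenbauerCoeff d l k := by
  have h1 := (ascPochhammer_half_pos hd k).ne'
  have h2 : ((d : ℝ) / 2 + k) ≠ 0 := by positivity
  have h3 : (l.choose (k + 1) : ℝ) * (k + 1) = l.choose k * ((l : ℝ) - k) := by
    rcases le_or_gt k l with h | h
    · have := Nat.choose_succ_right_eq l k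
      have h' := congrArg (Nat.cast (R := ℝ)) this
      push_cast [Nat.cast_sub h] at h'
      exact h'
    · simp [Nat.choose_eq_zero_of_lt h, Nat.choose_eq_zero_of_lt (Nat.lt_succ_of_lt h)]
  simp only [gegenbauerCoeff, ascPochhammer_succ_eval, pow_succ]
  field_simp
  linear_combination (-(2 * (k : ℝ) + d) * ((l : ℝ) + d - 1 + k)
    * (ascPochhammer ℝ k).eval ((l : ℝ) + d - 1)) * h3

theorem choose_add_half {d : ℕ} (l : ℕ) :
    Ring.choose ((l : ℝ) + (d : ℝ) / 2 - 1) l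
      = (ascPochhammer ℝ l).eval ((d : ℝ) / 2) / l.factorial := by
  have h := Ring.multichoose_eq ((d : ℝ) / 2) l
  have h2 := Ring.factorial_nsmul_multichoose_eq_ascPochhammer ((d : ℝ) / 2) l
  rw [show (l : ℝ) + (d : ℝ) / 2 - 1 = (d : ℝ) / 2 + l - 1 by ring, ← h,
    eq_div_iff (by positivity), ← Polynomial.ascPochhammer_smeval_eq_eval, ← h2, nsmul_eq_mul, mul_comm]

/-- With α = d/2, the splitting (α)_l = (α)_k (α + k)_(l-k) cancels the normalizing binomial against
the last Pochhammer factor of the Jacobi sum. -/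
theorem gegenbauerPoly_eval {d : ℕ} (hd : 0 < d) (l : ℕ) (x : ℝ) :
    (gegenbauerPoly l d).eval x = (gegenbauerShift d l).eval ((1 - x) / 2) := by
  rw [gegenbauerShift_eval]
  simp only [gegenbauerPoly, jacobiPoly, Polynomial.eval_mul, Polynomial.eval_C,
    Polynomial.eval_finsetSum, Polynomial.eval_pow, Polynomial.eval_sub, Polynomial.eval_X,
    Polynomial.eval_one, choose_add_half, Finset.mul_sum]
  refine Finset.sum_congr rfl fun k hk => ?_
  have hk' : k ≤ l := by simpa [Nat.lt_succ_iff] using hk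
  have h0 := (ascPochhammer_half_pos hd l).ne'
  have h1 := (ascPochhammer_half_pos hd k).ne'
  have h2 : (ascPochhammer ℝ l).eval ((d : ℝ) / 2)
      = (ascPochhammer ℝ k).eval ((d : ℝ) / 2)
        * (ascPochhammer ℝ (l - k)).eval ((d : ℝ) / 2 - 1 + k + 1) := by
    have := congrArg (Polynomial.eval ((d : ℝ) / 2)) (ascPochhammer_mul ℝ k (l - k))
    rw [Nat.add_sub_cancel' hk'] at this
    rw [← this]
    simp only [Polynomial.eval_mul, Polynomial.eval_comp, Polynomial.eval_add, Polynomial.eval_X,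
      Polynomial.eval_natCast]
    congr 2
    ring
  have h3 : (1 / 2 * (x - 1)) ^ k = (-1) ^ k * ((1 - x) / 2) ^ k := by
    rw [← mul_pow]; congr 1; ring
  have h4 : (l : ℝ) + ((d : ℝ) / 2 - 1) + ((d : ℝ) / 2 - 1) + 1 = (l : ℝ) + d - 1 := by ring
  rw [h3, h4, gegenbauerCoeff, h2]
  rw [h2] at h0
  have h5 := right_ne_zero_of_mul h0
  generalize (ascPochhammer ℝ (l - k)).eval ((d : ℝ) / 2 - 1 + k + 1) = A at h5 ⊢
  field_simp

theorem gegenbauerShift_ode {d : ℕ} (hd : 0 < d) (l : ℕ) (z : ℝ) :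
    z * (1 - z) * (gegenbauerShift d l).derivative.derivative.eval z
      + (d : ℝ) / 2 * (1 - 2 * z) * (gegenbauerShift d l).derivative.eval z
      + l * (l + d - 1) * (gegenbauerShift d l).eval z = 0 := by
  set H := gegenbauerShift d l with hH
  have key : Polynomial.X * (1 - Polynomial.X) * H.derivative.derivative
      + Polynomial.C ((d : ℝ) / 2) * (1 - Polynomial.C 2 * Polynomial.X) * H.derivative
      + Polynomial.C ((l : ℝ) * (l + d - 1)) * H = 0 := by
    have e : Polynomial.X * (1 - Polynomial.X) * H.derivative.derivative
      + Polynomial.C ((d : ℝ) / 2) * (1 - Polynomial.C 2 * Polynomial.X) * H.derivative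
      + Polynomial.C ((l : ℝ) * (l + d - 1)) * H
      = Polynomial.X * H.derivative.derivative
        - Polynomial.X * (Polynomial.X * H.derivative.derivative)
        + Polynomial.C ((d : ℝ) / 2) * H.derivative
        - Polynomial.C (d : ℝ) * (Polynomial.X * H.derivative)
        + Polynomial.C ((l : ℝ) * (l + d - 1)) * H := by
      have : Polynomial.C (d : ℝ) = Polynomial.C ((d : ℝ) / 2) * Polynomial.C 2 := by
        rw [← Polynomial.C_mul]; congr 1; ring
      rw [this]; ring
    rw [e]
    ext k
    have hr := gegenbauerCoeff_succ hd l
    -- The two lowest coefficients are separate because multiplication by X and by X² shifts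
    -- degrees; each case is one instance of the recursion.
    rcases k with _ | _ | k
    · simp only [Polynomial.coeff_add, Polynomial.coeff_sub, Polynomial.coeff_C_mul,
        Polynomial.coeff_X_mul_zero, Polynomial.coeff_derivative, hH, gegenbauerShift_coeff,
        Polynomial.coeff_zero]
      have := hr 0
      push_cast at this ⊢
      linear_combination this
    · simp only [Polynomial.coeff_add, Polynomial.coeff_sub, Polynomial.coeff_C_mul,
        Polynomial.coeff_X_mul, Polynomial.coeff_X_mul_zero, Polynomial.coeff_derivative, hH,
        gegenbauerShift_coeff, Polynomial.coeff_zero]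
      have := hr 1
      push_cast at this ⊢
      linear_combination this
    · simp only [Polynomial.coeff_add, Polynomial.coeff_sub, Polynomial.coeff_C_mul,
        Polynomial.coeff_X_mul, Polynomial.coeff_derivative, hH,
        gegenbauerShift_coeff, Polynomial.coeff_zero]
      have := hr (k + 2)
      push_cast at this ⊢
      linear_combination this
  have := congrArg (Polynomial.eval z) key
  simpa using this

/-! ### The angular variable and the first energy estimate. -/

/-- The Gegenbauer polynomial as a function of the angle. -/
noncomputable def gegenbauerAngle (d l : ℕ) (t : ℝ) : ℝ :=
  (gegenbauerShift d l).eval ((1 - Real.cos t) / 2)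

/-- The derivative of `gegenbauerAngle`. -/
noncomputable def gegenbauerAngleDeriv (d l : ℕ) (t : ℝ) : ℝ :=
  (gegenbauerShift d l).derivative.eval ((1 - Real.cos t) / 2) * (Real.sin t / 2)

theorem gegenbauerMoment_eq {d : ℕ} (hd : 0 < d) (q l : ℕ) :
    gegenbauerMoment d q l
      = ∫ t in (0 : ℝ)..(Real.pi / 2), gegenbauerAngle d l t ^ q * Real.sin t ^ (d - 1) := by
  simp only [gegenbauerMoment, gegenbauerPoly_eval hd, gegenbauerAngle]

theorem gegenbauerAngle_hasDerivAt (d l : ℕ) (t : ℝ) :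
    HasDerivAt (gegenbauerAngle d l) (gegenbauerAngleDeriv d l t) t := by
  have h := ((Real.hasDerivAt_cos t).const_sub 1).div_const 2
  rw [neg_neg] at h
  exact ((gegenbauerShift d l).hasDerivAt _).comp t h

theorem gegenbauerAngleDeriv_hasDerivAt {d : ℕ} (hd : 0 < d) (l : ℕ) {t : ℝ}
    (ht : Real.sin t ≠ 0) :
    HasDerivAt (gegenbauerAngleDeriv d l)
      (-((d : ℝ) - 1) * (Real.cos t / Real.sin t) * gegenbauerAngleDeriv d l t
        - l * (l + d - 1) * gegenbauerAngle d l t) t := by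
  have h := ((Real.hasDerivAt_cos t).const_sub 1).div_const 2
  rw [neg_neg] at h
  have h2 := (((gegenbauerShift d l).derivative.hasDerivAt _).comp t h).mul
    ((Real.hasDerivAt_sin t).div_const 2)
  refine h2.congr_deriv ?_
  have := gegenbauerShift_ode hd l ((1 - Real.cos t) / 2)
  simp only [gegenbauerAngle, gegenbauerAngleDeriv, Function.comp]
  set a := (gegenbauerShift d l).derivative.derivative.eval ((1 - Real.cos t) / 2)
  set b := (gegenbauerShift d l).derivative.eval ((1 - Real.cos t) / 2)
  set c := (gegenbauerShift d l).eval ((1 - Real.cos t) / 2)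
  have hs := Real.sin_sq_add_cos_sq t
  field_simp
  linear_combination 4 * this + a * hs

theorem gegenbauerAngle_zero (d l : ℕ) : gegenbauerAngle d l 0 = 1 := by
  simp [gegenbauerAngle, gegenbauerShift_eval, Finset.sum_range_succ', gegenbauerCoeff_zero]

theorem gegenbauerAngleDeriv_zero (d l : ℕ) : gegenbauerAngleDeriv d l 0 = 0 := by
  simp [gegenbauerAngleDeriv]

theorem gegenbauerAngle_continuous (d l : ℕ) : Continuous (gegenbauerAngle d l) :=
  continuous_iff_continuousAt.2 fun t => (gegenbauerAngle_hasDerivAt d l t).continuousAt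

theorem gegenbauerAngleDeriv_continuous (d l : ℕ) : Continuous (gegenbauerAngleDeriv d l) := by
  unfold gegenbauerAngleDeriv
  exact ((Polynomial.continuous _).comp (by fun_prop)).mul (by fun_prop)

/-- The derivative of the energy is -2(d - 1) cot t · y'², which is nonpositive on (0, π/2). The
right-hand side is the energy at t = 0, where y = 1 and y' = 0. -/
theorem gegenbauerAngle_energy_le {d : ℕ} (hd : 2 ≤ d) (l : ℕ) {t : ℝ}
    (ht : t ∈ Icc 0 (Real.pi / 2)) :
    gegenbauerAngleDeriv d l t ^ 2 + l * (l + d - 1) * gegenbauerAngle d l t ^ 2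
      ≤ l * (l + d - 1) := by
  have hd' : (2 : ℝ) ≤ d := by exact_mod_cast hd
  set E : ℝ → ℝ := fun t =>
    gegenbauerAngleDeriv d l t ^ 2 + l * (l + d - 1) * gegenbauerAngle d l t ^ 2 with hE
  have hsin : ∀ x ∈ Ioo (0 : ℝ) (Real.pi / 2), 0 < Real.sin x := fun x hx =>
    Real.sin_pos_of_pos_of_lt_pi hx.1 (by linarith [hx.2, Real.pi_pos])
  have hder : ∀ x ∈ Ioo (0 : ℝ) (Real.pi / 2), HasDerivAt E
      (-2 * ((d : ℝ) - 1) * (Real.cos x / Real.sin x) * gegenbauerAngleDeriv d l x ^ 2) x := by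
    intro x hx
    have h1 := (gegenbauerAngleDeriv_hasDerivAt (by omega : 0 < d) l (hsin x hx).ne').pow 2
    have h2 := ((gegenbauerAngle_hasDerivAt d l x).pow 2).const_mul ((l : ℝ) * (l + d - 1))
    refine (h1.add h2).congr_deriv ?_
    simp only [Nat.cast_ofNat, Nat.add_one_sub_one, pow_one]
    ring
  have hanti : AntitoneOn E (Icc 0 (Real.pi / 2)) := by
    refine antitoneOn_of_deriv_nonpos (convex_Icc _ _) ?_ ?_ ?_
    · exact (((gegenbauerAngleDeriv_continuous d l).pow 2).add
        (((gegenbauerAngle_continuous d l).pow 2).const_mul _)).continuousOn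
    · rw [interior_Icc]
      exact fun x hx => (hder x hx).differentiableAt.differentiableWithinAt
    · rw [interior_Icc]
      intro x hx
      rw [(hder x hx).deriv]
      have hc : 0 < Real.cos x := Real.cos_pos_of_mem_Ioo ⟨by linarith [hx.1, Real.pi_pos], hx.2⟩
      have : 0 ≤ ((d : ℝ) - 1) * (Real.cos x / Real.sin x) * gegenbauerAngleDeriv d l x ^ 2 :=
        mul_nonneg (mul_nonneg (by linarith) (div_pos hc (hsin x hx)).le) (sq_nonneg _)
      linarith
  have := hanti ⟨le_rfl, by positivity⟩ ht ht.1
  simpa [hE, gegenbauerAngle_zero, gegenbauerAngleDeriv_zero] using this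

theorem abs_gegenbauerAngle_le_one {d : ℕ} (hd : 2 ≤ d) (l : ℕ) {t : ℝ}
    (ht : t ∈ Icc 0 (Real.pi / 2)) : |gegenbauerAngle d l t| ≤ 1 := by
  have hd' : (2 : ℝ) ≤ d := by exact_mod_cast hd
  -- For l = 0 the weight l(l + d - 1) vanishes and the energy carries no information on y, which is
  -- then the constant 1.
  rcases Nat.eq_zero_or_pos l with rfl | hl
  · simp [gegenbauerAngle, gegenbauerShift_eval, gegenbauerCoeff_zero]
  · have hl' : (1 : ℝ) ≤ l := by exact_mod_cast hl
    have h := gegenbauerAngle_energy_le hd l ht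
    have hL : (0 : ℝ) < l * (l + d - 1) := by
      have : (0 : ℝ) < l + d - 1 := by linarith
      positivity
    rw [← sq_le_one_iff_abs_le_one]
    have h2 := sq_nonneg (gegenbauerAngleDeriv d l t)
    by_contra! hcon
    nlinarith

/-- The shifted degree `l + (d - 1) / 2`. -/
noncomputable def gegenbauerFreq (d l : ℕ) : ℝ := l + ((d : ℝ) - 1) / 2

theorem gegenbauerFreq_sq (d l : ℕ) :
    gegenbauerFreq d l ^ 2 = l * (l + d - 1) + (((d : ℝ) - 1) / 2) ^ 2 := by
  simp only [gegenbauerFreq]; ring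

theorem gegenbauerFreq_pos {d : ℕ} (hd : 2 ≤ d) (l : ℕ) : 0 < gegenbauerFreq d l := by
  have hd' : (2 : ℝ) ≤ d := by exact_mod_cast hd
  have : (0 : ℝ) ≤ l := by positivity
  simp only [gegenbauerFreq]; linarith

theorem abs_gegenbauerAngleDeriv_le {d : ℕ} (hd : 2 ≤ d) (l : ℕ) {t : ℝ}
    (ht : t ∈ Icc 0 (Real.pi / 2)) : |gegenbauerAngleDeriv d l t| ≤ gegenbauerFreq d l := by
  have hd' : (2 : ℝ) ≤ d := by exact_mod_cast hd
  have h := gegenbauerAngle_energy_le hd l ht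
  have hL : (0 : ℝ) ≤ l * (l + d - 1) := by
    have : (0 : ℝ) < l + d - 1 := by linarith [(Nat.cast_nonneg l : (0 : ℝ) ≤ l)]
    positivity
  refine abs_le_of_sq_le_sq ?_ (gegenbauerFreq_pos hd l).le
  rw [gegenbauerFreq_sq]
  have := mul_nonneg hL (sq_nonneg (gegenbauerAngle d l t))
  have h3 := sq_nonneg (((d : ℝ) - 1) / 2)
  linarith

/-- Evaluated at t = 1/(2N), this keeps y ≥ 1/2, the seed of the lower bound for the energy of the
normal form. -/
theorem one_sub_le_gegenbauerAngle {d : ℕ} (hd : 2 ≤ d) (l : ℕ) {t : ℝ}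
    (ht : t ∈ Icc 0 (Real.pi / 2)) : 1 - gegenbauerFreq d l * t ≤ gegenbauerAngle d l t := by
  have h := Convex.norm_image_sub_le_of_norm_hasDerivWithin_le (f := gegenbauerAngle d l)
    (f' := gegenbauerAngleDeriv d l) (C := gegenbauerFreq d l)
    (fun x _ => (gegenbauerAngle_hasDerivAt d l x).hasDerivWithinAt)
    (fun x hx => abs_gegenbauerAngleDeriv_le hd l hx) (convex_Icc 0 (Real.pi / 2))
    ⟨le_rfl, by positivity⟩ ht
  rw [gegenbauerAngle_zero, sub_zero, Real.norm_eq_abs, Real.norm_eq_abs, abs_of_nonneg ht.1] at h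
  linarith [(abs_le.1 h).1]

/-! ### Elementary trigonometric bounds and integration against an approximate primitive. -/

theorem half_le_sin {t : ℝ} (h0 : 0 ≤ t) (h1 : t ≤ Real.pi / 2) : t / 2 ≤ Real.sin t := by
  refine le_trans ?_ (Real.mul_le_sin h0 h1)
  rw [div_mul_eq_mul_div, div_le_div_iff₀ two_pos Real.pi_pos]
  nlinarith [Real.pi_le_four]

theorem cot_le_inv {t : ℝ} (h0 : 0 < t) (h1 : t ≤ Real.pi / 2) :
    Real.cos t / Real.sin t ≤ 1 / t := by
  rcases h1.lt_or_eq with h | rfl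
  · have hs : 0 < Real.sin t := Real.sin_pos_of_pos_of_lt_pi h0 (by linarith [Real.pi_pos])
    have hc : 0 < Real.cos t := Real.cos_pos_of_mem_Ioo ⟨by linarith [Real.pi_pos], h⟩
    have := Real.lt_tan h0 h
    rw [Real.tan_eq_sin_div_cos, lt_div_iff₀ hc] at this
    rw [div_le_div_iff₀ hs h0]
    linarith
  · simp; positivity

theorem hasDerivAt_cot {t : ℝ} (h : Real.sin t ≠ 0) :
    HasDerivAt (fun t => Real.cos t / Real.sin t) (-(1 / Real.sin t ^ 2)) t := by
  refine ((Real.hasDerivAt_cos t).div (Real.hasDerivAt_sin t) h).congr_deriv ?_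
  field_simp
  linear_combination -Real.sin_sq_add_cos_sq t

/-- If `h` differs from a derivative `g'` by `O(t ^ (-p - 1))`, its integral is controlled by
the boundary values of `g`. -/
theorem abs_integral_le_of_primitive {g g' h : ℝ → ℝ} {a b C p : ℝ} (ha : 0 < a) (hab : a ≤ b)
    (hp : 0 < p) (hC : 0 ≤ C) (hg : ∀ t ∈ Icc a b, HasDerivAt g (g' t) t)
    (hg' : ContinuousOn g' (Icc a b)) (hh : ContinuousOn h (Icc a b))
    (hbound : ∀ t ∈ Icc a b, |g' t - h t| ≤ C * t ^ (-p - 1)) :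
    |∫ t in a..b, h t| ≤ |g a| + |g b| + C * (a ^ (-p) / p) := by
  have hI1 : IntervalIntegrable g' volume a b := (hg'.mono (by rw [uIcc_of_le hab])).intervalIntegrable
  have hI2 : IntervalIntegrable h volume a b := (hh.mono (by rw [uIcc_of_le hab])).intervalIntegrable
  have e1 : ∫ t in a..b, g' t = g b - g a :=
    intervalIntegral.integral_eq_sub_of_hasDerivAt (by rwa [uIcc_of_le hab]) hI1
  have h0 : (0 : ℝ) ∉ uIcc a b := by
    rw [uIcc_of_le hab]; exact fun h => absurd h.1 (not_le.2 ha)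
  have hI3 : IntervalIntegrable (fun t : ℝ => C * t ^ (-p - 1)) volume a b :=
    (intervalIntegral.intervalIntegrable_rpow (Or.inr h0)).const_mul C
  have e2 : ‖∫ t in a..b, (g' t - h t)‖ ≤ ∫ t in a..b, C * t ^ (-p - 1) := by
    refine intervalIntegral.norm_integral_le_of_norm_le hab ?_ hI3
    exact Eventually.of_forall fun t ht => hbound t (Ioc_subset_Icc_self ht)
  rw [intervalIntegral.integral_sub hI1 hI2, e1, intervalIntegral.integral_const_mul,
    integral_rpow (Or.inr ⟨by linarith, h0⟩), Real.norm_eq_abs] at e2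
  have e3 : (b ^ (-p - 1 + 1) - a ^ (-p - 1 + 1)) / (-p - 1 + 1) ≤ a ^ (-p) / p := by
    rw [show -p - 1 + 1 = -p by ring, div_neg, ← neg_div]
    have : 0 ≤ b ^ (-p) := Real.rpow_nonneg (ha.le.trans hab) _
    gcongr
    linarith
  have e4 := mul_le_mul_of_nonneg_left e3 hC
  have e5 := abs_sub_abs_le_abs_sub (∫ t in a..b, h t) (g b - g a)
  rw [abs_sub_comm (∫ t in a..b, h t)] at e5
  have e6 := abs_sub (g b) (g a)
  linarith

/-! ### Perturbed harmonic oscillators: energy, cubic cancellation, quartic mean. -/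

/-- Solutions `u` (with derivative `v`) of `u'' + (N² + κ / sin²) u = 0` on `(0, π)`. -/
structure IsOscillator (N κ : ℝ) (u v : ℝ → ℝ) : Prop where
  hasDerivAt_left : ∀ t ∈ Ioo 0 Real.pi, HasDerivAt u (v t) t
  hasDerivAt_right : ∀ t ∈ Ioo 0 Real.pi,
    HasDerivAt v (-(N ^ 2 + κ / Real.sin t ^ 2) * u t) t

/-- The energy `v² + N² u²`. -/
def oscillatorEnergy (N : ℝ) (u v : ℝ → ℝ) (t : ℝ) : ℝ := v t ^ 2 + N ^ 2 * u t ^ 2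

namespace IsOscillator

variable {N κ : ℝ} {u v : ℝ → ℝ}

theorem continuousOn_left (h : IsOscillator N κ u v) : ContinuousOn u (Ioo 0 Real.pi) :=
  fun t ht => (h.hasDerivAt_left t ht).continuousAt.continuousWithinAt

theorem continuousOn_right (h : IsOscillator N κ u v) : ContinuousOn v (Ioo 0 Real.pi) :=
  fun t ht => (h.hasDerivAt_right t ht).continuousAt.continuousWithinAt

theorem hasDerivAt_energy (h : IsOscillator N κ u v) {t : ℝ} (ht : t ∈ Ioo 0 Real.pi) :
    HasDerivAt (oscillatorEnergy N u v) (-2 * (κ / Real.sin t ^ 2) * (u t * v t)) t := by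
  refine (((h.hasDerivAt_right t ht).pow 2).add
    (((h.hasDerivAt_left t ht).pow 2).const_mul (N ^ 2))).congr_deriv ?_
  simp only [Nat.cast_ofNat, Nat.add_one_sub_one, pow_one]
  ring

theorem abs_two_mul_le (hN : 0 < N) (t : ℝ) :
    2 * |u t * v t| ≤ oscillatorEnergy N u v t / N := by
  rw [le_div_iff₀ hN, oscillatorEnergy, abs_mul]
  nlinarith [sq_nonneg (|v t| - N * |u t|), sq_abs (u t), sq_abs (v t)]

/-- Since |E'| ≤ (|κ|/N) E / sin² and -cot is a primitive of 1/sin², the products E · exp(±(|κ|/N)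
cot) are monotone in opposite directions. For t ≥ 1/(2N) one has cot t ≤ 1/t ≤ 2N, so the exponent
never exceeds 2|κ|. The points s and t may come in either order, which yields upper and lower bounds
alike. -/
theorem energy_le (h : IsOscillator N κ u v) (hN : 0 < N) {s t : ℝ}
    (hs : s ∈ Icc (1 / (2 * N)) (Real.pi / 2)) (ht : t ∈ Icc (1 / (2 * N)) (Real.pi / 2)) :
    oscillatorEnergy N u v t ≤ Real.exp (2 * |κ|) * oscillatorEnergy N u v s := by
  have hsub : ∀ x ∈ Icc (1 / (2 * N)) (Real.pi / 2), x ∈ Ioo 0 Real.pi := fun x hx =>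
    ⟨lt_of_lt_of_le (by positivity) hx.1, by linarith [hx.2, Real.pi_pos]⟩
  have hsin : ∀ x ∈ Icc (1 / (2 * N)) (Real.pi / 2), 0 < Real.sin x := fun x hx =>
    Real.sin_pos_of_mem_Ioo (hsub x hx)
  have hE0 : ∀ x, 0 ≤ oscillatorEnergy N u v x := fun x => by
    unfold oscillatorEnergy; positivity
  have hcot : ∀ x ∈ Icc (1 / (2 * N)) (Real.pi / 2),
      0 ≤ |κ| / N * (Real.cos x / Real.sin x) ∧
        |κ| / N * (Real.cos x / Real.sin x) ≤ 2 * |κ| := by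
    intro x hx
    have hc : 0 ≤ Real.cos x := Real.cos_nonneg_of_mem_Icc
      ⟨by linarith [(hsub x hx).1, Real.pi_pos], hx.2⟩
    have h1 := cot_le_inv (hsub x hx).1 hx.2
    have h2 : 1 / x ≤ 2 * N := by
      rw [div_le_iff₀ (hsub x hx).1]
      have := hx.1
      rw [div_le_iff₀ (by positivity)] at this
      linarith
    refine ⟨mul_nonneg (by positivity) (div_nonneg hc (hsin x hx).le), ?_⟩
    calc |κ| / N * (Real.cos x / Real.sin x) ≤ |κ| / N * (2 * N) := by gcongr; linarith
      _ = 2 * |κ| := by field_simp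
  have hder : ∀ ε : ℝ, ∀ x ∈ Icc (1 / (2 * N)) (Real.pi / 2),
      HasDerivAt (fun x => oscillatorEnergy N u v x
        * Real.exp (ε * (|κ| / N * (Real.cos x / Real.sin x))))
      ((-2 * (κ / Real.sin x ^ 2) * (u x * v x)
        - ε * (|κ| / Real.sin x ^ 2 * (oscillatorEnergy N u v x / N)))
          * Real.exp (ε * (|κ| / N * (Real.cos x / Real.sin x)))) x := by
    intro ε x hx
    refine ((h.hasDerivAt_energy (hsub x hx)).mul
      ((((hasDerivAt_cot (hsin x hx).ne').const_mul (|κ| / N)).const_mul ε).exp)).congr_deriv ?_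
    ring
  have hkey : ∀ x, |-2 * (κ / Real.sin x ^ 2) * (u x * v x)|
      ≤ |κ| / Real.sin x ^ 2 * (oscillatorEnergy N u v x / N) := by
    intro x
    have := abs_two_mul_le (u := u) (v := v) hN x
    rw [abs_mul, abs_mul, abs_div, abs_neg, abs_two, abs_of_nonneg (sq_nonneg (Real.sin x))]
    calc 2 * (|κ| / Real.sin x ^ 2) * |u x * v x|
        = |κ| / Real.sin x ^ 2 * (2 * |u x * v x|) := by ring
      _ ≤ _ := by gcongr
  rcases le_total s t with hst | hts
  · have hanti : AntitoneOn (fun x => oscillatorEnergy N u v x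
        * Real.exp (1 * (|κ| / N * (Real.cos x / Real.sin x))))
        (Icc (1 / (2 * N)) (Real.pi / 2)) := by
      refine antitoneOn_of_deriv_nonpos (convex_Icc _ _)
        (fun x hx => (hder 1 x hx).continuousAt.continuousWithinAt)
        (fun x hx => (hder 1 x (interior_subset hx)).differentiableAt.differentiableWithinAt) ?_
      intro x hx
      rw [(hder 1 x (interior_subset hx)).deriv]
      refine mul_nonpos_of_nonpos_of_nonneg ?_ (Real.exp_pos _).le
      have := (abs_le.1 (hkey x)).2
      linarith
    have h1 := hanti hs ht hst
    simp only [one_mul] at h1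
    calc oscillatorEnergy N u v t
        ≤ oscillatorEnergy N u v t * Real.exp (|κ| / N * (Real.cos t / Real.sin t)) :=
          le_mul_of_one_le_right (hE0 t) (Real.one_le_exp (hcot t ht).1)
      _ ≤ _ := h1
      _ ≤ oscillatorEnergy N u v s * Real.exp (2 * |κ|) :=
          mul_le_mul_of_nonneg_left (Real.exp_le_exp.2 (hcot s hs).2) (hE0 s)
      _ = _ := mul_comm _ _
  · have hmono : MonotoneOn (fun x => oscillatorEnergy N u v x
        * Real.exp ((-1) * (|κ| / N * (Real.cos x / Real.sin x))))
        (Icc (1 / (2 * N)) (Real.pi / 2)) := by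
      refine monotoneOn_of_deriv_nonneg (convex_Icc _ _)
        (fun x hx => (hder _ x hx).continuousAt.continuousWithinAt)
        (fun x hx => (hder _ x (interior_subset hx)).differentiableAt.differentiableWithinAt) ?_
      intro x hx
      rw [(hder _ x (interior_subset hx)).deriv]
      refine mul_nonneg ?_ (Real.exp_pos _).le
      have := (abs_le.1 (hkey x)).1
      linarith
    have h1 := hmono ht hs hts
    simp only [neg_mul, one_mul] at h1
    have h2 : oscillatorEnergy N u v s * Real.exp (-(|κ| / N * (Real.cos s / Real.sin s)))
        ≤ oscillatorEnergy N u v s :=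
      mul_le_of_le_one_right (hE0 s) (Real.exp_le_one_iff.2 (by linarith [(hcot s hs).1]))
    have h3 : oscillatorEnergy N u v t * Real.exp (-(2 * |κ|))
        ≤ oscillatorEnergy N u v t * Real.exp (-(|κ| / N * (Real.cos t / Real.sin t))) :=
      mul_le_mul_of_nonneg_left (Real.exp_le_exp.2 (by linarith [(hcot t ht).2])) (hE0 t)
    rw [Real.exp_neg, ← div_eq_mul_inv] at h3
    have h4 := h3.trans (h1.trans h2)
    rwa [div_le_iff₀ (Real.exp_pos _), mul_comm] at h4

/-- Cancellation in the integral of the cube of an oscillator. -/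
theorem abs_integral_cube_le (h : IsOscillator N κ u v) (hN : 0 < N) {p m a b : ℝ} (hp : 0 < p)
    (hm : 0 ≤ m) (ha : 1 / (2 * N) ≤ a) (hab : a ≤ b) (hb : b ≤ Real.pi / 2)
    (hu : ∀ t ∈ Icc a b, |u t| ≤ m) (hv : ∀ t ∈ Icc a b, |v t| ≤ N * m) :
    |∫ t in a..b, u t ^ 3 * Real.sin t ^ (-p)|
      ≤ 2 ^ (p + 1) * ((12 * |κ| + 2 * p) / p + 2) * (m ^ 3 / N * a ^ (-p)) := by
  have ha0 : 0 < a := lt_of_lt_of_le (by positivity) ha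
  have hsub : ∀ x ∈ Icc a b, x ∈ Ioo 0 Real.pi := fun x hx =>
    ⟨ha0.trans_le hx.1, by linarith [hx.2, Real.pi_pos]⟩
  have hsin : ∀ x ∈ Icc a b, 0 < Real.sin x := fun x hx => Real.sin_pos_of_mem_Ioo (hsub x hx)
  have hhalf : ∀ x ∈ Icc a b, x / 2 ≤ Real.sin x := fun x hx =>
    half_le_sin (hsub x hx).1.le (hx.2.trans hb)
  set W : ℝ → ℝ := fun t => -(2 / (3 * N ^ 4)) * v t ^ 3 - 1 / N ^ 2 * (u t ^ 2 * v t) with hW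
  set R : ℝ → ℝ := fun t => κ / Real.sin t ^ 2 * (2 / N ^ 4 * (u t * v t ^ 2)
    + 1 / N ^ 2 * u t ^ 3) with hR
  have hWd : ∀ x ∈ Icc a b, HasDerivAt W (u x ^ 3 + R x) x := by
    intro x hx
    have h1 := h.hasDerivAt_left x (hsub x hx)
    have h2 := h.hasDerivAt_right x (hsub x hx)
    refine (((h2.pow 3).const_mul (-(2 / (3 * N ^ 4)))).sub
      (((h1.pow 2).mul h2).const_mul (1 / N ^ 2))).congr_deriv ?_
    simp only [hR, Nat.cast_ofNat, Nat.add_one_sub_one, pow_one, Pi.pow_apply]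
    field_simp
    ring
  have hcu : ContinuousOn u (Icc a b) := h.continuousOn_left.mono hsub
  have hcv : ContinuousOn v (Icc a b) := h.continuousOn_right.mono hsub
  have hcs : ∀ r : ℝ, ContinuousOn (fun t => Real.sin t ^ r) (Icc a b) := fun r =>
    Real.continuous_sin.continuousOn.rpow_const fun x hx => Or.inl (hsin x hx).ne'
  have hcW : ContinuousOn W (Icc a b) := by
    simp only [hW]; fun_prop
  have hcR : ContinuousOn R (Icc a b) := by
    have : ContinuousOn (fun t => κ / Real.sin t ^ 2) (Icc a b) :=
      continuousOn_const.div (by fun_prop) fun x hx => (pow_pos (hsin x hx) 2).ne'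
    simp only [hR]; fun_prop
  have hWb : ∀ x ∈ Icc a b, |W x| ≤ 2 * (m ^ 3 / N) := by
    intro x hx
    have h1 := hu x hx
    have h2 := hv x hx
    calc |W x| ≤ |(2 / (3 * N ^ 4)) * v x ^ 3| + |1 / N ^ 2 * (u x ^ 2 * v x)| := by
          simp only [hW, neg_mul]
          exact (abs_sub _ _).trans (by rw [abs_neg])
      _ = (2 / (3 * N ^ 4)) * |v x| ^ 3 + 1 / N ^ 2 * (|u x| ^ 2 * |v x|) := by
          rw [abs_mul, abs_mul, abs_mul, abs_pow, abs_pow,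
            abs_of_pos (by positivity : 0 < 2 / (3 * N ^ 4)),
            abs_of_pos (by positivity : 0 < 1 / N ^ 2)]
      _ ≤ (2 / (3 * N ^ 4)) * (N * m) ^ 3 + 1 / N ^ 2 * (m ^ 2 * (N * m)) := by gcongr
      _ = 5 / 3 * (m ^ 3 / N) := by field_simp; ring
      _ ≤ _ := by gcongr; norm_num
  have hRb : ∀ x ∈ Icc a b, |R x| ≤ 12 * |κ| * (m ^ 3 / N) * Real.sin x ^ (-1 : ℝ) := by
    intro x hx
    have h1 := hu x hx
    have h2 := hv x hx
    have hs := hsin x hx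
    -- From sin x ≥ x/2 ≥ 1/(4N). One of the two factors 1/sin in R is traded for N, so R has the
    -- same size m³/(N sin) as the term created by differentiating sin^(-p).
    have h3 : 1 / Real.sin x ≤ 4 * N := by
      rw [div_le_iff₀ hs]
      have := hhalf x hx
      have h5 : 1 / (2 * N) ≤ x := ha.trans hx.1
      rw [div_le_iff₀ (by positivity)] at h5
      nlinarith
    calc |R x| ≤ |κ| / Real.sin x ^ 2 * (2 / N ^ 4 * (|u x| * |v x| ^ 2)
            + 1 / N ^ 2 * |u x| ^ 3) := by
          simp only [hR]
          rw [abs_mul, abs_div, abs_of_pos (pow_pos hs 2)]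
          gcongr
          refine (abs_add_le _ _).trans (le_of_eq ?_)
          rw [abs_mul, abs_mul, abs_mul, abs_pow, abs_pow,
            abs_of_pos (by positivity : 0 < 2 / N ^ 4),
            abs_of_pos (by positivity : 0 < 1 / N ^ 2)]
      _ ≤ |κ| / Real.sin x ^ 2 * (2 / N ^ 4 * (m * (N * m) ^ 2) + 1 / N ^ 2 * m ^ 3) := by gcongr
      _ = 3 * |κ| * (m ^ 3 / N ^ 2) * (1 / Real.sin x) * (1 / Real.sin x) := by
          field_simp; ring
      _ ≤ 3 * |κ| * (m ^ 3 / N ^ 2) * (4 * N) * (1 / Real.sin x) := by gcongr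
      _ = _ := by rw [Real.rpow_neg_one]; field_simp; ring
  have hsr : ∀ x ∈ Icc a b, ∀ r : ℝ, 0 ≤ r → Real.sin x ^ (-r) ≤ 2 ^ r * x ^ (-r) := by
    intro x hx r hr
    have hx0 := (hsub x hx).1
    calc Real.sin x ^ (-r) ≤ (x / 2) ^ (-r) :=
          Real.rpow_le_rpow_of_nonpos (by positivity) (hhalf x hx) (by linarith)
      _ = _ := by
          rw [Real.div_rpow hx0.le two_pos.le, Real.rpow_neg two_pos.le, div_inv_eq_mul, mul_comm]
  have hmain := abs_integral_le_of_primitive (g := fun t => W t * Real.sin t ^ (-p))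
    (g' := fun t => (u t ^ 3 + R t) * Real.sin t ^ (-p)
      + W t * (Real.cos t * (-p) * Real.sin t ^ (-p - 1)))
    (h := fun t => u t ^ 3 * Real.sin t ^ (-p))
    (C := (12 * |κ| + 2 * p) * (m ^ 3 / N) * 2 ^ (p + 1)) ha0 hab hp (by positivity)
    (fun t ht => (hWd t ht).mul ((Real.hasDerivAt_sin t).rpow_const (Or.inl (hsin t ht).ne')))
    ?_ ?_ ?_
  · refine hmain.trans ?_
    have hend : ∀ x ∈ Icc a b, |W x * Real.sin x ^ (-p)| ≤ 2 ^ (p + 1) * (m ^ 3 / N * a ^ (-p)) := by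
      intro x hx
      have hs := hsin x hx
      rw [abs_mul, abs_of_pos (Real.rpow_pos_of_pos hs _)]
      calc |W x| * Real.sin x ^ (-p) ≤ 2 * (m ^ 3 / N) * (2 ^ p * x ^ (-p)) := by
            gcongr
            · exact hWb x hx
            · exact hsr x hx p hp.le
        _ ≤ 2 * (m ^ 3 / N) * (2 ^ p * a ^ (-p)) := by
            have := Real.rpow_le_rpow_of_nonpos ha0 hx.1 (neg_nonpos.2 hp.le)
            gcongr
        _ = _ := by rw [Real.rpow_add_one two_ne_zero]; ring
    have h1 := hend a ⟨le_rfl, hab⟩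
    have h2 := hend b ⟨hab, le_rfl⟩
    calc _ ≤ 2 ^ (p + 1) * (m ^ 3 / N * a ^ (-p)) + 2 ^ (p + 1) * (m ^ 3 / N * a ^ (-p))
        + (12 * |κ| + 2 * p) * (m ^ 3 / N) * 2 ^ (p + 1) * (a ^ (-p) / p) := by gcongr
      _ = _ := by field_simp; ring
  · exact ((((hcu.pow 3).add hcR).mul (hcs _)).add
      (hcW.mul ((Real.continuous_cos.continuousOn.mul continuousOn_const).mul (hcs _))))
  · exact (hcu.pow 3).mul (hcs _)
  · intro t ht
    have hs := hsin t ht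
    have e : (u t ^ 3 + R t) * Real.sin t ^ (-p)
        + W t * (Real.cos t * (-p) * Real.sin t ^ (-p - 1)) - u t ^ 3 * Real.sin t ^ (-p)
        = R t * Real.sin t ^ (-p) - p * (W t * Real.cos t * Real.sin t ^ (-p - 1)) := by ring
    have e2 : Real.sin t ^ (-1 : ℝ) * Real.sin t ^ (-p) = Real.sin t ^ (-p - 1) := by
      rw [← Real.rpow_add hs]; congr 1; ring
    have hc := Real.abs_cos_le_one t
    have hsp : 0 < Real.sin t ^ (-p - 1) := Real.rpow_pos_of_pos hs _
    have hsp' : 0 < Real.sin t ^ (-p) := Real.rpow_pos_of_pos hs _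
    rw [e]
    calc |R t * Real.sin t ^ (-p) - p * (W t * Real.cos t * Real.sin t ^ (-p - 1))|
        ≤ |R t| * Real.sin t ^ (-p) + p * (|W t| * |Real.cos t| * Real.sin t ^ (-p - 1)) := by
          refine (abs_sub _ _).trans (le_of_eq ?_)
          rw [abs_mul (R t), abs_mul p, abs_mul (W t * Real.cos t), abs_mul (W t), abs_of_pos hsp,
            abs_of_pos hsp', abs_of_pos hp]
      _ ≤ 12 * |κ| * (m ^ 3 / N) * Real.sin t ^ (-1 : ℝ) * Real.sin t ^ (-p)
          + p * (2 * (m ^ 3 / N) * 1 * Real.sin t ^ (-p - 1)) := by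
          gcongr
          · exact hRb t ht
          · exact hWb t ht
      _ = (12 * |κ| + 2 * p) * (m ^ 3 / N) * Real.sin t ^ (-p - 1) := by
          rw [mul_assoc (12 * |κ| * (m ^ 3 / N)), e2]; ring
      _ ≤ (12 * |κ| + 2 * p) * (m ^ 3 / N) * (2 ^ (p + 1) * t ^ (-p - 1)) := by
          have := hsr t ht (p + 1) (by linarith)
          rw [show -(p + 1) = -p - 1 by ring] at this
          gcongr
      _ = _ := by ring

/-- The derivative of the energy is at most 2|κ| N m² / sin² in absolute value. The comparison
primitive is cot, which vanishes at π/2; this is why the energy is measured against its value at the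
equator. -/
theorem abs_energy_sub_le (h : IsOscillator N κ u v) (hN : 0 < N) {m t : ℝ}
    (hu : ∀ t ∈ Icc (1 / (2 * N)) (Real.pi / 2), |u t| ≤ m)
    (hv : ∀ t ∈ Icc (1 / (2 * N)) (Real.pi / 2), |v t| ≤ N * m)
    (ht : t ∈ Icc (1 / (2 * N)) (Real.pi / 2)) :
    |oscillatorEnergy N u v t - oscillatorEnergy N u v (Real.pi / 2)|
      ≤ 2 * |κ| * N * m ^ 2 / Real.sin t := by
  have hsub : ∀ x ∈ Icc (1 / (2 * N)) (Real.pi / 2), x ∈ Ioo 0 Real.pi := fun x hx =>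
    ⟨lt_of_lt_of_le (by positivity) hx.1, by linarith [hx.2, Real.pi_pos]⟩
  have hsin : ∀ x ∈ Icc (1 / (2 * N)) (Real.pi / 2), 0 < Real.sin x := fun x hx =>
    Real.sin_pos_of_mem_Ioo (hsub x hx)
  have hm : 0 ≤ m := (abs_nonneg _).trans (hu t ht)
  have hder : ∀ ε : ℝ, ∀ x ∈ Icc (1 / (2 * N)) (Real.pi / 2),
      HasDerivAt (fun x => oscillatorEnergy N u v x
        + ε * (2 * |κ| * N * m ^ 2 * (Real.cos x / Real.sin x)))
      (-2 * (κ / Real.sin x ^ 2) * (u x * v x)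
        - ε * (2 * |κ| * N * m ^ 2 / Real.sin x ^ 2)) x := by
    intro ε x hx
    refine ((h.hasDerivAt_energy (hsub x hx)).add
      (((hasDerivAt_cot (hsin x hx).ne').const_mul (2 * |κ| * N * m ^ 2)).const_mul
        ε)).congr_deriv ?_
    ring
  have hkey : ∀ x ∈ Icc (1 / (2 * N)) (Real.pi / 2),
      |-2 * (κ / Real.sin x ^ 2) * (u x * v x)| ≤ 2 * |κ| * N * m ^ 2 / Real.sin x ^ 2 := by
    intro x hx
    rw [abs_mul, abs_mul, abs_mul, abs_div, abs_neg, abs_two, abs_of_nonneg (sq_nonneg (Real.sin x))]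
    calc 2 * (|κ| / Real.sin x ^ 2) * (|u x| * |v x|)
        ≤ 2 * (|κ| / Real.sin x ^ 2) * (m * (N * m)) := by
          gcongr
          · exact hu x hx
          · exact hv x hx
      _ = _ := by ring
  have hpi : Real.pi / 2 ∈ Icc (1 / (2 * N)) (Real.pi / 2) := ⟨ht.1.trans ht.2, le_rfl⟩
  have hanti : AntitoneOn (fun x => oscillatorEnergy N u v x
        + 1 * (2 * |κ| * N * m ^ 2 * (Real.cos x / Real.sin x)))
      (Icc (1 / (2 * N)) (Real.pi / 2)) := by
    refine antitoneOn_of_deriv_nonpos (convex_Icc _ _)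
      (fun x hx => (hder 1 x hx).continuousAt.continuousWithinAt)
      (fun x hx => (hder 1 x (interior_subset hx)).differentiableAt.differentiableWithinAt) ?_
    intro x hx
    rw [(hder 1 x (interior_subset hx)).deriv]
    linarith [(abs_le.1 (hkey x (interior_subset hx))).2]
  have hmono : MonotoneOn (fun x => oscillatorEnergy N u v x
        + (-1) * (2 * |κ| * N * m ^ 2 * (Real.cos x / Real.sin x)))
      (Icc (1 / (2 * N)) (Real.pi / 2)) := by
    refine monotoneOn_of_deriv_nonneg (convex_Icc _ _)
      (fun x hx => (hder _ x hx).continuousAt.continuousWithinAt)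
      (fun x hx => (hder _ x (interior_subset hx)).differentiableAt.differentiableWithinAt) ?_
    intro x hx
    rw [(hder _ x (interior_subset hx)).deriv]
    linarith [(abs_le.1 (hkey x (interior_subset hx))).1]
  have h1 := hanti ht hpi ht.2
  have h2 := hmono ht hpi ht.2
  simp only [Real.cos_pi_div_two, zero_div, mul_zero, add_zero] at h1 h2
  have h3 : 2 * |κ| * N * m ^ 2 * (Real.cos t / Real.sin t)
      ≤ 2 * |κ| * N * m ^ 2 / Real.sin t := by
    rw [← mul_div_assoc]
    have := hsin t ht
    refine div_le_div_of_nonneg_right ?_ this.le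
    exact mul_le_of_le_one_right (by positivity) (Real.cos_le_one t)
  rw [abs_le]
  constructor <;> linarith

/-- The mean value of the fourth power of an oscillator. -/
theorem abs_integral_quartic_sub_le (h : IsOscillator N κ u v) (hN : 0 < N) {m a b : ℝ}
    (ha : 1 / (2 * N) ≤ a) (hab : a ≤ b) (hb : b ≤ Real.pi / 2)
    (hu : ∀ t ∈ Icc (1 / (2 * N)) (Real.pi / 2), |u t| ≤ m)
    (hv : ∀ t ∈ Icc (1 / (2 * N)) (Real.pi / 2), |v t| ≤ N * m) :
    |∫ t in a..b, (u t ^ 4 - 3 * oscillatorEnergy N u v (Real.pi / 2) ^ 2 / (8 * N ^ 4))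
        / Real.sin t| ≤ (16 + 88 * |κ|) * m ^ 4 := by
  have ha0 : 0 < a := lt_of_lt_of_le (by positivity) ha
  have hIcc : ∀ x ∈ Icc a b, x ∈ Icc (1 / (2 * N)) (Real.pi / 2) := fun x hx =>
    ⟨ha.trans hx.1, hx.2.trans hb⟩
  have hm : 0 ≤ m := (abs_nonneg _).trans (hu a (hIcc a ⟨le_rfl, hab⟩))
  have hsub : ∀ x ∈ Icc a b, x ∈ Ioo 0 Real.pi := fun x hx =>
    ⟨ha0.trans_le hx.1, by linarith [hx.2, Real.pi_pos]⟩
  have hsin : ∀ x ∈ Icc a b, 0 < Real.sin x := fun x hx => Real.sin_pos_of_mem_Ioo (hsub x hx)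
  have hhalf : ∀ x ∈ Icc a b, x / 2 ≤ Real.sin x := fun x hx =>
    half_le_sin (hsub x hx).1.le (hx.2.trans hb)
  have hinv : ∀ x ∈ Icc a b, 1 / Real.sin x ≤ 4 * N := by
    intro x hx
    rw [div_le_iff₀ (hsin x hx)]
    have := hhalf x hx
    have h5 : 1 / (2 * N) ≤ x := ha.trans hx.1
    rw [div_le_iff₀ (by positivity)] at h5
    nlinarith
  set F := oscillatorEnergy N u v with hF
  set F₀ := F (Real.pi / 2) with hF₀
  -- For κ = 0 the energy F is constant and Z' = -u⁴ + 3F²/(8N⁴): the amplitude of u is √F/N, and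
  -- 3/8 is the mean of cos⁴. For κ ≠ 0 the extra part of Z' is -(κ/sin²) S.
  set S : ℝ → ℝ := fun t => u t ^ 4 / (4 * N ^ 2)
    + 3 / (8 * N ^ 4) * (2 * (u t ^ 2 * v t ^ 2) + F t * u t ^ 2) with hS
  set Z : ℝ → ℝ := fun t => u t ^ 3 * v t / (4 * N ^ 2) + 3 / (8 * N ^ 4) * (F t * (u t * v t))
    with hZ
  have hcu : ContinuousOn u (Icc a b) := h.continuousOn_left.mono hsub
  have hcv : ContinuousOn v (Icc a b) := h.continuousOn_right.mono hsub
  have hcF : ContinuousOn F (Icc a b) := by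
    simp only [hF]; unfold oscillatorEnergy; fun_prop
  have hcS : ContinuousOn S (Icc a b) := by simp only [hS]; fun_prop
  have hcZ : ContinuousOn Z (Icc a b) := by simp only [hZ]; fun_prop
  have hF0 : ∀ x, 0 ≤ F x := fun x => by simp only [hF]; unfold oscillatorEnergy; positivity
  have hFb : ∀ x ∈ Icc (1 / (2 * N)) (Real.pi / 2), F x ≤ 2 * N ^ 2 * m ^ 2 := by
    intro x hx
    have h1 := sq_le_sq' (by linarith [(abs_le.1 (hu x hx)).1]) (abs_le.1 (hu x hx)).2
    have h2 := sq_le_sq' (by linarith [(abs_le.1 (hv x hx)).1]) (abs_le.1 (hv x hx)).2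
    simp only [hF, oscillatorEnergy]
    nlinarith [sq_nonneg N]
  have hZd : ∀ x ∈ Icc a b, HasDerivAt Z (-u x ^ 4 + 3 * F x ^ 2 / (8 * N ^ 4)
      - κ / Real.sin x ^ 2 * S x) x := by
    intro x hx
    have h1 := h.hasDerivAt_left x (hsub x hx)
    have h2 := h.hasDerivAt_right x (hsub x hx)
    have h3 := h.hasDerivAt_energy (hsub x hx)
    refine ((((h1.pow 3).mul h2).div_const (4 * N ^ 2)).add
      ((h3.mul (h1.mul h2)).const_mul (3 / (8 * N ^ 4)))).congr_deriv ?_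
    simp only [hS, hF, oscillatorEnergy, Nat.cast_ofNat, Nat.add_one_sub_one, Pi.pow_apply,
      Pi.mul_apply]
    generalize κ / Real.sin x ^ 2 = δ
    field_simp
    ring
  have hSb : ∀ x ∈ Icc a b, |S x| ≤ 2 * (m ^ 4 / N ^ 2) := by
    intro x hx
    have h1 := hu x (hIcc x hx)
    have h2 := hv x (hIcc x hx)
    have h3 := hFb x (hIcc x hx)
    have h0 := hF0 x
    have e : S x = |u x| ^ 4 / (4 * N ^ 2)
        + 3 / (8 * N ^ 4) * (2 * (|u x| ^ 2 * |v x| ^ 2) + F x * |u x| ^ 2) := by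
      simp only [hS, sq_abs]
      rw [show |u x| ^ 4 = (|u x| ^ 2) ^ 2 by ring, sq_abs]; ring
    rw [abs_of_nonneg (by rw [e]; positivity), e]
    calc _ ≤ m ^ 4 / (4 * N ^ 2)
        + 3 / (8 * N ^ 4) * (2 * (m ^ 2 * (N * m) ^ 2) + 2 * N ^ 2 * m ^ 2 * m ^ 2) := by gcongr
      _ = 7 / 4 * (m ^ 4 / N ^ 2) := by field_simp; ring
      _ ≤ _ := by gcongr; norm_num
  have hZb : ∀ x ∈ Icc a b, |Z x| ≤ m ^ 4 / N := by
    intro x hx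
    have h1 := hu x (hIcc x hx)
    have h2 := hv x (hIcc x hx)
    have h3 := hFb x (hIcc x hx)
    have h0 := hF0 x
    calc |Z x| ≤ |u x| ^ 3 * |v x| / (4 * N ^ 2) + 3 / (8 * N ^ 4) * (F x * (|u x| * |v x|)) := by
          simp only [hZ]
          refine (abs_add_le _ _).trans (le_of_eq ?_)
          rw [abs_div, abs_of_pos (by positivity : 0 < 4 * N ^ 2), abs_mul (u x ^ 3), abs_pow,
            abs_mul (3 / (8 * N ^ 4)), abs_mul (F x), abs_mul (u x), abs_of_nonneg h0,
            abs_of_pos (by positivity : 0 < 3 / (8 * N ^ 4))]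
      _ ≤ m ^ 3 * (N * m) / (4 * N ^ 2)
          + 3 / (8 * N ^ 4) * (2 * N ^ 2 * m ^ 2 * (m * (N * m))) := by gcongr
      _ = _ := by field_simp; ring
  have hmain := abs_integral_le_of_primitive (p := 1) (g := fun t => Z t / Real.sin t)
    (g' := fun t => ((-u t ^ 4 + 3 * F t ^ 2 / (8 * N ^ 4) - κ / Real.sin t ^ 2 * S t) * Real.sin t
      - Z t * Real.cos t) / Real.sin t ^ 2)
    (h := fun t => -((u t ^ 4 - 3 * F₀ ^ 2 / (8 * N ^ 4)) / Real.sin t))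
    (C := (1 + 11 * |κ|) * 4 * (m ^ 4 / N)) ha0 hab one_pos (by positivity)
    (fun t ht => (hZd t ht).div (Real.hasDerivAt_sin t) (hsin t ht).ne') ?_ ?_ ?_
  · rw [intervalIntegral.integral_neg, abs_neg] at hmain
    refine hmain.trans ?_
    have hend : ∀ x ∈ Icc a b, |Z x / Real.sin x| ≤ 4 * m ^ 4 := by
      intro x hx
      have hs := hsin x hx
      rw [div_eq_mul_one_div, abs_mul, abs_of_pos (by positivity : 0 < 1 / Real.sin x)]
      calc |Z x| * (1 / Real.sin x) ≤ m ^ 4 / N * (4 * N) := by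
            gcongr
            · exact hZb x hx
            · exact hinv x hx
        _ = _ := by field_simp
    have h1 := hend a ⟨le_rfl, hab⟩
    have h2 := hend b ⟨hab, le_rfl⟩
    have h3 : a ^ (-1 : ℝ) ≤ 2 * N := by
      rw [Real.rpow_neg_one, inv_eq_one_div, div_le_iff₀ ha0]
      rw [div_le_iff₀ (by positivity)] at ha
      linarith
    calc _ ≤ 4 * m ^ 4 + 4 * m ^ 4 + (1 + 11 * |κ|) * 4 * (m ^ 4 / N) * (2 * N / 1) := by gcongr
      _ = _ := by field_simp; ring
  · have : ContinuousOn (fun t => κ / Real.sin t ^ 2) (Icc a b) :=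
      continuousOn_const.div (by fun_prop) fun x hx => (pow_pos (hsin x hx) 2).ne'
    exact ContinuousOn.div (by fun_prop) (by fun_prop) fun x hx => (pow_pos (hsin x hx) 2).ne'
  · exact (ContinuousOn.div (by fun_prop) (by fun_prop) fun x hx => (hsin x hx).ne').neg
  · intro t ht
    have hs := hsin t ht
    have e : ((-u t ^ 4 + 3 * F t ^ 2 / (8 * N ^ 4) - κ / Real.sin t ^ 2 * S t) * Real.sin t
      - Z t * Real.cos t) / Real.sin t ^ 2
        - -((u t ^ 4 - 3 * F₀ ^ 2 / (8 * N ^ 4)) / Real.sin t)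
        -- Three errors: freezing F at its equatorial value, the κ-term, and the derivative of
        -- 1/sin. Each is O(m⁴/(N sin²)), and the integral of this from a ≥ 1/(2N) is O(m⁴).
        = 3 / (8 * N ^ 4) * ((F t - F₀) * (F t + F₀)) * (1 / Real.sin t)
          - κ * S t * (1 / Real.sin t) ^ 3 - Z t * Real.cos t * (1 / Real.sin t) ^ 2 := by
      field_simp; ring
    have hi := hinv t ht
    have hi0 : 0 < 1 / Real.sin t := by positivity
    have hE := h.abs_energy_sub_le hN hu hv (hIcc t ht)
    have hE2 : |F t + F₀| ≤ 4 * N ^ 2 * m ^ 2 := by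
      have hpi : Real.pi / 2 ∈ Icc (1 / (2 * N)) (Real.pi / 2) :=
        ⟨(hIcc t ht).1.trans (hIcc t ht).2, le_rfl⟩
      rw [abs_of_nonneg (add_nonneg (hF0 _) (hF0 _))]
      linarith [hFb t (hIcc t ht), hFb _ hpi]
    have hc := Real.abs_cos_le_one t
    have hi2 : (1 / Real.sin t) ^ 2 ≤ 4 * t ^ (-1 - 1 : ℝ) := by
      have ht0 := (hsub t ht).1
      rw [show (-1 - 1 : ℝ) = ((-2 : ℤ) : ℝ) by norm_num, Real.rpow_intCast, zpow_neg, zpow_ofNat]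
      have : 1 / Real.sin t ≤ 2 / t := by
        rw [div_le_div_iff₀ hs ht0]; linarith [hhalf t ht]
      calc (1 / Real.sin t) ^ 2 ≤ (2 / t) ^ 2 := by gcongr
        _ = _ := by field_simp; norm_num
    rw [e]
    calc _ ≤ 3 / (8 * N ^ 4) * (|F t - F₀| * |F t + F₀|) * (1 / Real.sin t)
          + |κ| * |S t| * (1 / Real.sin t) ^ 3 + |Z t| * |Real.cos t| * (1 / Real.sin t) ^ 2 := by
          refine (abs_sub _ _).trans ?_
          gcongr
          · refine (abs_sub _ _).trans (le_of_eq ?_)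
            rw [abs_mul, abs_mul, abs_mul, abs_mul (κ * S t), abs_mul κ, abs_pow, abs_of_pos hi0,
              abs_of_pos (by positivity : 0 < 3 / (8 * N ^ 4))]
          · rw [abs_mul, abs_mul, abs_pow, abs_of_pos hi0]
      _ ≤ 3 / (8 * N ^ 4) * (2 * |κ| * N * m ^ 2 / Real.sin t * (4 * N ^ 2 * m ^ 2))
            * (1 / Real.sin t)
          + |κ| * (2 * (m ^ 4 / N ^ 2)) * ((4 * N) * (1 / Real.sin t) ^ 2)
          + m ^ 4 / N * 1 * (1 / Real.sin t) ^ 2 := by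
          have h3 : (1 / Real.sin t) ^ 3 ≤ (4 * N) * (1 / Real.sin t) ^ 2 := by
            rw [pow_succ' _ 2]; gcongr
          gcongr
          · exact hSb t ht
          · exact hZb t ht
      _ = (1 + 11 * |κ|) * (m ^ 4 / N) * (1 / Real.sin t) ^ 2 := by
          field_simp; ring
      _ ≤ (1 + 11 * |κ|) * (m ^ 4 / N) * (4 * t ^ (-1 - 1 : ℝ)) := by gcongr
      _ = _ := by ring

end IsOscillator

/-! ### Liouville normal form of the Gegenbauer equation and its amplitude. -/

/-- The exponent `(d - 1) / 2`. -/
noncomputable def gegenbauerExp (d : ℕ) : ℝ := ((d : ℝ) - 1) / 2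

/-- The Liouville normal form of `gegenbauerAngle`. -/
noncomputable def gegenbauerOsc (d l : ℕ) (t : ℝ) : ℝ :=
  Real.sin t ^ gegenbauerExp d * gegenbauerAngle d l t

/-- The derivative of `gegenbauerOsc`. -/
noncomputable def gegenbauerOscDeriv (d l : ℕ) (t : ℝ) : ℝ :=
  Real.sin t ^ gegenbauerExp d * (gegenbauerAngleDeriv d l t
    + gegenbauerExp d * (Real.cos t / Real.sin t) * gegenbauerAngle d l t)

theorem half_le_gegenbauerExp {d : ℕ} (hd : 2 ≤ d) : 1 / 2 ≤ gegenbauerExp d := by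
  have hd' : (2 : ℝ) ≤ d := by exact_mod_cast hd
  unfold gegenbauerExp; linarith

theorem gegenbauerFreq_eq (d l : ℕ) : gegenbauerFreq d l = l + gegenbauerExp d := rfl

theorem half_le_gegenbauerFreq {d : ℕ} (hd : 2 ≤ d) (l : ℕ) : 1 / 2 ≤ gegenbauerFreq d l := by
  have := half_le_gegenbauerExp hd
  rw [gegenbauerFreq_eq]
  linarith [(Nat.cast_nonneg l : (0 : ℝ) ≤ l)]

theorem rpow_two_mul_gegenbauerExp {d : ℕ} (hd : 2 ≤ d) {x : ℝ} (hx : 0 ≤ x) :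
    (x ^ gegenbauerExp d) ^ 2 = x ^ (d - 1) := by
  rw [← Real.rpow_natCast (x ^ gegenbauerExp d), ← Real.rpow_mul hx, ← Real.rpow_natCast x]
  congr 1
  rw [gegenbauerExp]
  push_cast [Nat.cast_sub (by omega : 1 ≤ d)]
  ring

/-- The factor sin^p with p = (d - 1)/2 removes the first-order term. Completing the square, l(l + d
- 1) + p² = N², leaves the potential p(1 - p)/sin². -/
theorem gegenbauerOsc_isOscillator {d : ℕ} (hd : 2 ≤ d) (l : ℕ) :
    IsOscillator (gegenbauerFreq d l) (gegenbauerExp d * (1 - gegenbauerExp d))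
      (gegenbauerOsc d l) (gegenbauerOscDeriv d l) where
  hasDerivAt_left t ht := by
    have hs := Real.sin_pos_of_mem_Ioo ht
    refine (((Real.hasDerivAt_sin t).rpow_const (Or.inl hs.ne')).mul
      (gegenbauerAngle_hasDerivAt d l t)).congr_deriv ?_
    rw [Real.rpow_sub_one hs.ne', gegenbauerOscDeriv]
    field_simp
    ring
  hasDerivAt_right t ht := by
    have hs := Real.sin_pos_of_mem_Ioo ht
    have h1 := gegenbauerAngle_hasDerivAt d l t
    have h2 := gegenbauerAngleDeriv_hasDerivAt (by omega : 0 < d) l hs.ne'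
    refine (((Real.hasDerivAt_sin t).rpow_const (p := gegenbauerExp d) (Or.inl hs.ne')).mul
      (h2.add (((hasDerivAt_cot hs.ne').const_mul (gegenbauerExp d)).mul h1))).congr_deriv ?_
    have hN := gegenbauerFreq_sq d l
    rw [hN, gegenbauerOsc, Real.rpow_sub_one hs.ne']
    simp only [Pi.add_apply, Pi.mul_apply, gegenbauerExp]
    have hsc := Real.sin_sq_add_cos_sq t
    generalize Real.sin t ^ (((d : ℝ) - 1) / 2) = S at *
    field_simp
    linear_combination (S * gegenbauerAngle d l t * ((d : ℝ) - 1) * (d - 1)) * hsc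

/-- Amplitude constant for `gegenbauerOsc`. -/
noncomputable def gegenbauerAmp (d : ℕ) : ℝ :=
  √(Real.exp (2 * |gegenbauerExp d * (1 - gegenbauerExp d)|)
    * ((1 + 2 * gegenbauerExp d) ^ 2 + 1))

theorem one_le_gegenbauerAmp (d : ℕ) : 1 ≤ gegenbauerAmp d := by
  rw [gegenbauerAmp, Real.one_le_sqrt]
  have h1 : 1 ≤ Real.exp (2 * |gegenbauerExp d * (1 - gegenbauerExp d)|) :=
    Real.one_le_exp (by positivity)
  nlinarith [sq_nonneg (1 + 2 * gegenbauerExp d)]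

theorem inv_freq_mem {d : ℕ} (hd : 2 ≤ d) (l : ℕ) :
    1 / (2 * gegenbauerFreq d l) ∈ Icc (1 / (2 * gegenbauerFreq d l)) (Real.pi / 2) := by
  have h := half_le_gegenbauerFreq hd l
  refine ⟨le_rfl, ?_⟩
  rw [div_le_iff₀ (by linarith)]
  nlinarith [Real.pi_gt_three]

/-- The energy is estimated at 1/(2N), where |y| ≤ 1, |y'| ≤ N, cot ≤ 2N and sin^p ≤ N^(-p), and is
then transported by `IsOscillator.energy_le`. The exponential in `gegenbauerAmp` is the cost of the
transport. -/
theorem gegenbauerOsc_energy_le {d : ℕ} (hd : 2 ≤ d) (l : ℕ) {t : ℝ}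
    (ht : t ∈ Icc (1 / (2 * gegenbauerFreq d l)) (Real.pi / 2)) :
    oscillatorEnergy (gegenbauerFreq d l) (gegenbauerOsc d l) (gegenbauerOscDeriv d l) t
      ≤ (gegenbauerFreq d l * (gegenbauerAmp d * gegenbauerFreq d l ^ (-gegenbauerExp d))) ^ 2 := by
  have hN := gegenbauerFreq_pos hd l
  have hp := half_le_gegenbauerExp hd
  have hp0 : 0 < gegenbauerExp d := by linarith
  have hmem := inv_freq_mem hd l
  refine ((gegenbauerOsc_isOscillator hd l).energy_le hN hmem ht).trans ?_
  set N := gegenbauerFreq d l with hNdef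
  set p := gegenbauerExp d with hpdef
  set t₀ := 1 / (2 * N) with ht₀
  have ht0 : 0 < t₀ := by positivity
  have hmem' : t₀ ∈ Icc 0 (Real.pi / 2) := ⟨ht0.le, hmem.2⟩
  have hs : 0 < Real.sin t₀ := Real.sin_pos_of_pos_of_lt_pi ht0 (by linarith [hmem.2, Real.pi_pos])
  have hc : 0 ≤ Real.cos t₀ := Real.cos_nonneg_of_mem_Icc ⟨by linarith [Real.pi_pos], hmem.2⟩
  have hcot := cot_le_inv ht0 hmem.2
  have hy := abs_gegenbauerAngle_le_one hd l hmem'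
  have hy' := abs_gegenbauerAngleDeriv_le hd l hmem'
  have hsp : Real.sin t₀ ^ p ≤ N ^ (-p) := by
    rw [Real.rpow_neg hN.le, ← Real.inv_rpow hN.le]
    refine Real.rpow_le_rpow hs.le ((Real.sin_le ht0.le).trans ?_) hp0.le
    rw [ht₀, ← one_div]
    exact one_div_le_one_div_of_le hN (by linarith)
  have hsp0 : 0 < Real.sin t₀ ^ p := Real.rpow_pos_of_pos hs _
  have hNp : 0 < N ^ (-p) := Real.rpow_pos_of_pos hN _
  have hu : |gegenbauerOsc d l t₀| ≤ N ^ (-p) := by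
    rw [gegenbauerOsc, abs_mul, abs_of_pos hsp0]
    calc _ ≤ N ^ (-p) * 1 := by gcongr
      _ = _ := mul_one _
  have hv : |gegenbauerOscDeriv d l t₀| ≤ N ^ (-p) * (N * (1 + 2 * p)) := by
    rw [gegenbauerOscDeriv, abs_mul, abs_of_pos hsp0]
    gcongr
    refine (abs_add_le _ _).trans ?_
    rw [abs_mul, abs_mul, abs_of_pos hp0, abs_of_nonneg (div_nonneg hc hs.le)]
    have h1 : Real.cos t₀ / Real.sin t₀ ≤ 2 * N := by
      refine hcot.trans (le_of_eq ?_)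
      rw [ht₀, one_div_one_div]
    calc _ ≤ N + p * (2 * N) * 1 := by gcongr
      _ = _ := by ring
  have hE : oscillatorEnergy N (gegenbauerOsc d l) (gegenbauerOscDeriv d l) t₀
      ≤ (N * N ^ (-p)) ^ 2 * ((1 + 2 * p) ^ 2 + 1) := by
    rw [oscillatorEnergy, ← sq_abs (gegenbauerOscDeriv d l t₀), ← sq_abs (gegenbauerOsc d l t₀)]
    calc _ ≤ (N ^ (-p) * (N * (1 + 2 * p))) ^ 2 + N ^ 2 * (N ^ (-p)) ^ 2 := by gcongr
      _ = _ := by ring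
  have hA : gegenbauerAmp d ^ 2 = Real.exp (2 * |p * (1 - p)|) * ((1 + 2 * p) ^ 2 + 1) :=
    Real.sq_sqrt (by positivity)
  calc _ ≤ Real.exp (2 * |p * (1 - p)|) * ((N * N ^ (-p)) ^ 2 * ((1 + 2 * p) ^ 2 + 1)) := by
        gcongr
    _ = (N * N ^ (-p)) ^ 2 * gegenbauerAmp d ^ 2 := by rw [hA]; ring
    _ = _ := by ring

theorem abs_gegenbauerOsc_le {d : ℕ} (hd : 2 ≤ d) (l : ℕ) {t : ℝ}
    (ht : t ∈ Icc (1 / (2 * gegenbauerFreq d l)) (Real.pi / 2)) :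
    |gegenbauerOsc d l t| ≤ gegenbauerAmp d * gegenbauerFreq d l ^ (-gegenbauerExp d) := by
  have hN := gegenbauerFreq_pos hd l
  have h := gegenbauerOsc_energy_le hd l ht
  have hA := one_le_gegenbauerAmp d
  have hm : 0 ≤ gegenbauerAmp d * gegenbauerFreq d l ^ (-gegenbauerExp d) := by positivity
  rw [oscillatorEnergy] at h
  have h2 : (gegenbauerFreq d l * gegenbauerOsc d l t) ^ 2
      ≤ (gegenbauerFreq d l * (gegenbauerAmp d * gegenbauerFreq d l ^ (-gegenbauerExp d))) ^ 2 := by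
    rw [mul_pow]; linarith [sq_nonneg (gegenbauerOscDeriv d l t)]
  have h3 := abs_le_of_sq_le_sq h2 (by positivity)
  rw [abs_mul, abs_of_pos hN] at h3
  exact le_of_mul_le_mul_left h3 hN

theorem abs_gegenbauerOscDeriv_le {d : ℕ} (hd : 2 ≤ d) (l : ℕ) {t : ℝ}
    (ht : t ∈ Icc (1 / (2 * gegenbauerFreq d l)) (Real.pi / 2)) :
    |gegenbauerOscDeriv d l t|
      ≤ gegenbauerFreq d l * (gegenbauerAmp d * gegenbauerFreq d l ^ (-gegenbauerExp d)) := by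
  have hN := gegenbauerFreq_pos hd l
  have h := gegenbauerOsc_energy_le hd l ht
  have hA := one_le_gegenbauerAmp d
  rw [oscillatorEnergy] at h
  refine abs_le_of_sq_le_sq ?_ (by positivity)
  have : 0 ≤ gegenbauerFreq d l ^ 2 * gegenbauerOsc d l t ^ 2 := by positivity
  linarith

/-- At 1/(2N) one has y ≥ 1/2 and sin ≥ 1/(4N), which bounds the energy below there; transport to
the equator costs only a constant factor. -/
theorem exists_le_energy {d : ℕ} (hd : 2 ≤ d) : ∃ c : ℝ, 0 < c ∧ ∀ l : ℕ,
    c * (gegenbauerFreq d l * gegenbauerFreq d l ^ (-gegenbauerExp d)) ^ 2 ≤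
      oscillatorEnergy (gegenbauerFreq d l) (gegenbauerOsc d l) (gegenbauerOscDeriv d l)
        (Real.pi / 2) := by
  have hp := half_le_gegenbauerExp hd
  have hp0 : 0 < gegenbauerExp d := by linarith
  refine ⟨((1 / 4) ^ gegenbauerExp d / 2) ^ 2
    / Real.exp (2 * |gegenbauerExp d * (1 - gegenbauerExp d)|), by positivity, fun l => ?_⟩
  have hN := gegenbauerFreq_pos hd l
  have hmem := inv_freq_mem hd l
  have h := (gegenbauerOsc_isOscillator hd l).energy_le hN (s := Real.pi / 2)
    ⟨hmem.2, le_rfl⟩ hmem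
  rw [div_mul_eq_mul_div, div_le_iff₀ (Real.exp_pos _), mul_comm (oscillatorEnergy _ _ _ _)]
  refine le_trans ?_ h
  set N := gegenbauerFreq d l with hNdef
  set p := gegenbauerExp d with hpdef
  set t₀ := 1 / (2 * N) with ht₀
  have ht0 : 0 < t₀ := by positivity
  have hmem' : t₀ ∈ Icc 0 (Real.pi / 2) := ⟨ht0.le, hmem.2⟩
  have hy : 1 / 2 ≤ gegenbauerAngle d l t₀ := by
    have := one_sub_le_gegenbauerAngle hd l hmem'
    have e : N * t₀ = 1 / 2 := by rw [ht₀]; field_simp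
    rw [← hNdef, e] at this
    linarith
  have hs : t₀ / 2 ≤ Real.sin t₀ := half_le_sin ht0.le hmem.2
  have hsp : (1 / 4) ^ p * N ^ (-p) ≤ Real.sin t₀ ^ p := by
    rw [Real.rpow_neg hN.le, ← Real.inv_rpow hN.le, ← Real.mul_rpow (by norm_num) (by positivity)]
    refine Real.rpow_le_rpow (by positivity) (le_trans (le_of_eq ?_) hs) hp0.le
    rw [ht₀]; field_simp; norm_num
  have hu : (1 / 4) ^ p * N ^ (-p) * (1 / 2) ≤ gegenbauerOsc d l t₀ := by
    have hs0 : 0 ≤ Real.sin t₀ := (by positivity : 0 ≤ t₀ / 2).trans hs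
    exact mul_le_mul hsp hy (by norm_num) (Real.rpow_nonneg hs0 _)
  rw [oscillatorEnergy]
  have h2 : ((1 / 4) ^ p * N ^ (-p) * (1 / 2)) ^ 2 ≤ gegenbauerOsc d l t₀ ^ 2 := by gcongr
  calc _ = N ^ 2 * ((1 / 4) ^ p * N ^ (-p) * (1 / 2)) ^ 2 := by ring
    _ ≤ N ^ 2 * gegenbauerOsc d l t₀ ^ 2 := by gcongr
    _ ≤ _ := by linarith [sq_nonneg (gegenbauerOscDeriv d l t₀)]

/-! ### Rescaling by the frequency and tail bounds uniform in the degree. -/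

/-- `gegenbauerAngle` at the scale of its oscillations. -/
noncomputable def gegenbauerScaled (d l : ℕ) (x : ℝ) : ℝ :=
  gegenbauerAngle d l (x / gegenbauerFreq d l)

/-- The rescaled sine. -/
noncomputable def sinScaled (d l : ℕ) (x : ℝ) : ℝ :=
  gegenbauerFreq d l * Real.sin (x / gegenbauerFreq d l)

theorem gegenbauerScaled_continuous (d l : ℕ) : Continuous (gegenbauerScaled d l) :=
  (gegenbauerAngle_continuous d l).comp (continuous_id.div_const _)

theorem sinScaled_continuous (d l : ℕ) : Continuous (sinScaled d l) := by
  unfold sinScaled; fun_prop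

theorem div_freq_mem {d : ℕ} (hd : 2 ≤ d) {l : ℕ} {x : ℝ}
    (hx : x ∈ Icc 0 (Real.pi / 2 * gegenbauerFreq d l)) :
    x / gegenbauerFreq d l ∈ Icc 0 (Real.pi / 2) := by
  have hN := gegenbauerFreq_pos hd l
  exact ⟨div_nonneg hx.1 hN.le, (div_le_iff₀ hN).2 hx.2⟩

theorem abs_gegenbauerScaled_le_one {d : ℕ} (hd : 2 ≤ d) {l : ℕ} {x : ℝ}
    (hx : x ∈ Icc 0 (Real.pi / 2 * gegenbauerFreq d l)) : |gegenbauerScaled d l x| ≤ 1 :=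
  abs_gegenbauerAngle_le_one hd l (div_freq_mem hd hx)

theorem sinScaled_le {d : ℕ} (hd : 2 ≤ d) {l : ℕ} {x : ℝ} (hx : 0 ≤ x) :
    sinScaled d l x ≤ x := by
  have hN := gegenbauerFreq_pos hd l
  calc sinScaled d l x ≤ gegenbauerFreq d l * (x / gegenbauerFreq d l) := by
        unfold sinScaled
        gcongr
        exact Real.sin_le (div_nonneg hx hN.le)
    _ = x := by field_simp

theorem half_le_sinScaled {d : ℕ} (hd : 2 ≤ d) {l : ℕ} {x : ℝ}
    (hx : x ∈ Icc 0 (Real.pi / 2 * gegenbauerFreq d l)) : x / 2 ≤ sinScaled d l x := by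
  have hN := gegenbauerFreq_pos hd l
  have h := div_freq_mem hd hx
  calc x / 2 = gegenbauerFreq d l * (x / gegenbauerFreq d l / 2) := by field_simp
    _ ≤ _ := by
      unfold sinScaled
      have := half_le_sin h.1 h.2
      gcongr

theorem gegenbauerOsc_scaled {d : ℕ} (hd : 2 ≤ d) {l : ℕ} {x : ℝ}
    (hx : x ∈ Icc 0 (Real.pi / 2 * gegenbauerFreq d l)) :
    gegenbauerOsc d l (x / gegenbauerFreq d l)
      = gegenbauerFreq d l ^ (-gegenbauerExp d)
        * (sinScaled d l x ^ gegenbauerExp d * gegenbauerScaled d l x) := by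
  have hN := gegenbauerFreq_pos hd l
  have h := div_freq_mem hd hx
  have hs : 0 ≤ Real.sin (x / gegenbauerFreq d l) :=
    (by linarith [h.1] : (0 : ℝ) ≤ x / gegenbauerFreq d l / 2).trans (half_le_sin h.1 h.2)
  rw [gegenbauerOsc, sinScaled, gegenbauerScaled, Real.mul_rpow hN.le hs, Real.rpow_neg hN.le]
  have := Real.rpow_pos_of_pos hN (gegenbauerExp d)
  field_simp

/-- In the variable x = Nt the range t ≥ 1/(2N) becomes x ≥ 1/2, and the powers of N cancel, so the
bound no longer depends on l. -/
theorem abs_gegenbauerScaled_mul_le {d : ℕ} (hd : 2 ≤ d) {l : ℕ} {x : ℝ}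
    (hx : x ∈ Icc (1 / 2) (Real.pi / 2 * gegenbauerFreq d l)) :
    sinScaled d l x ^ gegenbauerExp d * |gegenbauerScaled d l x| ≤ gegenbauerAmp d := by
  have hN := gegenbauerFreq_pos hd l
  have hx' : x ∈ Icc 0 (Real.pi / 2 * gegenbauerFreq d l) := ⟨by linarith [hx.1], hx.2⟩
  have hs : 0 ≤ sinScaled d l x := by linarith [half_le_sinScaled hd hx', hx'.1]
  have h := abs_gegenbauerOsc_le hd l (t := x / gegenbauerFreq d l)
    ⟨by rw [div_le_div_iff₀ (by positivity) hN]; nlinarith [hx.1], (div_freq_mem hd hx').2⟩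
  rw [gegenbauerOsc_scaled hd hx', abs_mul, abs_mul, abs_of_nonneg (Real.rpow_nonneg hs _),
    abs_of_pos (Real.rpow_pos_of_pos hN _), mul_comm (gegenbauerAmp d)] at h
  exact le_of_mul_le_mul_left h (Real.rpow_pos_of_pos hN _)

theorem abs_gegenbauerScaled_le {d : ℕ} (hd : 2 ≤ d) {l : ℕ} {x : ℝ}
    (hx : x ∈ Icc (1 / 2) (Real.pi / 2 * gegenbauerFreq d l)) :
    |gegenbauerScaled d l x| ≤ gegenbauerAmp d * 2 ^ gegenbauerExp d * x ^ (-gegenbauerExp d) := by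
  have hx0 : 0 < x := by linarith [hx.1]
  have hx' : x ∈ Icc 0 (Real.pi / 2 * gegenbauerFreq d l) := ⟨hx0.le, hx.2⟩
  have hp := half_le_gegenbauerExp hd
  have h1 := abs_gegenbauerScaled_mul_le hd hx
  have h2 : (x / 2) ^ gegenbauerExp d ≤ sinScaled d l x ^ gegenbauerExp d :=
    Real.rpow_le_rpow (by positivity) (half_le_sinScaled hd hx') (by linarith)
  have h3 := (mul_le_mul_of_nonneg_right h2 (abs_nonneg (gegenbauerScaled d l x))).trans h1
  rw [Real.div_rpow hx0.le two_pos.le] at h3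
  rw [Real.rpow_neg hx0.le]
  have := Real.rpow_pos_of_pos hx0 (gegenbauerExp d)
  have h4 := Real.rpow_pos_of_pos (two_pos (α := ℝ)) (gegenbauerExp d)
  rw [← div_eq_mul_inv, le_div_iff₀ this]
  rw [div_mul_eq_mul_div, div_le_iff₀ h4] at h3
  linarith

/-- The rescaled moment integrand. -/
noncomputable def scaledIntegrand (d q l : ℕ) (x : ℝ) : ℝ :=
  gegenbauerScaled d l x ^ q * sinScaled d l x ^ (d - 1)

theorem scaledIntegrand_continuous (d q l : ℕ) : Continuous (scaledIntegrand d q l) :=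
  ((gegenbauerScaled_continuous d l).pow q).mul ((sinScaled_continuous d l).pow _)

theorem gegenbauerMoment_eq_scaled {d : ℕ} (hd : 2 ≤ d) (q l : ℕ) :
    gegenbauerMoment d q l = (∫ x in (0 : ℝ)..(Real.pi / 2 * gegenbauerFreq d l),
      scaledIntegrand d q l x) / gegenbauerFreq d l ^ d := by
  have hN := gegenbauerFreq_pos hd l
  have h := intervalIntegral.integral_comp_div (a := 0) (b := Real.pi / 2 * gegenbauerFreq d l)
    (fun t => gegenbauerAngle d l t ^ q * Real.sin t ^ (d - 1)) hN.ne'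
  rw [zero_div, mul_div_cancel_right₀ _ hN.ne', ← gegenbauerMoment_eq (by omega : 0 < d),
    smul_eq_mul] at h
  have e : ∀ x, scaledIntegrand d q l x = gegenbauerFreq d l ^ (d - 1)
      * (gegenbauerAngle d l (x / gegenbauerFreq d l) ^ q
        * Real.sin (x / gegenbauerFreq d l) ^ (d - 1)) := by
    intro x
    rw [scaledIntegrand, gegenbauerScaled, sinScaled, mul_pow]; ring
  simp only [e, intervalIntegral.integral_const_mul]
  rw [h, eq_div_iff (by positivity), ← mul_assoc, ← pow_succ, Nat.sub_add_cancel (by omega),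
    mul_comm]

/-- The decay x^(-pq) meets the volume factor x^(d-1) = x^(2p). The bound is integrable at infinity
exactly when (q - 2)p > 1. -/
theorem abs_scaledIntegrand_le_rpow {d : ℕ} (hd : 2 ≤ d) (q : ℕ) {l : ℕ} {x : ℝ}
    (hx : x ∈ Icc (1 / 2) (Real.pi / 2 * gegenbauerFreq d l)) :
    |scaledIntegrand d q l x| ≤ (gegenbauerAmp d * 2 ^ gegenbauerExp d) ^ q
      * x ^ (-(q - 2) * gegenbauerExp d) := by
  have hx0 : 0 < x := by linarith [hx.1]
  have hx' : x ∈ Icc 0 (Real.pi / 2 * gegenbauerFreq d l) := ⟨hx0.le, hx.2⟩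
  have hs : 0 ≤ sinScaled d l x := by linarith [half_le_sinScaled hd hx', hx'.1]
  have hA := one_le_gegenbauerAmp d
  rw [scaledIntegrand, abs_mul, abs_pow, abs_of_nonneg (pow_nonneg hs _)]
  calc _ ≤ (gegenbauerAmp d * 2 ^ gegenbauerExp d * x ^ (-gegenbauerExp d)) ^ q
        * x ^ (d - 1) := by
        have h1 := abs_gegenbauerScaled_le hd hx
        have h2 := sinScaled_le hd (l := l) hx0.le
        gcongr
    _ = _ := by
        rw [mul_pow, ← rpow_two_mul_gegenbauerExp hd hx0.le, ← Real.rpow_natCast _ 2,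
          ← Real.rpow_natCast (x ^ (-gegenbauerExp d)), ← Real.rpow_mul hx0.le,
          ← Real.rpow_mul hx0.le, mul_assoc, ← Real.rpow_add hx0]
        congr 2
        push_cast; ring

theorem integral_scaled_eq {d : ℕ} (hd : 2 ≤ d) (l : ℕ) (a b : ℝ) (f g : ℝ → ℝ) (c : ℝ)
    (h : ∀ x ∈ uIcc a b, f x = c * g (x / gegenbauerFreq d l)) :
    ∫ x in a..b, f x = c * gegenbauerFreq d l
      * ∫ t in (a / gegenbauerFreq d l)..(b / gegenbauerFreq d l), g t := by
  rw [intervalIntegral.integral_congr h, intervalIntegral.integral_const_mul,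
    intervalIntegral.integral_comp_div g (gegenbauerFreq_pos hd l).ne', smul_eq_mul, mul_assoc]

/-- Since d - 1 = 2p, the integrand y³ sin^(d-1) equals u³ sin^(-p), to which the cubic cancellation
applies. It works for every d ≥ 2, with decay exponent r = p. -/
theorem exists_cubic_tail_bound {d : ℕ} (hd : 2 ≤ d) : ∃ C r : ℝ, 0 ≤ C ∧ 0 < r ∧
    ∀ l : ℕ, ∀ a b : ℝ, 1 / 2 ≤ a → a ≤ b → b ≤ Real.pi / 2 * gegenbauerFreq d l →
      |∫ x in a..b, scaledIntegrand d 3 l x| ≤ C * a ^ (-r) := by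
  have hp := half_le_gegenbauerExp hd
  have hp0 : 0 < gegenbauerExp d := by linarith
  set p := gegenbauerExp d with hpdef
  have hA := one_le_gegenbauerAmp d
  refine ⟨2 ^ (p + 1) * ((12 * |p * (1 - p)| + 2 * p) / p + 2) * gegenbauerAmp d ^ 3, p,
    by positivity, hp0, fun l a b ha hab hb => ?_⟩
  have hN := gegenbauerFreq_pos hd l
  set N := gegenbauerFreq d l with hNdef
  have ha0 : 0 < a := by linarith
  have hinv : 1 / (2 * N) ≤ a / N := by
    rw [div_le_div_iff₀ (by positivity) hN]; nlinarith
  have hpow : N ^ p * N ^ (-p) = 1 := by rw [← Real.rpow_add hN]; simp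
  have hNp : N ^ (d - 1) = (N ^ p) ^ 2 := (rpow_two_mul_gegenbauerExp hd hN.le).symm
  have h := integral_scaled_eq hd l a b (scaledIntegrand d 3 l)
    (fun t => gegenbauerOsc d l t ^ 3 * Real.sin t ^ (-p)) ((N ^ p) ^ 2) ?_
  · have h2 := (gegenbauerOsc_isOscillator hd l).abs_integral_cube_le hN hp0
      (m := gegenbauerAmp d * N ^ (-p)) (by positivity) hinv
      (div_le_div_of_nonneg_right hab hN.le) ((div_le_iff₀ hN).2 hb)
      (fun t ht => abs_gegenbauerOsc_le hd l ⟨hinv.trans ht.1, ht.2.trans ((div_le_iff₀ hN).2 hb)⟩)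
      (fun t ht => abs_gegenbauerOscDeriv_le hd l
        ⟨hinv.trans ht.1, ht.2.trans ((div_le_iff₀ hN).2 hb)⟩)
    rw [h, abs_mul, abs_of_pos (by positivity)]
    refine (mul_le_mul_of_nonneg_left h2 (by positivity)).trans (le_of_eq ?_)
    have e1 : (a / N) ^ (-p) = a ^ (-p) * N ^ p := by
      rw [Real.div_rpow ha0.le hN.le, Real.rpow_neg hN.le, div_inv_eq_mul]
    rw [e1]
    have : (N ^ p) ^ 2 * N * (2 ^ (p + 1) * ((12 * |p * (1 - p)| + 2 * p) / p + 2)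
        * ((gegenbauerAmp d * N ^ (-p)) ^ 3 / N * (a ^ (-p) * N ^ p)))
        = 2 ^ (p + 1) * ((12 * |p * (1 - p)| + 2 * p) / p + 2) * gegenbauerAmp d ^ 3 * a ^ (-p)
          * (N ^ p * N ^ (-p)) ^ 3 := by
      field_simp
    rw [this, hpow]; ring
  · intro x hx
    rw [uIcc_of_le hab] at hx
    have hx' : x ∈ Icc 0 (Real.pi / 2 * N) := ⟨by linarith [hx.1], hx.2.trans hb⟩
    have hm := div_freq_mem hd hx'
    have hs : 0 < Real.sin (x / N) := lt_of_lt_of_le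
      (by have : 0 < x := by linarith [hx.1]
          positivity) (half_le_sin hm.1 hm.2)
    simp only [scaledIntegrand, gegenbauerOsc, gegenbauerScaled, sinScaled, mul_pow]
    rw [← rpow_two_mul_gegenbauerExp hd hs.le, hNp, Real.rpow_neg hs.le, ← hpdef, ← hNdef]
    have := Real.rpow_pos_of_pos hs p
    field_simp

theorem exists_absolute_tail_bound {d q : ℕ} (hd : 2 ≤ d)
    (h : 1 < ((q : ℝ) - 2) * gegenbauerExp d) : ∃ C r : ℝ, 0 ≤ C ∧ 0 < r ∧
    ∀ l : ℕ, ∀ a b : ℝ, 1 / 2 ≤ a → a ≤ b → b ≤ Real.pi / 2 * gegenbauerFreq d l →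
      |∫ x in a..b, scaledIntegrand d q l x| ≤ C * a ^ (-r) := by
  set r := ((q : ℝ) - 2) * gegenbauerExp d - 1 with hr
  have hr0 : 0 < r := by linarith
  have hA := one_le_gegenbauerAmp d
  refine ⟨(gegenbauerAmp d * 2 ^ gegenbauerExp d) ^ q / r, r, by positivity, hr0,
    fun l a b ha hab hb => ?_⟩
  -- With the zero primitive the whole integrand counts as error, and only the power bound is used.
  have := abs_integral_le_of_primitive (g := 0) (g' := 0) (h := scaledIntegrand d q l)
    (C := (gegenbauerAmp d * 2 ^ gegenbauerExp d) ^ q) (a := a) (b := b) (p := r)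
    (by linarith) hab hr0 (by positivity) (fun t _ => hasDerivAt_const t 0)
    continuousOn_const (scaledIntegrand_continuous d q l).continuousOn ?_
  · refine this.trans (le_of_eq ?_)
    simp; ring
  · intro t ht
    have := abs_scaledIntegrand_le_rpow hd q (l := l) (x := t) ⟨ha.trans ht.1, ht.2.trans hb⟩
    simp only [Pi.zero_apply, zero_sub, abs_neg]
    convert this using 3
    rw [hr]; ring

/-- The exponent is chosen so that y⁴ sin^(2d-3) = u⁴/sin, because 4p - 1 = 2d - 3. The mean of u⁴
is bounded below through the equatorial energy, and 1/sin t ≥ 1/t supplies the logarithm. -/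
theorem exists_quartic_lower_bound {d : ℕ} (hd : 2 ≤ d) : ∃ c C : ℝ, 0 < c ∧
    ∀ l : ℕ, ∀ a b : ℝ, 1 / 2 ≤ a → a ≤ b → b ≤ Real.pi / 2 * gegenbauerFreq d l →
      c * Real.log (b / a) - C ≤
        ∫ x in a..b, gegenbauerScaled d l x ^ 4 * sinScaled d l x ^ (2 * d - 3) := by
  obtain ⟨c, hc, hE⟩ := exists_le_energy hd
  set p := gegenbauerExp d with hpdef
  set κ := p * (1 - p) with hκ
  refine ⟨3 * c ^ 2 / 8, (16 + 88 * |κ|) * gegenbauerAmp d ^ 4, by positivity,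
    fun l a b ha hab hb => ?_⟩
  have hN := gegenbauerFreq_pos hd l
  have hEl := hE l
  have hosc := gegenbauerOsc_isOscillator hd l
  set N := gegenbauerFreq d l with hNdef
  set F := oscillatorEnergy N (gegenbauerOsc d l) (gegenbauerOscDeriv d l) (Real.pi / 2) with hF
  have ha0 : 0 < a := by linarith
  have hinv : 1 / (2 * N) ≤ a / N := by
    rw [div_le_div_iff₀ (by positivity) hN]; nlinarith
  have hbN : b / N ≤ Real.pi / 2 := (div_le_iff₀ hN).2 hb
  have habN : a / N ≤ b / N := div_le_div_of_nonneg_right hab hN.le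
  have hpow : N ^ p * N ^ (-p) = 1 := by rw [← Real.rpow_add hN]; simp
  have hNp : N ^ (d - 1) = (N ^ p) ^ 2 := (rpow_two_mul_gegenbauerExp hd hN.le).symm
  have hsin : ∀ x ∈ Icc (a / N) (b / N), 0 < Real.sin x := fun x hx =>
    Real.sin_pos_of_pos_of_lt_pi ((by positivity : 0 < a / N).trans_le hx.1)
      (by linarith [hx.2, Real.pi_pos])
  have hsub : ∀ x ∈ Icc (a / N) (b / N), x ∈ Ioo 0 Real.pi := fun x hx =>
    ⟨(by positivity : 0 < a / N).trans_le hx.1, by linarith [hx.2, Real.pi_pos]⟩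
  have hexp : ∀ s : ℝ, 0 < s → s ^ (2 * d - 3) = (s ^ p) ^ 4 / s := by
    intro s hs
    rw [show (s ^ p) ^ 4 = ((s ^ p) ^ 2) ^ 2 by ring, rpow_two_mul_gegenbauerExp hd hs.le,
      eq_div_iff hs.ne', ← pow_succ, ← pow_mul]
    congr 1; omega
  have h := integral_scaled_eq hd l a b
    (fun x => gegenbauerScaled d l x ^ 4 * sinScaled d l x ^ (2 * d - 3))
    (fun t => gegenbauerOsc d l t ^ 4 / Real.sin t) ((N ^ p) ^ 4 / N) ?_
  · have h2 := hosc.abs_integral_quartic_sub_le hN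
      (m := gegenbauerAmp d * N ^ (-p)) hinv habN hbN
      (fun t ht => abs_gegenbauerOsc_le hd l ht)
      (fun t ht => abs_gegenbauerOscDeriv_le hd l ht)
    have hcs : ContinuousOn (fun t => (Real.sin t)⁻¹) (Icc (a / N) (b / N)) :=
      Real.continuous_sin.continuousOn.inv₀ fun x hx => (hsin x hx).ne'
    have hi1 : IntervalIntegrable (fun t => gegenbauerOsc d l t ^ 4 / Real.sin t) volume
        (a / N) (b / N) := by
      refine ContinuousOn.intervalIntegrable ?_
      rw [uIcc_of_le habN]
      exact ((hosc.continuousOn_left.mono hsub).pow 4).div (by fun_prop) fun x hx => (hsin x hx).ne'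
    have hi2 : IntervalIntegrable (fun t => 3 * F ^ 2 / (8 * N ^ 4) * (Real.sin t)⁻¹) volume
        (a / N) (b / N) := by
      refine ContinuousOn.intervalIntegrable ?_
      rw [uIcc_of_le habN]
      exact continuousOn_const.mul hcs
    have hi3 : IntervalIntegrable (fun t : ℝ => (t : ℝ)⁻¹) volume (a / N) (b / N) := by
      refine ContinuousOn.intervalIntegrable ?_
      rw [uIcc_of_le habN]
      exact continuousOn_id.inv₀ fun x hx => (hsub x hx).1.ne'
    have hi4 : IntervalIntegrable (fun t : ℝ => (Real.sin t)⁻¹) volume (a / N) (b / N) := by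
      refine ContinuousOn.intervalIntegrable ?_
      rwa [uIcc_of_le habN]
    have e1 : ∫ t in (a / N)..(b / N), (gegenbauerOsc d l t ^ 4 - 3 * F ^ 2 / (8 * N ^ 4))
        / Real.sin t = (∫ t in (a / N)..(b / N), gegenbauerOsc d l t ^ 4 / Real.sin t)
          - 3 * F ^ 2 / (8 * N ^ 4) * ∫ t in (a / N)..(b / N), (Real.sin t)⁻¹ := by
      rw [← intervalIntegral.integral_const_mul, ← intervalIntegral.integral_sub hi1 hi2]
      refine intervalIntegral.integral_congr fun t _ => ?_
      simp only [div_eq_mul_inv, sub_mul]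
    rw [e1] at h2
    have e2 : Real.log (b / a) ≤ ∫ t in (a / N)..(b / N), (Real.sin t)⁻¹ := by
      have : ∫ t in (a / N)..(b / N), (t : ℝ)⁻¹ = Real.log (b / a) := by
        rw [integral_inv_of_pos (by positivity) (by
          have : 0 < b := by linarith
          positivity)]
        congr 1; field_simp
      rw [← this]
      refine intervalIntegral.integral_mono_on habN hi3 hi4 fun t ht => ?_
      exact inv_anti₀ (hsin t ht) (Real.sin_le (hsub t ht).1.le)
    have h3 := (abs_le.1 h2).1
    have hlog : 0 ≤ Real.log (b / a) := Real.log_nonneg ((one_le_div ha0).2 hab)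
    have h4 : 3 * (c * (N * N ^ (-p)) ^ 2) ^ 2 / (8 * N ^ 4) * Real.log (b / a)
        ≤ 3 * F ^ 2 / (8 * N ^ 4) * ∫ t in (a / N)..(b / N), (Real.sin t)⁻¹ := by
      gcongr
    rw [h, div_mul_cancel₀ _ hN.ne']
    have h5 : 3 * (c * (N * N ^ (-p)) ^ 2) ^ 2 / (8 * N ^ 4) * Real.log (b / a)
        - (16 + 88 * |κ|) * (gegenbauerAmp d * N ^ (-p)) ^ 4
        ≤ ∫ t in (a / N)..(b / N), gegenbauerOsc d l t ^ 4 / Real.sin t := by linarith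
    refine le_trans (le_of_eq ?_)
      (mul_le_mul_of_nonneg_left h5 (by positivity : 0 ≤ (N ^ p) ^ 4))
    have : (N ^ p) ^ 4 * (3 * (c * (N * N ^ (-p)) ^ 2) ^ 2 / (8 * N ^ 4) * Real.log (b / a)
        - (16 + 88 * |κ|) * (gegenbauerAmp d * N ^ (-p)) ^ 4)
        = (N ^ p * N ^ (-p)) ^ 4 * (3 * c ^ 2 / 8 * Real.log (b / a)
          - (16 + 88 * |κ|) * gegenbauerAmp d ^ 4) := by
      field_simp
    rw [this, hpow]; ring
  · intro x hx
    rw [uIcc_of_le hab] at hx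
    have hs := hsin (x / N) ⟨div_le_div_of_nonneg_right hx.1 hN.le,
      div_le_div_of_nonneg_right hx.2 hN.le⟩
    simp only [gegenbauerOsc, gegenbauerScaled, sinScaled, mul_pow]
    rw [← hNdef, hexp _ hs, hexp _ hN, ← hpdef]
    field_simp

/-! ### The normalized Bessel function as an entire function of x². -/

/-- Coefficients of the normalized Bessel function in powers of `x ^ 2`. -/
noncomputable def besselCoeff (α : ℝ) (m : ℕ) : ℝ :=
  (-1) ^ m / (4 ^ m * m.factorial * (ascPochhammer ℝ m).eval α)

/-- The entire function with `J_v(x) = (x / 2) ^ v / Γ(v + 1) * besselEntire (v + 1) (x ^ 2)`. -/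
noncomputable def besselEntire (α z : ℝ) : ℝ := ∑' m : ℕ, besselCoeff α m * z ^ m

theorem one_le_ascPochhammer {α : ℝ} (hα : 1 ≤ α) (m : ℕ) :
    1 ≤ (ascPochhammer ℝ m).eval α := by
  induction m with
  | zero => simp
  | succ m ih =>
    rw [ascPochhammer_succ_eval]
    have : (0 : ℝ) ≤ m := m.cast_nonneg
    nlinarith

theorem abs_besselCoeff_le {α : ℝ} (hα : 1 ≤ α) (m : ℕ) :
    |besselCoeff α m| ≤ 1 / m.factorial := by
  have h1 := one_le_ascPochhammer hα m
  have h2 : (1 : ℝ) ≤ 4 ^ m := one_le_pow₀ (by norm_num)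
  have h3 : (0 : ℝ) < m.factorial := by positivity
  rw [besselCoeff, abs_div, abs_pow, abs_neg, abs_one, one_pow, abs_of_pos (by positivity)]
  refine one_div_le_one_div_of_le h3 ?_
  calc (m.factorial : ℝ) = 1 * m.factorial * 1 := by ring
    _ ≤ _ := by gcongr

theorem summable_besselEntire {α : ℝ} (hα : 1 ≤ α) (z : ℝ) :
    Summable fun m : ℕ => besselCoeff α m * z ^ m := by
  refine Summable.of_norm_bounded (Real.summable_pow_div_factorial |z|) fun m => ?_
  rw [Real.norm_eq_abs, abs_mul, abs_pow]
  calc _ ≤ 1 / m.factorial * |z| ^ m := by gcongr; exact abs_besselCoeff_le hα m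
    _ = _ := by ring

theorem besselCoeff_succ {α : ℝ} (hα : 1 ≤ α) (m : ℕ) :
    besselCoeff α (m + 1) * (4 * (m + 1) * (α + m)) = -besselCoeff α m := by
  have h1 := one_le_ascPochhammer hα m
  have h2 : (0 : ℝ) ≤ m := m.cast_nonneg
  have h3 : (ascPochhammer ℝ m).eval α ≠ 0 := by linarith
  have h4 : α + m ≠ 0 := by linarith
  rw [besselCoeff, besselCoeff, ascPochhammer_succ_eval, Nat.factorial_succ]
  push_cast
  field_simp
  ring

/-- From (α)_(m+1) = α (α + 1)_m. This is the reason termwise differentiation raises the parameter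
by one. -/
theorem besselCoeff_succ_left {α : ℝ} (hα : 1 ≤ α) (m : ℕ) :
    (m + 1) * besselCoeff α (m + 1) = -(1 / (4 * α)) * besselCoeff (α + 1) m := by
  have h1 := one_le_ascPochhammer (by linarith : 1 ≤ α + 1) m
  have h3 : (ascPochhammer ℝ m).eval (α + 1) ≠ 0 := by linarith
  have h4 : α ≠ 0 := by linarith
  have e : (ascPochhammer ℝ (m + 1)).eval α = α * (ascPochhammer ℝ m).eval (α + 1) := by
    rw [ascPochhammer_succ_left]
    simp [Polynomial.eval_comp]
  rw [besselCoeff, besselCoeff, e, Nat.factorial_succ]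
  push_cast
  field_simp
  ring

theorem besselEntire_hasDerivAt {α : ℝ} (hα : 1 ≤ α) (z : ℝ) :
    HasDerivAt (besselEntire α) (-(1 / (4 * α)) * besselEntire (α + 1) z) z := by
  set R := |z| + 1 with hR
  have hR0 : 0 < R := by positivity
  have hz : z ∈ Ioo (-R) R := by
    rw [mem_Ioo, ← abs_lt]; linarith
  have hsum : Summable fun m : ℕ => (m : ℝ) * R ^ (m - 1) / m.factorial := by
    rw [← summable_nat_add_iff 1]
    refine (Real.summable_pow_div_factorial R).congr fun m => ?_
    rw [Nat.factorial_succ]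
    push_cast
    field_simp
  have h := hasDerivAt_tsum_of_isPreconnected (g := fun (m : ℕ) (y : ℝ) => besselCoeff α m * y ^ m)
    (g' := fun (m : ℕ) (y : ℝ) => besselCoeff α m * (m * y ^ (m - 1))) hsum isOpen_Ioo
    (isPreconnected_Ioo (a := -R) (b := R)) (fun m y _ => (hasDerivAt_pow m y).const_mul _) ?_
    hz (summable_besselEntire hα z) hz
  · refine h.congr_deriv ?_
    have hs : Summable fun m : ℕ => besselCoeff α m * (m * z ^ (m - 1)) := by
      rw [← summable_nat_add_iff 1]
      refine ((summable_besselEntire (by linarith : 1 ≤ α + 1) z).mul_left (-(1 / (4 * α)))).congr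
        fun m => ?_
      rw [← mul_assoc, ← besselCoeff_succ_left hα]
      simp only [Nat.add_sub_cancel]
      push_cast
      ring
    rw [hs.tsum_eq_zero_add, besselEntire, ← tsum_mul_left]
    simp only [Nat.cast_zero, zero_mul, mul_zero, zero_add, Nat.add_sub_cancel]
    refine tsum_congr fun m => ?_
    rw [← mul_assoc, ← mul_assoc, ← besselCoeff_succ_left hα]
    push_cast
    ring
  · intro m y hy
    rw [Real.norm_eq_abs, abs_mul, abs_mul, abs_pow, Nat.abs_cast]
    have : |y| ≤ R := (abs_lt.2 hy).le
    calc _ ≤ 1 / m.factorial * (m * R ^ (m - 1)) := by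
          gcongr
          exact abs_besselCoeff_le hα m
      _ = _ := by ring

theorem besselEntire_continuous {α : ℝ} (hα : 1 ≤ α) : Continuous (besselEntire α) :=
  continuous_iff_continuousAt.2 fun z => (besselEntire_hasDerivAt hα z).continuousAt

theorem besselEntire_zero (α : ℝ) : besselEntire α 0 = 1 := by
  rw [besselEntire, tsum_eq_single 0 fun m hm => by simp [hm]]
  simp [besselCoeff]

/-- The Bessel differential equation as a contiguity relation. -/
theorem besselEntire_contiguous {α : ℝ} (hα : 1 ≤ α) (z : ℝ) :
    besselEntire (α + 1) z - z / (4 * α * (α + 1)) * besselEntire (α + 2) z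
      = besselEntire α z := by
  have h1 := summable_besselEntire hα z
  have h2 := summable_besselEntire (by linarith : 1 ≤ α + 1) z
  have h3 := summable_besselEntire (by linarith : 1 ≤ α + 2) z
  have hα0 : α ≠ 0 := by linarith
  have hα1 : α + 1 ≠ 0 := by linarith
  simp only [besselEntire]
  rw [h1.tsum_eq_zero_add, h2.tsum_eq_zero_add, ← tsum_mul_left, add_sub_assoc]
  congr 1
  · simp [besselCoeff]
  rw [← Summable.tsum_sub ((summable_nat_add_iff 1).2 h2) (h3.mul_left _)]
  refine tsum_congr fun m => ?_
  have e1 := besselCoeff_succ (by linarith : 1 ≤ α + 1) m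
  have e2 := besselCoeff_succ_left hα m
  have e3 := besselCoeff_succ_left (by linarith : 1 ≤ α + 1) m
  rw [show α + 1 + 1 = α + 2 by ring] at e3
  have hm : (m : ℝ) + 1 ≠ 0 := by positivity
  have f3 : besselCoeff (α + 2) m = -(4 * (α + 1)) * ((m + 1) * besselCoeff (α + 1) (m + 1)) := by
    rw [e3]; field_simp
  have f1 : besselCoeff (α + 1) m
      = -(besselCoeff (α + 1) (m + 1) * (4 * (m + 1) * (α + 1 + m))) := by rw [e1, neg_neg]
  have f2 : besselCoeff α (m + 1)
      = 1 / α * (besselCoeff (α + 1) (m + 1) * (α + 1 + m)) := by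
    refine mul_left_cancel₀ hm ?_
    rw [e2, f1]; field_simp
  rw [f3, f2]
  field_simp
  ring

/-! ### The Mehler–Heine limit. -/

theorem gegenbauerFreq_tendsto (d : ℕ) : Tendsto (gegenbauerFreq d) atTop atTop := by
  unfold gegenbauerFreq
  exact tendsto_atTop_add_const_right _ _ tendsto_natCast_atTop_atTop

theorem eventually_le_freq (d : ℕ) (x : ℝ) :
    ∀ᶠ l : ℕ in atTop, x ≤ Real.pi / 2 * gegenbauerFreq d l :=
  ((gegenbauerFreq_tendsto d).const_mul_atTop (by positivity)).eventually_ge_atTop x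

theorem mul_sin_div_tendsto (x : ℝ) :
    Tendsto (fun N : ℝ => N * Real.sin (x / N)) atTop (𝓝 x) := by
  have h : HasDerivAt (fun s => Real.sin (x * s)) x 0 := by
    have := ((hasDerivAt_id (0 : ℝ)).const_mul x).sin
    simpa using this
  have h2 := h.tendsto_slope_zero_right
  have h3 := h2.comp tendsto_inv_atTop_nhdsGT_zero
  refine h3.congr fun N => ?_
  simp [div_eq_mul_inv]

theorem sinScaled_tendsto (d : ℕ) (x : ℝ) :
    Tendsto (fun l => sinScaled d l x) atTop (𝓝 x) :=
  (mul_sin_div_tendsto x).comp (gegenbauerFreq_tendsto d)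

theorem sin_sq_half (t : ℝ) : (1 - Real.cos t) / 2 = Real.sin (t / 2) ^ 2 := by
  have := Real.cos_two_mul' (t / 2)
  have h2 := Real.sin_sq_add_cos_sq (t / 2)
  rw [mul_div_cancel₀ t two_ne_zero] at this
  linarith

theorem freq_sq_mul_sin_sq_tendsto (d : ℕ) (x : ℝ) :
    Tendsto (fun l => gegenbauerFreq d l ^ 2 * Real.sin (x / gegenbauerFreq d l / 2) ^ 2) atTop
      (𝓝 (x ^ 2 / 4)) := by
  have h := ((mul_sin_div_tendsto (x / 2)).comp (gegenbauerFreq_tendsto d)).pow 2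
  rw [show (x / 2) ^ 2 = x ^ 2 / 4 by ring] at h
  refine h.congr fun l => ?_
  simp only [Function.comp]
  rw [mul_pow, div_right_comm]

/-- Induction on the ratio of consecutive terms: (l - k)(l + d - 1 + k) = N² - (k + p)² is
asymptotic to N², while N² sin²(x/(2N)) tends to x²/4. -/
theorem gegenbauerCoeff_mul_pow_tendsto {d : ℕ} (hd : 2 ≤ d) (x : ℝ) (k : ℕ) :
    Tendsto (fun l => gegenbauerCoeff d l k * (Real.sin (x / gegenbauerFreq d l / 2) ^ 2) ^ k)
      atTop (𝓝 (besselCoeff ((d : ℝ) / 2) k * (x ^ 2) ^ k)) := by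
  have hd' : (2 : ℝ) ≤ d := by exact_mod_cast hd
  have hα : (1 : ℝ) ≤ (d : ℝ) / 2 := by linarith
  induction k with
  | zero => simp [gegenbauerCoeff_zero, besselCoeff]
  | succ k ih =>
    have hk : ((k : ℝ) + 1) * (k + (d : ℝ) / 2) ≠ 0 := by positivity
    have h1 : Tendsto (fun l : ℕ => ((l : ℝ) - k) * (l + d - 1 + k) / gegenbauerFreq d l ^ 2)
        atTop (𝓝 1) := by
      have e : ∀ l : ℕ, ((l : ℝ) - k) * (l + d - 1 + k) / gegenbauerFreq d l ^ 2
          = 1 - ((k : ℝ) + gegenbauerExp d) ^ 2 * (gegenbauerFreq d l ^ 2)⁻¹ := by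
        intro l
        have := gegenbauerFreq_pos hd l
        field_simp
        rw [gegenbauerFreq, gegenbauerExp]
        ring
      simp only [e]
      have h2 := ((tendsto_pow_atTop two_ne_zero).comp (gegenbauerFreq_tendsto d)).inv_tendsto_atTop
      simpa using (h2.const_mul (((k : ℝ) + gegenbauerExp d) ^ 2)).const_sub 1
    have h3 := ((ih.mul (h1.mul (freq_sq_mul_sin_sq_tendsto d x))).const_mul
      (-(1 / (((k : ℝ) + 1) * (k + (d : ℝ) / 2)))))
    have e2 : besselCoeff ((d : ℝ) / 2) (k + 1) * (x ^ 2) ^ (k + 1)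
        = -(1 / (((k : ℝ) + 1) * (k + (d : ℝ) / 2)))
          * (besselCoeff ((d : ℝ) / 2) k * (x ^ 2) ^ k * (1 * (x ^ 2 / 4))) := by
      have := besselCoeff_succ hα k
      rw [← neg_eq_iff_eq_neg] at this
      rw [← this, pow_succ (x ^ 2)]
      field_simp
      ring
    rw [e2]
    refine h3.congr fun l => ?_
    have hN := gegenbauerFreq_pos hd l
    have hr := gegenbauerCoeff_succ (by omega : 0 < d) l k
    rw [← eq_div_iff hk] at hr
    rw [hr, pow_succ (Real.sin (x / gegenbauerFreq d l / 2) ^ 2)]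
    field_simp

/-- The summable majorant for exchanging limit and sum. Consecutive terms have ratio at most
(x²/4)/(k + 1), because (l - k)(l + d - 1 + k) ≤ N² and k + d/2 ≥ 1. -/
theorem abs_gegenbauerCoeff_mul_pow_le {d : ℕ} (hd : 2 ≤ d) (x : ℝ) (l k : ℕ) :
    |gegenbauerCoeff d l k * (Real.sin (x / gegenbauerFreq d l / 2) ^ 2) ^ k|
      ≤ (x ^ 2 / 4) ^ k / k.factorial := by
  have hd' : (2 : ℝ) ≤ d := by exact_mod_cast hd
  have hN := gegenbauerFreq_pos hd l
  set w := Real.sin (x / gegenbauerFreq d l / 2) ^ 2 with hw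
  have hw0 : 0 ≤ w := sq_nonneg _
  have hw1 : gegenbauerFreq d l ^ 2 * w ≤ x ^ 2 / 4 := by
    have h1 := sq_le_sq.2 (abs_le_abs_of_nonneg (abs_nonneg _)
      (Real.abs_sin_le_abs (x := x / gegenbauerFreq d l / 2)))
    simp only [sq_abs] at h1
    calc _ ≤ gegenbauerFreq d l ^ 2 * (x / gegenbauerFreq d l / 2) ^ 2 := by gcongr
      _ = _ := by field_simp; norm_num
  induction k with
  | zero => simp [gegenbauerCoeff_zero]
  | succ k ih =>
    rcases lt_or_ge l (k + 1) with hlk | hlk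
    · rw [gegenbauerCoeff_eq_zero hlk]; simp; positivity
    have hkl : (k : ℝ) ≤ l := by exact_mod_cast (by omega : k ≤ l)
    have hk0 : (0 : ℝ) ≤ k := k.cast_nonneg
    have hk : 0 < ((k : ℝ) + 1) * (k + (d : ℝ) / 2) := by positivity
    have hr := gegenbauerCoeff_succ (by omega : 0 < d) l k
    rw [← eq_div_iff hk.ne'] at hr
    have hL0 : 0 ≤ ((l : ℝ) - k) * (l + d - 1 + k) := mul_nonneg (by linarith) (by linarith)
    have hL : ((l : ℝ) - k) * (l + d - 1 + k) ≤ gegenbauerFreq d l ^ 2 := by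
      rw [gegenbauerFreq]; nlinarith [sq_nonneg ((k : ℝ) + (d - 1) / 2)]
    have e : gegenbauerCoeff d l (k + 1) * w ^ (k + 1)
        = -(gegenbauerCoeff d l k * w ^ k * (((l : ℝ) - k) * (l + d - 1 + k) * w)
          / (((k : ℝ) + 1) * (k + (d : ℝ) / 2))) := by
      rw [hr, pow_succ]; ring
    rw [e, abs_neg, abs_div, abs_mul, abs_of_pos hk, abs_of_nonneg (mul_nonneg hL0 hw0)]
    have h5 : ((l : ℝ) - k) * (l + d - 1 + k) * w ≤ x ^ 2 / 4 :=
      (mul_le_mul_of_nonneg_right hL hw0).trans hw1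
    calc _ ≤ (x ^ 2 / 4) ^ k / k.factorial * (x ^ 2 / 4) / (((k : ℝ) + 1) * 1) := by
          gcongr
          linarith
      _ = _ := by
          rw [Nat.factorial_succ, pow_succ (x ^ 2 / 4)]; push_cast; field_simp

/-- The Mehler–Heine limit. -/
theorem gegenbauerScaled_tendsto {d : ℕ} (hd : 2 ≤ d) (x : ℝ) :
    Tendsto (fun l => gegenbauerScaled d l x) atTop (𝓝 (besselEntire ((d : ℝ) / 2) (x ^ 2))) := by
  have h := tendsto_tsum_of_dominated_convergence (𝓕 := atTop)
    (f := fun l k => gegenbauerCoeff d l k * (Real.sin (x / gegenbauerFreq d l / 2) ^ 2) ^ k)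
    (g := fun k => besselCoeff ((d : ℝ) / 2) k * (x ^ 2) ^ k)
    (bound := fun k => (x ^ 2 / 4) ^ k / k.factorial)
    (Real.summable_pow_div_factorial _) (gegenbauerCoeff_mul_pow_tendsto hd x)
    (Eventually.of_forall fun l k => abs_gegenbauerCoeff_mul_pow_le hd x l k)
  refine h.congr fun l => ?_
  rw [gegenbauerScaled, gegenbauerAngle, gegenbauerShift_eval, sin_sq_half]
  refine tsum_eq_sum fun k hk => ?_
  rw [gegenbauerCoeff_eq_zero (by simpa using hk), zero_mul]

/-! ### From Bessel functions to the limit of the moments. -/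

theorem Gamma_nat_add {α : ℝ} (hα : 0 < α) (m : ℕ) :
    Real.Gamma (m + α) = (ascPochhammer ℝ m).eval α * Real.Gamma α := by
  induction m with
  | zero => simp
  | succ m ih =>
    rw [show ((m + 1 : ℕ) : ℝ) + α = (m + α) + 1 by push_cast; ring,
      Real.Gamma_add_one (by positivity), ih, ascPochhammer_succ_eval]
    ring

theorem besselJ_eq {d : ℕ} (hd : 2 ≤ d) {x : ℝ} (hx : 0 < x) :
    besselJ ((d : ℝ) / 2 - 1) x = x ^ ((d : ℝ) / 2 - 1)
      / (2 ^ ((d : ℝ) / 2 - 1) * Real.Gamma ((d : ℝ) / 2))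
        * besselEntire ((d : ℝ) / 2) (x ^ 2) := by
  have hd' : (2 : ℝ) ≤ d := by exact_mod_cast hd
  have hα : (1 : ℝ) ≤ (d : ℝ) / 2 := by linarith
  rw [besselJ, besselEntire, ← tsum_mul_left]
  refine tsum_congr fun m => ?_
  have h1 := one_le_ascPochhammer hα m
  have h2 := Real.Gamma_pos_of_pos (by linarith : 0 < (d : ℝ) / 2)
  have h3 : (0 : ℝ) < 2 ^ ((d : ℝ) / 2 - 1) := Real.rpow_pos_of_pos two_pos _
  rw [show (m : ℝ) + ((d : ℝ) / 2 - 1) + 1 = m + (d : ℝ) / 2 by ring,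
    Gamma_nat_add (by linarith), Real.rpow_add (by positivity),
    Real.div_rpow hx.le two_pos.le ((d : ℝ) / 2 - 1),
    show 2 * (m : ℝ) = ((2 * m : ℕ) : ℝ) by push_cast; ring, Real.rpow_natCast, besselCoeff,
    ← pow_mul, div_pow, pow_mul 2, show (2 : ℝ) ^ 2 = 4 by norm_num]
  have : (ascPochhammer ℝ m).eval ((d : ℝ) / 2) ≠ 0 := by linarith
  generalize (ascPochhammer ℝ m).eval ((d : ℝ) / 2) = A at *
  field_simp

/-- The integrand `Φ(x) ^ q * x ^ (d - 1)` for the normalized Bessel function `Φ`. -/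
noncomputable def besselScaledIntegrand (d q : ℕ) (x : ℝ) : ℝ :=
  besselEntire ((d : ℝ) / 2) (x ^ 2) ^ q * x ^ (d - 1)

/-- The normalizing factor of `momentConst`. -/
noncomputable def besselNorm (d q : ℕ) : ℝ :=
  ((2 : ℝ) ^ ((d : ℝ) / 2 - 1) * Real.Gamma ((d : ℝ) / 2)) ^ q

theorem besselNorm_pos {d : ℕ} (hd : 2 ≤ d) (q : ℕ) : 0 < besselNorm d q := by
  have hd' : (2 : ℝ) ≤ d := by exact_mod_cast hd
  have := Real.Gamma_pos_of_pos (by linarith : 0 < (d : ℝ) / 2)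
  unfold besselNorm
  positivity

/-- The factor x^(q(d/2 - 1)) hidden in J^q cancels the singular weight, which leaves a function
continuous up to 0. -/
theorem besselIntegrand_eq {d : ℕ} (hd : 2 ≤ d) (q : ℕ) {x : ℝ} (hx : 0 < x) :
    besselIntegrand d q x = (besselNorm d q)⁻¹ * besselScaledIntegrand d q x := by
  rw [besselIntegrand, besselJ_eq hd hx, mul_pow, div_pow, ← besselNorm, besselScaledIntegrand,
    show -(q : ℝ) * ((d : ℝ) / 2 - 1) + d - 1 = -(((d : ℝ) / 2 - 1) * q) + ((d - 1 : ℕ) : ℝ) by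
      push_cast [Nat.cast_sub (by omega : 1 ≤ d)]; ring,
    Real.rpow_add hx, Real.rpow_natCast, Real.rpow_neg hx.le, Real.rpow_mul hx.le,
    Real.rpow_natCast]
  have : 0 < x ^ ((d : ℝ) / 2 - 1) := Real.rpow_pos_of_pos hx _
  field_simp

theorem besselScaledIntegrand_continuous {d : ℕ} (hd : 2 ≤ d) (q : ℕ) :
    Continuous (besselScaledIntegrand d q) := by
  have hd' : (2 : ℝ) ≤ d := by exact_mod_cast hd
  exact (((besselEntire_continuous (by linarith)).comp (continuous_pow 2)).pow q).mul
    (continuous_pow _)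

/-- This bound and the decay bounds after it pass from the Gegenbauer polynomials through the
pointwise limit; no Bessel asymptotics enter. -/
theorem abs_besselEntire_le_one {d : ℕ} (hd : 2 ≤ d) {z : ℝ} (hz : 0 ≤ z) :
    |besselEntire ((d : ℝ) / 2) z| ≤ 1 := by
  have h := (gegenbauerScaled_tendsto hd (√z)).abs
  rw [Real.sq_sqrt hz] at h
  refine le_of_tendsto h ?_
  filter_upwards [eventually_le_freq d (√z)] with l hl
  exact abs_gegenbauerScaled_le_one hd ⟨Real.sqrt_nonneg _, hl⟩

theorem abs_besselEntire_sq_le {d : ℕ} (hd : 2 ≤ d) {x : ℝ} (hx : 1 / 2 ≤ x) :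
    |besselEntire ((d : ℝ) / 2) (x ^ 2)|
      ≤ gegenbauerAmp d * 2 ^ gegenbauerExp d * x ^ (-gegenbauerExp d) := by
  refine le_of_tendsto (gegenbauerScaled_tendsto hd x).abs ?_
  filter_upwards [eventually_le_freq d x] with l hl
  exact abs_gegenbauerScaled_le hd ⟨hx, hl⟩

theorem scaledIntegrand_tendsto {d : ℕ} (hd : 2 ≤ d) (q : ℕ) (x : ℝ) :
    Tendsto (fun l => scaledIntegrand d q l x) atTop (𝓝 (besselScaledIntegrand d q x)) :=
  ((gegenbauerScaled_tendsto hd x).pow q).mul ((sinScaled_tendsto d x).pow _)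

theorem abs_besselScaledIntegrand_le_rpow {d : ℕ} (hd : 2 ≤ d) (q : ℕ) {x : ℝ}
    (hx : 1 / 2 ≤ x) :
    |besselScaledIntegrand d q x| ≤ (gegenbauerAmp d * 2 ^ gegenbauerExp d) ^ q
      * x ^ (-(q - 2) * gegenbauerExp d) := by
  refine le_of_tendsto (scaledIntegrand_tendsto hd q x).abs ?_
  filter_upwards [eventually_le_freq d x] with l hl
  exact abs_scaledIntegrand_le_rpow hd q ⟨hx, hl⟩

/-- Dominated convergence with majorant x^e. The exponent e is free because it is needed both for
the moments (d - 1) and for the quartic comparison (2d - 3). -/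
theorem integral_scaled_tendsto {d : ℕ} (hd : 2 ≤ d) (q e : ℕ) {a b : ℝ} (ha : 0 ≤ a)
    (hab : a ≤ b) :
    Tendsto (fun l => ∫ x in a..b, gegenbauerScaled d l x ^ q * sinScaled d l x ^ e) atTop
      (𝓝 (∫ x in a..b, besselEntire ((d : ℝ) / 2) (x ^ 2) ^ q * x ^ e)) := by
  refine intervalIntegral.tendsto_integral_filter_of_dominated_convergence (fun x => x ^ e)
    ?_ ?_ ((continuous_pow e).intervalIntegrable _ _) ?_
  · exact Eventually.of_forall fun l => (((gegenbauerScaled_continuous d l).pow q).mul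
      ((sinScaled_continuous d l).pow e)).aestronglyMeasurable
  · filter_upwards [eventually_le_freq d b] with l hl
    refine Eventually.of_forall fun x hx => ?_
    rw [uIoc_of_le hab] at hx
    have hx' : x ∈ Icc 0 (Real.pi / 2 * gegenbauerFreq d l) :=
      ⟨ha.trans hx.1.le, hx.2.trans hl⟩
    have hs : 0 ≤ sinScaled d l x := by linarith [half_le_sinScaled hd hx', hx'.1]
    have h1 := abs_gegenbauerScaled_le_one hd hx'
    have h2 := sinScaled_le hd (l := l) hx'.1
    rw [Real.norm_eq_abs, abs_mul, abs_pow, abs_of_nonneg (pow_nonneg hs _)]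
    calc _ ≤ 1 ^ q * x ^ e := by gcongr
      _ = _ := by simp
  · exact Eventually.of_forall fun x _ =>
      ((gegenbauerScaled_tendsto hd x).pow q).mul ((sinScaled_tendsto d x).pow _)

/-- If `∫ f_l → ∫ f` on bounded intervals and the tails of `f_l` are uniformly small, then the
improper integral of `f` converges and is the limit of the full integrals of `f_l`. -/
theorem exists_tendsto_integral_of_uniform_tail {f : ℕ → ℝ → ℝ} {g : ℝ → ℝ} {B : ℕ → ℝ}
    {τ : ℝ → ℝ} {a₀ : ℝ} (ha₀ : 0 ≤ a₀) (hf : ∀ l, Continuous (f l)) (hg : Continuous g)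
    (hB : Tendsto B atTop atTop) (hτ : Tendsto τ atTop (𝓝 0))
    (hlim : ∀ a b, 0 ≤ a → a ≤ b →
      Tendsto (fun l => ∫ x in a..b, f l x) atTop (𝓝 (∫ x in a..b, g x)))
    (htail : ∀ l a b, a₀ ≤ a → a ≤ b → b ≤ B l → |∫ x in a..b, f l x| ≤ τ a) :
    ∃ I, Tendsto (fun R : ℝ => ∫ x in (0 : ℝ)..R, g x) atTop (𝓝 I) ∧
      Tendsto (fun l => ∫ x in (0 : ℝ)..(B l), f l x) atTop (𝓝 I) := by
  have hgt : ∀ a b, a₀ ≤ a → a ≤ b → |∫ x in a..b, g x| ≤ τ a := by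
    intro a b ha hab
    refine le_of_tendsto (hlim a b (ha₀.trans ha) hab).abs ?_
    filter_upwards [hB.eventually_ge_atTop b] with l hl
    exact htail l a b ha hab hl
  have hadd : ∀ a b, (∫ x in (0 : ℝ)..b, g x) - ∫ x in (0 : ℝ)..a, g x = ∫ x in a..b, g x :=
    fun a b => intervalIntegral.integral_interval_sub_left (hg.intervalIntegrable _ _)
      (hg.intervalIntegrable _ _)
  have hcauchy : CauchySeq fun R : ℝ => ∫ x in (0 : ℝ)..R, g x := by
    rw [Metric.cauchySeq_iff']
    intro ε hε
    obtain ⟨R, hR1, hR2⟩ := ((hτ.eventually (gt_mem_nhds hε)).and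
      (eventually_ge_atTop a₀)).exists
    refine ⟨R, fun b hb => ?_⟩
    rw [Real.dist_eq, hadd]
    exact (hgt R b hR2 hb).trans_lt hR1
  obtain ⟨I, hI⟩ := cauchySeq_tendsto_of_complete hcauchy
  refine ⟨I, hI, ?_⟩
  rw [Metric.tendsto_atTop']
  intro ε hε
  obtain ⟨R, ⟨hR1, hR2⟩, hR3⟩ := (((hτ.eventually (gt_mem_nhds (by positivity : 0 < ε / 3))).and
      (eventually_ge_atTop a₀)).and (hI.eventually
        (Metric.ball_mem_nhds I (by positivity : 0 < ε / 3)))).exists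
  have h1 := (hlim 0 R le_rfl (ha₀.trans hR2)).eventually
    (Metric.ball_mem_nhds _ (by positivity : 0 < ε / 3))
  obtain ⟨L, hL⟩ := eventually_atTop.1 (h1.and (hB.eventually_ge_atTop R))
  refine ⟨L, fun l hl => ?_⟩
  obtain ⟨h2, h3⟩ := hL l hl.le
  rw [Real.dist_eq] at h2 hR3
  have h4 := htail l R (B l) hR2 h3 le_rfl
  have h5 : ∫ x in (0 : ℝ)..(B l), f l x
      = (∫ x in (0 : ℝ)..R, f l x) + ∫ x in R..(B l), f l x :=
    (intervalIntegral.integral_add_adjacent_intervals ((hf l).intervalIntegrable _ _)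
      ((hf l).intervalIntegrable _ _)).symm
  rw [Real.dist_eq, h5]
  rw [abs_lt] at h2 hR3 ⊢
  rw [abs_le] at h4
  constructor <;> linarith [h4.1, h4.2, h2.1, h2.2, hR3.1, hR3.2]

/-- One limit I serves both the improper Bessel integral and the rescaled moments; this identifies
the constant. For q = 3 the cancellation bound is used in all dimensions, even where the absolute
one would do. -/
theorem exists_limit_moment {d q : ℕ} (hd : 2 ≤ d)
    (hq : q = 3 ∨ 1 < ((q : ℝ) - 2) * gegenbauerExp d) :
    ∃ I, Tendsto (fun R : ℝ => ∫ x in (0 : ℝ)..R, besselScaledIntegrand d q x) atTop (𝓝 I) ∧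
      Tendsto (fun l => gegenbauerMoment d q l * gegenbauerFreq d l ^ d) atTop (𝓝 I) := by
  have htail : ∃ C r : ℝ, 0 ≤ C ∧ 0 < r ∧
      ∀ l : ℕ, ∀ a b : ℝ, 1 / 2 ≤ a → a ≤ b → b ≤ Real.pi / 2 * gegenbauerFreq d l →
        |∫ x in a..b, scaledIntegrand d q l x| ≤ C * a ^ (-r) := by
    rcases hq with rfl | hq
    · exact exists_cubic_tail_bound hd
    · exact exists_absolute_tail_bound hd hq
  obtain ⟨C, r, -, hr, hC⟩ := htail
  obtain ⟨I, hI1, hI2⟩ := exists_tendsto_integral_of_uniform_tail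
    (B := fun l => Real.pi / 2 * gegenbauerFreq d l) (τ := fun a => C * a ^ (-r))
    (by norm_num : (0 : ℝ) ≤ 1 / 2) (scaledIntegrand_continuous d q)
    (besselScaledIntegrand_continuous hd q)
    ((gegenbauerFreq_tendsto d).const_mul_atTop (by positivity))
    (by simpa using (tendsto_rpow_neg_atTop hr).const_mul C)
    (fun a b ha hab => integral_scaled_tendsto hd q (d - 1) ha hab) hC
  refine ⟨I, hI1, hI2.congr fun l => ?_⟩
  have hN := gegenbauerFreq_pos hd l
  rw [gegenbauerMoment_eq_scaled hd, div_mul_cancel₀ _ (by positivity)]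

theorem integral_besselIntegrand {d : ℕ} (hd : 2 ≤ d) (q : ℕ) {R : ℝ} (hR : 0 ≤ R) :
    ∫ x in (0 : ℝ)..R, besselIntegrand d q x
      = (besselNorm d q)⁻¹ * ∫ x in (0 : ℝ)..R, besselScaledIntegrand d q x := by
  rw [← intervalIntegral.integral_const_mul]
  refine intervalIntegral.integral_congr_ae (Eventually.of_forall fun x hx => ?_)
  rw [uIoc_of_le hR] at hx
  exact besselIntegrand_eq hd q hx.1

theorem momentConst_eq {d q : ℕ} (hd : 2 ≤ d) {I : ℝ}
    (hI : Tendsto (fun R : ℝ => ∫ x in (0 : ℝ)..R, besselScaledIntegrand d q x) atTop (𝓝 I)) :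
    momentConst d q = I := by
  have h : Tendsto (fun R : ℝ => ∫ x in (0 : ℝ)..R, besselIntegrand d q x) atTop
      (𝓝 ((besselNorm d q)⁻¹ * I)) := by
    refine (hI.const_mul _).congr' ?_
    filter_upwards [eventually_ge_atTop 0] with R hR
    exact (integral_besselIntegrand hd q hR).symm
  rw [momentConst, improperIntegral, h.limUnder_eq, ← besselNorm,
    mul_inv_cancel_left₀ (besselNorm_pos hd q).ne']

theorem freq_div_tendsto_one {d : ℕ} (hd : 2 ≤ d) :
    Tendsto (fun l : ℕ => (l : ℝ) / gegenbauerFreq d l) atTop (𝓝 1) := by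
  have e : ∀ l : ℕ, (l : ℝ) / gegenbauerFreq d l
      = 1 - gegenbauerExp d * (gegenbauerFreq d l)⁻¹ := by
    intro l
    have := gegenbauerFreq_pos hd l
    field_simp
    rw [gegenbauerFreq_eq]; ring
  simp only [e]
  simpa using ((gegenbauerFreq_tendsto d).inv_tendsto_atTop.const_mul (gegenbauerExp d)).const_sub 1

/-- The frequency N is replaced by l, as l/N → 1. The condition I ≠ 0 is essential: equivalence to
the zero sequence would force the moments to vanish eventually. -/
theorem isEquivalent_moment {d q : ℕ} (hd : 2 ≤ d) {I : ℝ} (hI0 : I ≠ 0)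
    (h : Tendsto (fun l => gegenbauerMoment d q l * gegenbauerFreq d l ^ d) atTop (𝓝 I)) :
    (fun l : ℕ => gegenbauerMoment d q l) ~[atTop] (fun l : ℕ => I / (l : ℝ) ^ d) := by
  rw [isEquivalent_iff_tendsto_one]
  · have h2 := (h.div_const I).mul ((freq_div_tendsto_one hd).pow d)
    rw [div_self hI0, one_pow, one_mul] at h2
    refine h2.congr fun l => ?_
    have hN := gegenbauerFreq_pos hd l
    simp only [Pi.div_apply]
    rw [div_pow]
    field_simp
  · filter_upwards [eventually_gt_atTop 0] with l hl
    have : (0 : ℝ) < l := by exact_mod_cast hl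
    positivity

/-! ### Absolute and conditional convergence. -/

theorem besselScaledIntegrand_integrableOn_Ioc {d : ℕ} (hd : 2 ≤ d) (q : ℕ) (R : ℝ) :
    IntegrableOn (besselScaledIntegrand d q) (Ioc 0 R) :=
  ((besselScaledIntegrand_continuous hd q).integrableOn_Icc).mono_set Ioc_subset_Icc_self

theorem besselIntegrand_integrableOn_iff {d : ℕ} (hd : 2 ≤ d) (q : ℕ) {s : Set ℝ}
    (hs : MeasurableSet s) (hs0 : s ⊆ Ioi 0) :
    IntegrableOn (besselIntegrand d q) s ↔ IntegrableOn (besselScaledIntegrand d q) s := by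
  rw [integrableOn_congr_fun (fun x hx => besselIntegrand_eq hd q (hs0 hx)) hs]
  exact integrable_const_mul_iff (isUnit_iff_ne_zero.2 (inv_ne_zero (besselNorm_pos hd q).ne')) _

theorem absolutelyConvergent_besselIntegrand {d q : ℕ} (hd : 2 ≤ d)
    (hq : 1 < ((q : ℝ) - 2) * gegenbauerExp d) :
    AbsolutelyConvergent (besselIntegrand d q) := by
  rw [AbsolutelyConvergent, besselIntegrand_integrableOn_iff hd q measurableSet_Ioi subset_rfl,
    ← Ioc_union_Ioi_eq_Ioi zero_le_one]
  refine (besselScaledIntegrand_integrableOn_Ioc hd q 1).union ?_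
  refine Integrable.mono' (((integrableOn_Ioi_rpow_of_lt (a := -(q - 2) * gegenbauerExp d)
    (by linarith) one_pos)).const_mul ((gegenbauerAmp d * 2 ^ gegenbauerExp d) ^ q))
    (besselScaledIntegrand_continuous hd q).aestronglyMeasurable ?_
  refine (ae_restrict_iff' measurableSet_Ioi).2 (Eventually.of_forall fun x hx => ?_)
  exact abs_besselScaledIntegrand_le_rpow hd q (by linarith [mem_Ioi.1 hx])

/-- One factor |Φ| ≤ A x^(-p) is spent to get Φ⁴ x^(2d-3) ≤ A |Φ|³ x^(d-1) for x ≥ 1. This requires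
2d - 3 ≤ p + d - 1, that is, d ≤ 3. The integral of the left side grows at least like log b. -/
theorem not_absolutelyConvergent_besselIntegrand {d : ℕ} (hd : 2 ≤ d) (hd3 : d ≤ 3) :
    ¬ AbsolutelyConvergent (besselIntegrand d 3) := by
  rw [AbsolutelyConvergent, besselIntegrand_integrableOn_iff hd 3 measurableSet_Ioi subset_rfl]
  intro hint
  have hp : gegenbauerExp d ≤ 1 := by
    have : (d : ℝ) ≤ 3 := by exact_mod_cast hd3
    rw [gegenbauerExp]; linarith
  obtain ⟨c, C, hc, hlow⟩ := exists_quartic_lower_bound hd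
  set A := gegenbauerAmp d * 2 ^ gegenbauerExp d with hA
  have hA0 : 0 < A := by
    have := one_le_gegenbauerAmp d
    positivity
  set g : ℝ → ℝ := fun x => besselEntire ((d : ℝ) / 2) (x ^ 2) ^ 4 * x ^ (2 * d - 3) with hg
  have hd' : (2 : ℝ) ≤ d := by exact_mod_cast hd
  have hgc : Continuous g := (((besselEntire_continuous (by linarith)).comp
    (continuous_pow 2)).pow 4).mul (continuous_pow _)
  have hgle : ∀ x, 1 ≤ x → g x ≤ A * |besselScaledIntegrand d 3 x| := by
    intro x hx
    have hx0 : 0 < x := by linarith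
    have h1 := abs_besselEntire_sq_le hd (x := x) (by linarith)
    rw [← hA] at h1
    have e1 : x ^ (2 * d - 3) ≤ x ^ gegenbauerExp d * x ^ (d - 1) := by
      rw [← Real.rpow_natCast x (2 * d - 3), ← Real.rpow_natCast x (d - 1), ← Real.rpow_add hx0]
      refine Real.rpow_le_rpow_of_exponent_le hx ?_
      rw [gegenbauerExp] at hp ⊢
      push_cast [Nat.cast_sub (by omega : 3 ≤ 2 * d), Nat.cast_sub (by omega : 1 ≤ d)]
      linarith
    set B := besselEntire ((d : ℝ) / 2) (x ^ 2) with hB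
    have e2 : B ^ 4 = |B| * |B| ^ 3 := by
      rw [← pow_succ', show |B| ^ (3 + 1) = (|B| ^ 2) ^ 2 by ring, sq_abs]; ring
    have hxp : 0 < x ^ gegenbauerExp d := Real.rpow_pos_of_pos hx0 _
    simp only [hg, besselScaledIntegrand]
    rw [← hB, abs_mul, abs_pow, abs_of_pos (pow_pos hx0 (d - 1)), e2]
    calc _ ≤ A * x ^ (-gegenbauerExp d) * |B| ^ 3 * (x ^ gegenbauerExp d * x ^ (d - 1)) := by
          gcongr
      _ = _ := by rw [Real.rpow_neg hx0.le]; field_simp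
  have hbound : ∀ b, 1 ≤ b → c * Real.log b - C ≤ A * ∫ x in Ioi 0, |besselScaledIntegrand d 3 x| := by
    intro b hb
    have h1 : c * Real.log b - C ≤ ∫ x in (1 : ℝ)..b, g x := by
      refine ge_of_tendsto (integral_scaled_tendsto hd 4 (2 * d - 3) zero_le_one hb) ?_
      filter_upwards [eventually_le_freq d b] with l hl
      simpa using hlow l 1 b (by norm_num) hb hl
    refine h1.trans ?_
    rw [intervalIntegral.integral_of_le hb, ← integral_const_mul]
    have hi : IntegrableOn (fun x => A * |besselScaledIntegrand d 3 x|) (Ioi 0) :=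
      hint.abs.const_mul A
    refine (setIntegral_mono_on ((hgc.integrableOn_Icc).mono_set Ioc_subset_Icc_self)
      (hi.mono_set fun x hx => lt_trans one_pos hx.1) measurableSet_Ioc
      fun x hx => hgle x hx.1.le).trans ?_
    refine setIntegral_mono_set hi (Eventually.of_forall fun x => by positivity) ?_
    exact Eventually.of_forall fun x hx => lt_trans one_pos hx.1
  have hlog : Tendsto (fun b => c * Real.log b - C) atTop atTop :=
    tendsto_atTop_add_const_right _ _ (Real.tendsto_log_atTop.const_mul_atTop hc)
  obtain ⟨b, hb1, hb2⟩ := ((hlog.eventually_gt_atTop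
    (A * ∫ x in Ioi 0, |besselScaledIntegrand d 3 x|)).and (eventually_ge_atTop 1)).exists
  exact absurd (hbound b hb2) (not_le.2 hb1)

theorem conditionallyConvergent_besselIntegrand {d : ℕ} (hd : 2 ≤ d) (hd3 : d ≤ 3) :
    ConditionallyConvergent (besselIntegrand d 3) := by
  refine ⟨fun R _ => (besselIntegrand_integrableOn_iff hd 3 measurableSet_Ioc
    Ioc_subset_Ioi_self).2 (besselScaledIntegrand_integrableOn_Ioc hd 3 R), ?_,
    not_absolutelyConvergent_besselIntegrand hd hd3⟩
  obtain ⟨I, hI, -⟩ := exists_limit_moment hd (q := 3) (Or.inl rfl)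
  refine ⟨(besselNorm d 3)⁻¹ * I, (hI.const_mul _).congr' ?_⟩
  filter_upwards [eventually_ge_atTop 0] with R hR
  exact (integral_besselIntegrand hd 3 hR).symm

/-! ### Gegenbauer's product formula. -/

theorem hasDerivAt_intervalIntegral_of_continuous {f f' : ℝ → ℝ → ℝ} {a b : ℝ} (hab : a ≤ b)
    (hf : ∀ r, Continuous (f r)) (hf' : Continuous (Function.uncurry f'))
    (h : ∀ r t, HasDerivAt (fun r => f r t) (f' r t) r) (r : ℝ) :
    HasDerivAt (fun r => ∫ t in a..b, f r t) (∫ t in a..b, f' r t) r := by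
  obtain ⟨C, hC⟩ := ((isCompact_Icc (a := r - 1) (b := r + 1)).prod
    (isCompact_Icc (a := a) (b := b))).exists_bound_of_continuousOn hf'.continuousOn
  refine (intervalIntegral.hasDerivAt_integral_of_dominated_loc_of_deriv_le
    (bound := fun _ => C) (Icc_mem_nhds (by linarith : r - 1 < r) (by linarith : r < r + 1))
    (Eventually.of_forall fun r => (hf r).aestronglyMeasurable)
    ((hf r).intervalIntegrable _ _)
    (hf'.comp (Continuous.prodMk_right r)).aestronglyMeasurable ?_
    intervalIntegrable_const ?_).2
  · refine Eventually.of_forall fun t ht s hs => hC (s, t) ⟨hs, ?_⟩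
    rw [uIoc_of_le hab] at ht
    exact Ioc_subset_Icc_self ht
  · exact Eventually.of_forall fun t _ s _ => h s t

/-- Uniqueness of the regular solution of `D'' + (k / ρ) D' + x² D = 0`. -/
theorem eq_zero_of_radial_ode {k x : ℝ} (hk : 0 ≤ k) (hx : x ≠ 0) {D D1 D2 : ℝ → ℝ}
    (h1 : ∀ r, HasDerivAt D (D1 r) r) (h2 : ∀ r, HasDerivAt D1 (D2 r) r)
    (hode : ∀ r, 0 < r → D2 r = -(k / r) * D1 r - x ^ 2 * D r) (hD : D 0 = 0) (hD1 : D1 0 = 0)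
    {r : ℝ} (hr : 0 ≤ r) : D r = 0 := by
  -- This energy starts at zero and is dissipated by the k/r term, so it stays zero; the singular
  -- point r = 0 enters only by continuity.
  have hE : ∀ r, HasDerivAt (fun r => D1 r ^ 2 + x ^ 2 * D r ^ 2)
      (2 * D1 r * D2 r + x ^ 2 * (2 * D r * D1 r)) r := fun r => by
    refine (((h2 r).pow 2).add (((h1 r).pow 2).const_mul (x ^ 2))).congr_deriv ?_
    simp only [Nat.cast_ofNat, Nat.add_one_sub_one, pow_one]
  have hanti : AntitoneOn (fun r => D1 r ^ 2 + x ^ 2 * D r ^ 2) (Ici 0) := by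
    refine antitoneOn_of_deriv_nonpos (convex_Ici 0)
      (fun r _ => (hE r).continuousAt.continuousWithinAt)
      (fun r _ => (hE r).differentiableAt.differentiableWithinAt) ?_
    intro r hr
    rw [interior_Ici, mem_Ioi] at hr
    rw [(hE r).deriv, hode r hr]
    have : 0 ≤ k / r * D1 r ^ 2 := mul_nonneg (div_nonneg hk hr.le) (sq_nonneg _)
    linarith
  have h := hanti (self_mem_Ici) hr hr
  simp only [hD, hD1] at h
  have h3 : x ^ 2 * D r ^ 2 ≤ 0 := by
    have := sq_nonneg (D1 r)
    norm_num at h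
    linarith
  have h4 : 0 < x ^ 2 := by positivity
  have h5 : D r ^ 2 ≤ 0 := by
    by_contra! hc
    exact absurd h3 (not_le.2 (mul_pos h4 hc))
  exact pow_eq_zero_iff two_ne_zero |>.1 (le_antisymm h5 (sq_nonneg _))

/-- The squared length of the third side of a triangle with sides `r` and `1`. -/
noncomputable def sideSq (r t : ℝ) : ℝ := r ^ 2 + 1 - 2 * r * Real.cos t

theorem sideSq_eq (r t : ℝ) : sideSq r t = (r - Real.cos t) ^ 2 + Real.sin t ^ 2 := by
  rw [sideSq]; linear_combination -Real.sin_sq_add_cos_sq t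

theorem sideSq_nonneg (r t : ℝ) : 0 ≤ sideSq r t := by
  rw [sideSq_eq]; positivity

theorem sideSq_continuous : Continuous (Function.uncurry sideSq) := by
  unfold sideSq Function.uncurry
  fun_prop

/-- The total mass `∫_0^π sin ^ (d - 2)`. -/
noncomputable def sinMass (d : ℕ) : ℝ := ∫ t in (0 : ℝ)..Real.pi, Real.sin t ^ (d - 2)

theorem sinMass_pos (d : ℕ) : 0 < sinMass d := integral_sin_pow_pos (d - 2)

theorem integral_cos_mul_sin_pow (n : ℕ) :
    ∫ t in (0 : ℝ)..Real.pi, Real.cos t * Real.sin t ^ n = 0 := by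
  have h := intervalIntegral.integral_eq_sub_of_hasDerivAt (a := 0) (b := Real.pi)
    (f := fun t => Real.sin t ^ (n + 1) / (n + 1)) (f' := fun t => Real.cos t * Real.sin t ^ n)
    (fun t _ => by
      have hn : (n : ℝ) + 1 ≠ 0 := by positivity
      refine (((Real.hasDerivAt_sin t).pow (n + 1)).div_const ((n : ℝ) + 1)).congr_deriv ?_
      simp
      field_simp) ((by fun_prop : Continuous fun t => Real.cos t * Real.sin t ^ n).intervalIntegrable
        _ _)
  simpa using h

theorem besselEntire_hasDerivAt_sq {α : ℝ} (hα : 1 ≤ α) (x r : ℝ) :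
    HasDerivAt (fun r => besselEntire α (x ^ 2 * r ^ 2))
      (-(x ^ 2 * r / (2 * α)) * besselEntire (α + 1) (x ^ 2 * r ^ 2)) r := by
  refine ((besselEntire_hasDerivAt hα (x ^ 2 * r ^ 2)).comp r
    (((hasDerivAt_pow 2 r).const_mul (x ^ 2)))).congr_deriv ?_
  have : α ≠ 0 := by linarith
  norm_num
  field_simp
  ring

/-- The integrand of Gegenbauer's product formula. -/
noncomputable def productKernel (α : ℝ) (n : ℕ) (x r t : ℝ) : ℝ :=
  besselEntire α (x ^ 2 * sideSq r t) * Real.sin t ^ n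

/-- The first derivative of `productKernel` in `r`. -/
noncomputable def productKernelDeriv (α : ℝ) (n : ℕ) (x r t : ℝ) : ℝ :=
  -(1 / (4 * α)) * besselEntire (α + 1) (x ^ 2 * sideSq r t)
    * (x ^ 2 * (2 * r - 2 * Real.cos t)) * Real.sin t ^ n

/-- The second derivative of `productKernel` in `r`. -/
noncomputable def productKernelDeriv2 (α : ℝ) (n : ℕ) (x r t : ℝ) : ℝ :=
  (1 / (16 * α * (α + 1)) * besselEntire (α + 2) (x ^ 2 * sideSq r t)
    * (x ^ 2 * (2 * r - 2 * Real.cos t)) ^ 2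
    - 1 / (4 * α) * besselEntire (α + 1) (x ^ 2 * sideSq r t) * (2 * x ^ 2)) * Real.sin t ^ n

theorem besselEntire_hasDerivAt_succ {α : ℝ} (hα : 1 ≤ α) (z : ℝ) :
    HasDerivAt (besselEntire (α + 1)) (-(1 / (4 * (α + 1))) * besselEntire (α + 2) z) z := by
  have := besselEntire_hasDerivAt (by linarith : 1 ≤ α + 1) z
  rwa [show α + 1 + 1 = α + 2 by ring] at this

section ProductKernel

variable {α : ℝ} (n : ℕ) (x : ℝ)

theorem mul_sideSq_continuous : Continuous fun p : ℝ × ℝ => x ^ 2 * sideSq p.1 p.2 :=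
  continuous_const.mul sideSq_continuous

theorem mul_sideSq_hasDerivAt_left (r t : ℝ) : HasDerivAt (fun r => x ^ 2 * sideSq r t)
    (x ^ 2 * (2 * r - 2 * Real.cos t)) r := by
  unfold sideSq
  refine ((((hasDerivAt_pow 2 r).add_const 1).sub
    (((hasDerivAt_id r).const_mul 2).mul_const (Real.cos t))).const_mul (x ^ 2)).congr_deriv ?_
  simp

theorem mul_sideSq_hasDerivAt_right (r t : ℝ) : HasDerivAt (fun t => x ^ 2 * sideSq r t)
    (x ^ 2 * (2 * r * Real.sin t)) t := by
  unfold sideSq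
  refine ((((Real.hasDerivAt_cos t).const_mul (2 * r)).const_sub (r ^ 2 + 1)).const_mul
    (x ^ 2)).congr_deriv ?_
  ring

theorem productKernel_continuous (hα : 1 ≤ α) :
    Continuous (Function.uncurry (productKernel α n x)) := by
  simp only [productKernel, Function.uncurry_def]
  exact ((besselEntire_continuous hα).comp (mul_sideSq_continuous x)).mul (by fun_prop)

theorem productKernelDeriv_continuous (hα : 1 ≤ α) :
    Continuous (Function.uncurry (productKernelDeriv α n x)) := by
  simp only [productKernelDeriv, Function.uncurry_def]
  exact (((continuous_const.mul ((besselEntire_continuous (by linarith : 1 ≤ α + 1)).comp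
    (mul_sideSq_continuous x))).mul (by fun_prop))).mul (by fun_prop)

theorem productKernelDeriv2_continuous (hα : 1 ≤ α) :
    Continuous (Function.uncurry (productKernelDeriv2 α n x)) := by
  simp only [productKernelDeriv2, Function.uncurry_def]
  exact ((((continuous_const.mul ((besselEntire_continuous (by linarith : 1 ≤ α + 2)).comp
    (mul_sideSq_continuous x))).mul (by fun_prop))).sub ((continuous_const.mul
      ((besselEntire_continuous (by linarith : 1 ≤ α + 1)).comp
        (mul_sideSq_continuous x))).mul continuous_const)).mul (by fun_prop)

theorem productKernel_hasDerivAt (hα : 1 ≤ α) (r t : ℝ) :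
    HasDerivAt (fun r => productKernel α n x r t) (productKernelDeriv α n x r t) r :=
  ((besselEntire_hasDerivAt hα _).comp r (mul_sideSq_hasDerivAt_left x r t)).mul_const _

theorem productKernelDeriv_hasDerivAt (hα : 1 ≤ α) (r t : ℝ) :
    HasDerivAt (fun r => productKernelDeriv α n x r t) (productKernelDeriv2 α n x r t) r := by
  have h1 := (besselEntire_hasDerivAt_succ hα (x ^ 2 * sideSq r t)).comp r
    (mul_sideSq_hasDerivAt_left x r t)
  have h2 : HasDerivAt (fun r => x ^ 2 * (2 * r - 2 * Real.cos t)) (x ^ 2 * 2) r := by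
    simpa using (((hasDerivAt_id r).const_mul 2).sub_const (2 * Real.cos t)).const_mul (x ^ 2)
  refine (((h1.const_mul (-(1 / (4 * α)))).mul h2).mul_const (Real.sin t ^ n)).congr_deriv ?_
  have hα0 : α ≠ 0 := by linarith
  have hα0' : α + 1 ≠ 0 := by linarith
  simp only [productKernelDeriv2, Function.comp]
  field_simp
  ring

theorem integral_productKernel_hasDerivAt (hα : 1 ≤ α) (r : ℝ) :
    HasDerivAt (fun r => ∫ t in (0 : ℝ)..Real.pi, productKernel α n x r t)
      (∫ t in (0 : ℝ)..Real.pi, productKernelDeriv α n x r t) r :=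
  hasDerivAt_intervalIntegral_of_continuous Real.pi_pos.le
    (fun r => (productKernel_continuous n x hα).comp (Continuous.prodMk_right r))
    (productKernelDeriv_continuous n x hα) (productKernel_hasDerivAt n x hα) r

theorem integral_productKernelDeriv_hasDerivAt (hα : 1 ≤ α) (r : ℝ) :
    HasDerivAt (fun r => ∫ t in (0 : ℝ)..Real.pi, productKernelDeriv α n x r t)
      (∫ t in (0 : ℝ)..Real.pi, productKernelDeriv2 α n x r t) r :=
  hasDerivAt_intervalIntegral_of_continuous Real.pi_pos.le
    (fun r => (productKernelDeriv_continuous n x hα).comp (Continuous.prodMk_right r))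
    (productKernelDeriv2_continuous n x hα) (productKernelDeriv_hasDerivAt n x hα) r

/-- The integrand is the t-derivative of sin^(n+1) t · `besselEntire (α + 1)` at x² `sideSq r t`,
which vanishes at 0 and π. -/
theorem integral_angular_eq_zero (hα : 1 ≤ α) (r : ℝ) : ∫ t in (0 : ℝ)..Real.pi,
      ((n + 1) * Real.sin t ^ n * Real.cos t * besselEntire (α + 1) (x ^ 2 * sideSq r t)
      + Real.sin t ^ (n + 1) * (-(1 / (4 * (α + 1))) * besselEntire (α + 2) (x ^ 2 * sideSq r t)
        * (x ^ 2 * (2 * r * Real.sin t)))) = 0 := by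
  have hPc : Continuous fun t => x ^ 2 * sideSq r t :=
    (mul_sideSq_continuous x).comp (Continuous.prodMk_right r)
  rw [intervalIntegral.integral_eq_sub_of_hasDerivAt
    (f := fun t => Real.sin t ^ (n + 1) * besselEntire (α + 1) (x ^ 2 * sideSq r t))]
  · simp
  · intro t _
    refine (((Real.hasDerivAt_sin t).pow (n + 1)).mul ((besselEntire_hasDerivAt_succ hα _).comp t
      (mul_sideSq_hasDerivAt_right x r t))).congr_deriv ?_
    simp
  · refine Continuous.intervalIntegrable ?_ _ _
    have e1 := (besselEntire_continuous (by linarith : 1 ≤ α + 1)).comp hPc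
    have e2 := (besselEntire_continuous (by linarith : 1 ≤ α + 2)).comp hPc
    simp only [Function.comp_def] at e1 e2
    fun_prop

/-- A translate of the radial eigenfunction Φ(x|·|) is again an eigenfunction of the Laplacian. In
polar coordinates its radial part differs from the eigenvalue equation by the angular part, which is
an exact t-derivative. The contiguity relation reduces the identity to algebra. -/
theorem productKernel_ode (hα : 1 ≤ α) (hn : (n : ℝ) = 2 * α - 2) {r : ℝ} (hr : 0 < r) (t : ℝ) :
    productKernelDeriv2 α n x r t
      = -((2 * α - 1) / r) * productKernelDeriv α n x r t - x ^ 2 * productKernel α n x r t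
        + x ^ 2 / (2 * α * r) * ((n + 1) * Real.sin t ^ n * Real.cos t
          * besselEntire (α + 1) (x ^ 2 * sideSq r t)
          + Real.sin t ^ (n + 1) * (-(1 / (4 * (α + 1)))
            * besselEntire (α + 2) (x ^ 2 * sideSq r t) * (x ^ 2 * (2 * r * Real.sin t)))) := by
  have hα0 : α ≠ 0 := by linarith
  have hα0' : α + 1 ≠ 0 := by linarith
  have hr0 : r ≠ 0 := hr.ne'
  rw [productKernelDeriv2, productKernelDeriv, productKernel,
    ← besselEntire_contiguous hα (x ^ 2 * sideSq r t), hn]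
  generalize besselEntire (α + 1) (x ^ 2 * sideSq r t) = A
  generalize besselEntire (α + 2) (x ^ 2 * sideSq r t) = B
  rw [sideSq_eq, pow_succ (Real.sin t) n]
  generalize Real.sin t ^ n = S
  generalize Real.sin t = s
  generalize Real.cos t = c
  field_simp
  ring

theorem integral_productKernel_ode (hα : 1 ≤ α) (hn : (n : ℝ) = 2 * α - 2) {r : ℝ} (hr : 0 < r) :
    ∫ t in (0 : ℝ)..Real.pi, productKernelDeriv2 α n x r t
      = -((2 * α - 1) / r) * (∫ t in (0 : ℝ)..Real.pi, productKernelDeriv α n x r t)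
        - x ^ 2 * ∫ t in (0 : ℝ)..Real.pi, productKernel α n x r t := by
  have i0 : IntervalIntegrable (productKernel α n x r) volume 0 Real.pi :=
    ((productKernel_continuous n x hα).comp (Continuous.prodMk_right r)).intervalIntegrable _ _
  have i1 : IntervalIntegrable (productKernelDeriv α n x r) volume 0 Real.pi :=
    ((productKernelDeriv_continuous n x hα).comp (Continuous.prodMk_right r)).intervalIntegrable _ _
  have hPc : Continuous fun t => x ^ 2 * sideSq r t :=
    (mul_sideSq_continuous x).comp (Continuous.prodMk_right r)
  have i2 : IntervalIntegrable (fun t => x ^ 2 / (2 * α * r) *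
      ((n + 1) * Real.sin t ^ n * Real.cos t * besselEntire (α + 1) (x ^ 2 * sideSq r t)
      + Real.sin t ^ (n + 1) * (-(1 / (4 * (α + 1))) * besselEntire (α + 2) (x ^ 2 * sideSq r t)
        * (x ^ 2 * (2 * r * Real.sin t))))) volume 0 Real.pi := by
    refine Continuous.intervalIntegrable ?_ _ _
    have e1 := (besselEntire_continuous (by linarith : 1 ≤ α + 1)).comp hPc
    have e2 := (besselEntire_continuous (by linarith : 1 ≤ α + 2)).comp hPc
    simp only [Function.comp_def] at e1 e2
    fun_prop
  rw [intervalIntegral.integral_congr fun t _ => productKernel_ode n x hα hn hr t,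
    intervalIntegral.integral_add ((i1.const_mul _).sub (i0.const_mul _)) i2,
    intervalIntegral.integral_sub (i1.const_mul _) (i0.const_mul _),
    intervalIntegral.integral_const_mul, intervalIntegral.integral_const_mul,
    intervalIntegral.integral_const_mul, integral_angular_eq_zero n x hα r, mul_zero, add_zero]

end ProductKernel

theorem besselEntire_hasDerivAt_sq2 {α : ℝ} (hα : 1 ≤ α) (x r : ℝ) :
    HasDerivAt (fun r => -(x ^ 2 * r / (2 * α)) * besselEntire (α + 1) (x ^ 2 * r ^ 2))
      (-(x ^ 2 / (2 * α)) * besselEntire (α + 1) (x ^ 2 * r ^ 2)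
        + (x ^ 2 * r) ^ 2 / (4 * α * (α + 1)) * besselEntire (α + 2) (x ^ 2 * r ^ 2)) r := by
  have hα0 : α ≠ 0 := by linarith
  have hα0' : α + 1 ≠ 0 := by linarith
  have h1 := besselEntire_hasDerivAt_sq (by linarith : 1 ≤ α + 1) x r
  rw [show α + 1 + 1 = α + 2 by ring] at h1
  have h2 := ((((hasDerivAt_id r).const_mul (x ^ 2)).div_const (2 * α)).neg)
  refine (h2.mul h1).congr_deriv ?_
  simp only [Pi.neg_apply, id, mul_one]
  field_simp
  ring

/-- Gegenbauer's product formula for the normalized Bessel function. -/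
theorem besselEntire_product {d : ℕ} (hd : 2 ≤ d) (x : ℝ) {r : ℝ} (hr : 0 ≤ r) :
    ∫ t in (0 : ℝ)..Real.pi, besselEntire ((d : ℝ) / 2) (x ^ 2 * sideSq r t)
        * Real.sin t ^ (d - 2)
      = sinMass d * (besselEntire ((d : ℝ) / 2) (x ^ 2)
        * besselEntire ((d : ℝ) / 2) (x ^ 2 * r ^ 2)) := by
  have hd' : (2 : ℝ) ≤ d := by exact_mod_cast hd
  -- Uniqueness for the radial equation needs x ≠ 0; at x = 0 both sides are the total mass.
  rcases eq_or_ne x 0 with rfl | hx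
  · simp [besselEntire_zero, sinMass]
  obtain ⟨α, hα⟩ : ∃ α : ℝ, α = (d : ℝ) / 2 := ⟨_, rfl⟩
  rw [← hα]
  have hα1 : 1 ≤ α := by rw [hα]; linarith
  have hα0 : α ≠ 0 := by linarith
  have hα0' : α + 1 ≠ 0 := by linarith
  obtain ⟨n, hn⟩ : ∃ n : ℕ, n = d - 2 := ⟨_, rfl⟩
  have hnd : (n : ℝ) = 2 * α - 2 := by rw [hn, Nat.cast_sub hd, hα]; norm_num; ring
  have hmass : sinMass d = ∫ t in (0 : ℝ)..Real.pi, Real.sin t ^ n := by rw [hn]; rfl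
  rw [← hn]
  -- The difference of the two sides solves the radial equation in r. Its value at r = 0 is zero
  -- because `sideSq 0 t = 1`, and its derivative is zero because ∫ cos · sin^n = 0.
  have hzero := eq_zero_of_radial_ode (k := 2 * α - 1) (x := x)
    (D := fun r => (∫ t in (0 : ℝ)..Real.pi, productKernel α n x r t)
      - sinMass d * besselEntire α (x ^ 2) * besselEntire α (x ^ 2 * r ^ 2))
    (by linarith) hx
    (fun r => (integral_productKernel_hasDerivAt n x hα1 r).sub
      ((besselEntire_hasDerivAt_sq hα1 x r).const_mul (sinMass d * besselEntire α (x ^ 2))))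
    (fun r => (integral_productKernelDeriv_hasDerivAt n x hα1 r).sub
      ((besselEntire_hasDerivAt_sq2 hα1 x r).const_mul (sinMass d * besselEntire α (x ^ 2))))
    ?_ ?_ ?_ hr
  · rw [← mul_assoc]
    simp only [productKernel] at hzero
    linarith
  · intro r hr
    rw [integral_productKernel_ode n x hα1 hnd hr, ← besselEntire_contiguous hα1 (x ^ 2 * r ^ 2)]
    generalize besselEntire (α + 1) (x ^ 2 * r ^ 2) = A
    generalize besselEntire (α + 2) (x ^ 2 * r ^ 2) = B
    generalize sinMass d * besselEntire α (x ^ 2) = K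
    generalize (∫ t in (0 : ℝ)..Real.pi, productKernelDeriv α n x r t) = I1
    field_simp
    ring
  · simp [productKernel, hmass, besselEntire_zero, sideSq, mul_comm]
  · have : ∀ t, productKernelDeriv α n x 0 t = (1 / (2 * α) * besselEntire (α + 1) (x ^ 2) * x ^ 2)
        * (Real.cos t * Real.sin t ^ n) := by
      intro t
      simp only [productKernelDeriv, sideSq]
      norm_num
      field_simp
      norm_num [mul_comm]
    simp only [this, intervalIntegral.integral_const_mul, integral_cos_mul_sin_pow]
    simp

/-! ### Gaussian-regularized moments and positivity of the constant. -/

/-- Gaussian-regularized moments of the normalized Bessel function. -/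
noncomputable def besselLaplace (d j : ℕ) (ε w : ℝ) : ℝ :=
  ∫ x in Ioi (0 : ℝ), besselEntire ((d : ℝ) / 2) (x ^ 2 * w) * besselEntire ((d : ℝ) / 2) (x ^ 2) ^ j
    * (x ^ (d - 1) * Real.exp (-ε * x ^ 2))

theorem integrableOn_pow_mul_exp_neg_sq (k : ℕ) {ε : ℝ} (hε : 0 < ε) :
    IntegrableOn (fun x : ℝ => x ^ k * Real.exp (-ε * x ^ 2)) (Ioi 0) := by
  have h := integrableOn_rpow_mul_exp_neg_mul_sq hε (s := k)
    (by linarith [(Nat.cast_nonneg k : (0 : ℝ) ≤ k)])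
  simpa using h

theorem integral_pow_mul_exp_neg_sq {d : ℕ} (hd : 2 ≤ d) (m : ℕ) {ε : ℝ} (hε : 0 < ε) :
    ∫ x in Ioi (0 : ℝ), (x ^ 2) ^ m * (x ^ (d - 1) * Real.exp (-ε * x ^ 2))
      = Real.Gamma ((d : ℝ) / 2) / 2 * ε ^ (-((d : ℝ) / 2))
        * ((ascPochhammer ℝ m).eval ((d : ℝ) / 2) * (1 / ε) ^ m) := by
  have hd' : (2 : ℝ) ≤ d := by exact_mod_cast hd
  have h := integral_rpow_mul_exp_neg_mul_rpow (p := 2) (q := ((2 * m + (d - 1) : ℕ) : ℝ)) two_pos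
    (by linarith [(Nat.cast_nonneg (2 * m + (d - 1)) : (0 : ℝ) ≤ ((2 * m + (d - 1) : ℕ) : ℝ))]) hε
  have e : (((2 * m + (d - 1) : ℕ) : ℝ) + 1) / 2 = m + (d : ℝ) / 2 := by
    push_cast [Nat.cast_sub (by omega : 1 ≤ d)]; ring
  rw [neg_div, e, Gamma_nat_add (by linarith), neg_add, Real.rpow_add hε, Real.rpow_neg hε.le m,
    Real.rpow_natCast] at h
  have e2 : ∀ x : ℝ, (x ^ 2) ^ m * (x ^ (d - 1) * Real.exp (-ε * x ^ 2))
      = x ^ (((2 * m + (d - 1) : ℕ) : ℝ)) * Real.exp (-ε * x ^ (2 : ℝ)) := fun x => by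
    rw [Real.rpow_natCast, Real.rpow_two, pow_add, pow_mul]; ring
  simp only [e2]
  rw [h, one_div_pow]
  ring

/-- The Hankel transform of a Gaussian is a Gaussian. Integrating termwise, the Gamma integral
supplies a factor (d/2)_m that cancels the one in `besselCoeff`, and the exponential series of
-w/(4ε) remains. -/
theorem besselLaplace_zero {d : ℕ} (hd : 2 ≤ d) {ε : ℝ} (hε : 0 < ε) (w : ℝ) :
    besselLaplace d 0 ε w
      = Real.Gamma ((d : ℝ) / 2) / 2 * ε ^ (-((d : ℝ) / 2)) * Real.exp (-w / (4 * ε)) := by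
  have hd' : (2 : ℝ) ≤ d := by exact_mod_cast hd
  obtain ⟨α, hα⟩ : ∃ α : ℝ, α = (d : ℝ) / 2 := ⟨_, rfl⟩
  have hα1 : 1 ≤ α := by rw [hα]; linarith
  have hΓ := Real.Gamma_pos_of_pos (by linarith : 0 < α)
  have hεp : 0 < ε ^ (-α) := Real.rpow_pos_of_pos hε _
  set F : ℕ → ℝ → ℝ := fun m x =>
    besselCoeff α m * w ^ m * ((x ^ 2) ^ m * (x ^ (d - 1) * Real.exp (-ε * x ^ 2))) with hF
  have hint : ∀ m, IntegrableOn (fun x : ℝ => (x ^ 2) ^ m * (x ^ (d - 1) * Real.exp (-ε * x ^ 2)))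
      (Ioi 0) := fun m => by
    refine (integrableOn_pow_mul_exp_neg_sq (2 * m + (d - 1)) hε).congr_fun (fun x _ => ?_)
      measurableSet_Ioi
    simp only
    rw [pow_add, pow_mul]; ring
  have hcoef : ∀ m, besselCoeff α m * (ascPochhammer ℝ m).eval α
      = (-1 / 4) ^ m / m.factorial := fun m => by
    have := one_le_ascPochhammer hα1 m
    have h2 : (ascPochhammer ℝ m).eval α ≠ 0 := by linarith
    rw [besselCoeff, div_pow]
    field_simp
  have hFint : ∀ m, ∫ x in Ioi (0 : ℝ), F m x
      = Real.Gamma α / 2 * ε ^ (-α) * ((-w / (4 * ε)) ^ m / m.factorial) := fun m => by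
    simp only [hF, integral_const_mul]
    rw [hα, integral_pow_mul_exp_neg_sq hd m hε, ← hα]
    calc _ = Real.Gamma α / 2 * ε ^ (-α) * ((besselCoeff α m * (ascPochhammer ℝ m).eval α)
          * (w ^ m * (1 / ε) ^ m)) := by ring
      _ = _ := by
        rw [hcoef, ← mul_pow, div_mul_eq_mul_div ((-1 / 4 : ℝ) ^ m), ← mul_pow]
        congr 3
        field_simp
  have hFnorm : ∀ m, ∫ x in Ioi (0 : ℝ), ‖F m x‖
      = Real.Gamma α / 2 * ε ^ (-α) * ((|w| / (4 * ε)) ^ m / m.factorial) := fun m => by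
    have e : ∀ x ∈ Ioi (0 : ℝ), ‖F m x‖
        = |besselCoeff α m * w ^ m| * ((x ^ 2) ^ m * (x ^ (d - 1) * Real.exp (-ε * x ^ 2))) :=
      fun x hx => by
        have hx' : (0 : ℝ) < x := hx
        simp only [hF]
        rw [Real.norm_eq_abs, abs_mul, abs_of_nonneg
          (by positivity : 0 ≤ (x ^ 2) ^ m * (x ^ (d - 1) * Real.exp (-ε * x ^ 2)))]
    rw [setIntegral_congr_fun measurableSet_Ioi e, integral_const_mul,
      hα, integral_pow_mul_exp_neg_sq hd m hε, ← hα]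
    have hp := one_le_ascPochhammer hα1 m
    calc _ = Real.Gamma α / 2 * ε ^ (-α) * (|besselCoeff α m * (ascPochhammer ℝ m).eval α|
          * (|w| ^ m * (1 / ε) ^ m)) := by
          rw [abs_mul, abs_pow, abs_mul, abs_of_pos (by linarith : 0 < (ascPochhammer ℝ m).eval α)]
          ring
      _ = _ := by
        rw [hcoef, abs_div, abs_pow, Nat.abs_cast, ← mul_pow, div_mul_eq_mul_div (|(-1 / 4 : ℝ)| ^ m),
          ← mul_pow]
        congr 3
        rw [abs_div, abs_neg, abs_one, abs_of_pos (by norm_num : (0 : ℝ) < 4)]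
        field_simp
  have h := hasSum_integral_of_summable_integral_norm (μ := volume.restrict (Ioi (0 : ℝ)))
    (F := F) (fun m => (hint m).const_mul _) ?_
  · simp only [hFint] at h
    have h2 := ((NormedSpace.expSeries_div_hasSum_exp (-w / (4 * ε)))).mul_left
      (Real.Gamma α / 2 * ε ^ (-α))
    rw [← Real.exp_eq_exp_ℝ] at h2
    rw [← hα, ← h.unique h2, besselLaplace, ← hα]
    refine setIntegral_congr_fun measurableSet_Ioi fun x _ => ?_
    simp only [pow_zero, mul_one, besselEntire, hF]
    rw [← tsum_mul_right]
    refine tsum_congr fun m => ?_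
    rw [mul_pow]; ring
  · simp only [hFnorm]
    exact (Real.summable_pow_div_factorial _).mul_left _

theorem besselLaplace_bound {d : ℕ} (hd : 2 ≤ d) (j : ℕ) {ε w x : ℝ} (hw : 0 ≤ w) (hx : 0 ≤ x) :
    |besselEntire ((d : ℝ) / 2) (x ^ 2 * w) * besselEntire ((d : ℝ) / 2) (x ^ 2) ^ j
      * (x ^ (d - 1) * Real.exp (-ε * x ^ 2))| ≤ x ^ (d - 1) * Real.exp (-ε * x ^ 2) := by
  have h0 : 0 ≤ x ^ (d - 1) * Real.exp (-ε * x ^ 2) := by positivity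
  rw [abs_mul, abs_mul, abs_pow, abs_of_nonneg h0]
  have h1 := abs_besselEntire_le_one hd (mul_nonneg (sq_nonneg x) hw)
  have h2 := abs_besselEntire_le_one hd (sq_nonneg x)
  calc _ ≤ 1 * 1 ^ j * (x ^ (d - 1) * Real.exp (-ε * x ^ 2)) := by gcongr
    _ = _ := by simp

/-- The averaging recursion between the regularized moments. -/
theorem integral_besselLaplace {d : ℕ} (hd : 2 ≤ d) (j : ℕ) {ε r : ℝ} (hε : 0 < ε) (hr : 0 ≤ r) :
    ∫ t in (0 : ℝ)..Real.pi, besselLaplace d j ε (sideSq r t) * Real.sin t ^ (d - 2)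
      = sinMass d * besselLaplace d (j + 1) ε (r ^ 2) := by
  have hd' : (2 : ℝ) ≤ d := by exact_mod_cast hd
  have hc : Continuous (besselEntire ((d : ℝ) / 2)) := besselEntire_continuous (by linarith)
  set G : ℝ → ℝ → ℝ := fun t x => besselEntire ((d : ℝ) / 2) (x ^ 2 * sideSq r t)
    * besselEntire ((d : ℝ) / 2) (x ^ 2) ^ j * (x ^ (d - 1) * Real.exp (-ε * x ^ 2))
      * Real.sin t ^ (d - 2) with hG
  have hGc : Continuous (Function.uncurry G) := by
    have h1 : Continuous fun p : ℝ × ℝ => p.2 ^ 2 * sideSq r p.1 := by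
      unfold sideSq; fun_prop
    have h2 : Continuous fun p : ℝ × ℝ => p.2 ^ 2 := by fun_prop
    simp only [hG, Function.uncurry_def]
    exact (((hc.comp h1).mul ((hc.comp h2).pow j)).mul (by fun_prop)).mul (by fun_prop)
  have hGi : Integrable (Function.uncurry G)
      ((volume.restrict (Ioc 0 Real.pi)).prod (volume.restrict (Ioi 0))) := by
    have h1 : Integrable (fun _ : ℝ => (1 : ℝ)) (volume.restrict (Ioc 0 Real.pi)) :=
      integrable_const _
    refine Integrable.mono' (h1.mul_prod (integrableOn_pow_mul_exp_neg_sq (d - 1) hε))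
      hGc.aestronglyMeasurable ?_
    rw [Measure.prod_restrict]
    refine (ae_restrict_iff' (measurableSet_Ioc.prod measurableSet_Ioi)).2
      (Eventually.of_forall fun p hp => ?_)
    have hp2 : (0 : ℝ) ≤ p.2 := (mem_Ioi.1 hp.2).le
    have hs := Real.abs_sin_le_one p.1
    have h3 := besselLaplace_bound hd j (ε := ε) (sideSq_nonneg r p.1) hp2
    simp only [hG, Function.uncurry, Real.norm_eq_abs, one_mul]
    rw [abs_mul, abs_pow]
    calc _ ≤ p.2 ^ (d - 1) * Real.exp (-ε * p.2 ^ 2) * 1 ^ (d - 2) := by gcongr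
      _ = _ := by simp
  -- By Fubini the angular average acts inside the x-integral, where the product formula splits off
  -- one more factor Φ(x) and so raises j by one.
  have hswap := integral_integral_swap hGi
  have e1 : ∫ t in (0 : ℝ)..Real.pi, besselLaplace d j ε (sideSq r t) * Real.sin t ^ (d - 2)
      = ∫ t in Ioc 0 Real.pi, ∫ x in Ioi (0 : ℝ), G t x := by
    rw [intervalIntegral.integral_of_le Real.pi_pos.le]
    refine integral_congr_ae (Eventually.of_forall fun t => ?_)
    simp only [hG, besselLaplace]
    rw [← integral_mul_const]
  rw [e1, hswap, besselLaplace, ← integral_const_mul]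
  refine integral_congr_ae (Eventually.of_forall fun x => ?_)
  have hprod := besselEntire_product hd x hr
  rw [intervalIntegral.integral_of_le Real.pi_pos.le] at hprod
  have e2 : ∀ t, G t x = besselEntire ((d : ℝ) / 2) (x ^ 2 * sideSq r t) * Real.sin t ^ (d - 2)
      * (besselEntire ((d : ℝ) / 2) (x ^ 2) ^ j * (x ^ (d - 1) * Real.exp (-ε * x ^ 2))) :=
    fun t => by simp only [hG]; ring
  simp only [e2]
  rw [integral_mul_const, hprod]
  ring

theorem besselLaplace_continuousOn_sideSq {d : ℕ} (hd : 2 ≤ d) (j : ℕ) {ε r : ℝ} (hε : 0 < ε) :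
    Continuous fun t => besselLaplace d j ε (sideSq r t) := by
  have hd' : (2 : ℝ) ≤ d := by exact_mod_cast hd
  have hc : Continuous (besselEntire ((d : ℝ) / 2)) := besselEntire_continuous (by linarith)
  unfold besselLaplace
  refine continuous_of_dominated (bound := fun x => x ^ (d - 1) * Real.exp (-ε * x ^ 2)) ?_ ?_
    (integrableOn_pow_mul_exp_neg_sq (d - 1) hε) ?_
  · intro t
    have h1 : Continuous fun x : ℝ => x ^ 2 * sideSq r t := by fun_prop
    have h2 : Continuous fun x : ℝ => x ^ 2 := by fun_prop
    exact (((hc.comp h1).mul ((hc.comp h2).pow j)).mul (by fun_prop)).aestronglyMeasurable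
  · intro t
    refine (ae_restrict_iff' measurableSet_Ioi).2 (Eventually.of_forall fun x hx => ?_)
    exact besselLaplace_bound hd j (sideSq_nonneg r t) (mem_Ioi.1 hx).le
  · refine Eventually.of_forall fun x => ?_
    have h1 : Continuous fun t => x ^ 2 * sideSq r t := by unfold sideSq; fun_prop
    exact ((hc.comp h1).mul continuous_const).mul continuous_const

/-- For j = 0 it is a Gaussian, and each increase of j is an average with nonnegative weight. -/
theorem besselLaplace_nonneg {d : ℕ} (hd : 2 ≤ d) (j : ℕ) {ε : ℝ} (hε : 0 < ε) {w : ℝ}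
    (hw : 0 ≤ w) : 0 ≤ besselLaplace d j ε w := by
  have hd' : (2 : ℝ) ≤ d := by exact_mod_cast hd
  induction j generalizing w with
  | zero =>
    rw [besselLaplace_zero hd hε]
    have := Real.Gamma_pos_of_pos (by linarith : 0 < (d : ℝ) / 2)
    positivity
  | succ j ih =>
    have h := integral_besselLaplace hd j hε (Real.sqrt_nonneg w)
    rw [Real.sq_sqrt hw] at h
    have h2 : 0 ≤ ∫ t in (0 : ℝ)..Real.pi,
        besselLaplace d j ε (sideSq (√w) t) * Real.sin t ^ (d - 2) := by
      refine intervalIntegral.integral_nonneg Real.pi_pos.le fun t ht => ?_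
      exact mul_nonneg (ih (sideSq_nonneg _ _)) (pow_nonneg (Real.sin_nonneg_of_mem_Icc ht) _)
    rw [h] at h2
    exact nonneg_of_mul_nonneg_right h2 (sinMass_pos d)

theorem le_besselLaplace_succ {d : ℕ} (hd : 2 ≤ d) (j : ℕ) {ε w a b m : ℝ} (hε : 0 < ε)
    (hw : 0 ≤ w) (ha : 0 ≤ a) (hab : a ≤ b) (hb : b ≤ Real.pi)
    (hm : ∀ t ∈ Icc a b, m ≤ besselLaplace d j ε (sideSq (√w) t) * Real.sin t ^ (d - 2)) :
    (b - a) * m / sinMass d ≤ besselLaplace d (j + 1) ε w := by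
  have h := integral_besselLaplace hd j hε (Real.sqrt_nonneg w)
  rw [Real.sq_sqrt hw] at h
  have hc : Continuous fun t => besselLaplace d j ε (sideSq (√w) t) * Real.sin t ^ (d - 2) :=
    (besselLaplace_continuousOn_sideSq hd j hε).mul (by fun_prop)
  rw [div_le_iff₀ (sinMass_pos d), mul_comm (besselLaplace d (j + 1) ε w), ← h]
  calc (b - a) * m = ∫ _ in a..b, m := by simp
    _ ≤ ∫ t in a..b, besselLaplace d j ε (sideSq (√w) t) * Real.sin t ^ (d - 2) :=
        intervalIntegral.integral_mono_on hab intervalIntegrable_const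
          (hc.intervalIntegrable _ _) hm
    _ ≤ _ := by
        refine intervalIntegral.integral_mono_interval ha hab hb ?_ (hc.intervalIntegrable _ _)
        refine (ae_restrict_iff' measurableSet_Ioc).2 (Eventually.of_forall fun t ht => ?_)
        exact mul_nonneg (besselLaplace_nonneg hd j hε (sideSq_nonneg _ _))
          (pow_nonneg (Real.sin_nonneg_of_mem_Icc (Ioc_subset_Icc_self ht)) _)

/-- After one unit step the mass lies near the unit sphere, in a layer of width δ and height 1/δ.
For t in [δ/2, δ] the squared side is at most 4δ², so the Gaussian factor is at least e^(-1); length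
δ, weight δ^(d-2) and normalization δ^(-d) multiply to 1/δ. -/
theorem exists_le_besselLaplace_one {d : ℕ} (hd : 2 ≤ d) : ∃ c : ℝ, 0 < c ∧
    ∀ δ : ℝ, 0 < δ → δ ≤ 1 → ∀ w : ℝ, 0 ≤ w → |w - 1| ≤ δ →
      c / δ ≤ besselLaplace d 1 (δ ^ 2) w := by
  have hd' : (2 : ℝ) ≤ d := by exact_mod_cast hd
  have hΓ := Real.Gamma_pos_of_pos (by linarith : 0 < (d : ℝ) / 2)
  have hmass := sinMass_pos d
  refine ⟨1 / 2 * (Real.Gamma ((d : ℝ) / 2) / 2 * Real.exp (-1) * (1 / 4) ^ (d - 2)) / sinMass d,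
    by positivity, fun δ hδ hδ1 w hw hwδ => ?_⟩
  have hε : 0 < δ ^ 2 := by positivity
  have hr0 := Real.sqrt_nonneg w
  have hr2 := Real.sq_sqrt hw
  have hr : |√w - 1| ≤ δ := by
    have : |√w - 1| * (√w + 1) = |w - 1| := by
      rw [← abs_of_nonneg (by linarith : 0 ≤ √w + 1), ← abs_mul]
      congr 1; linear_combination hr2
    nlinarith [abs_nonneg (√w - 1)]
  have hr' := abs_le.1 hr
  have h := le_besselLaplace_succ hd 0 hε hw (a := δ / 2) (b := δ)
    (m := Real.Gamma ((d : ℝ) / 2) / 2 * Real.exp (-1) * (1 / 4) ^ (d - 2) / δ ^ 2)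
    (by linarith) (by linarith) (by linarith [Real.pi_gt_three]) ?_
  · refine le_trans (le_of_eq ?_) h
    field_simp
    ring
  · intro t ht
    have ht0 : 0 < t := by linarith [ht.1]
    rw [besselLaplace_zero hd hε]
    have hpow : (δ ^ 2) ^ (-((d : ℝ) / 2)) = 1 / δ ^ 2 * (1 / δ) ^ (d - 2) := by
      rw [← Real.rpow_natCast δ 2, ← Real.rpow_mul hδ.le,
        show ((2 : ℕ) : ℝ) * (-((d : ℝ) / 2)) = -((d : ℕ) : ℝ) by push_cast; ring,
        Real.rpow_neg hδ.le, Real.rpow_natCast, Real.rpow_natCast, one_div_pow, one_div, one_div,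
        ← mul_inv, ← pow_add, Nat.add_sub_cancel' hd]
    have hside : sideSq (√w) t ≤ 4 * δ ^ 2 := by
      have hcos := Real.one_sub_sq_div_two_le_cos (x := t)
      have e : sideSq (√w) t = (√w - 1) ^ 2 + 2 * √w * (1 - Real.cos t) := by rw [sideSq]; ring
      have h1 : (√w - 1) ^ 2 ≤ δ ^ 2 := sq_le_sq' hr'.1 hr'.2
      have h2 : t ^ 2 ≤ δ ^ 2 := by have := ht.2; gcongr
      have h3 : 2 * √w * (1 - Real.cos t) ≤ 4 * (δ ^ 2 / 2) := by
        have : 1 - Real.cos t ≤ δ ^ 2 / 2 := by linarith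
        calc 2 * √w * (1 - Real.cos t) ≤ 2 * √w * (δ ^ 2 / 2) := by gcongr
          _ ≤ 4 * (δ ^ 2 / 2) := by gcongr; linarith
      linarith
    have hexp : Real.exp (-1) ≤ Real.exp (-sideSq (√w) t / (4 * δ ^ 2)) := by
      rw [Real.exp_le_exp, neg_div, neg_le_neg_iff, div_le_one (by positivity)]
      exact hside
    have hsin : δ / 4 ≤ Real.sin t := by
      have := half_le_sin ht0.le (by linarith [ht.2, Real.pi_gt_three])
      linarith [ht.1]
    rw [hpow]
    calc Real.Gamma ((d : ℝ) / 2) / 2 * Real.exp (-1) * (1 / 4) ^ (d - 2) / δ ^ 2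
        = Real.Gamma ((d : ℝ) / 2) / 2 * (1 / δ ^ 2 * (1 / δ) ^ (d - 2)) * Real.exp (-1)
          * (δ / 4) ^ (d - 2) := by
          rw [div_pow δ, one_div_pow, one_div_pow]; field_simp
      _ ≤ _ := by gcongr

/-- At the angle with cos s = √w/2 the third side has length exactly 1. Moving t by η/3 changes the
squared side by at most η, so an angular interval of that length remains in the window where A is
available. -/
theorem exists_le_besselLaplace_step {d : ℕ} (hd : 2 ≤ d) : ∃ c : ℝ, 0 < c ∧
    ∀ (j : ℕ) (ε η A : ℝ), 0 < ε → 0 < η → η ≤ 1 → 0 ≤ A →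
      (∀ w : ℝ, 0 ≤ w → |w - 1| ≤ η → A ≤ besselLaplace d j ε w) →
      ∀ w : ℝ, 0 ≤ w → |w - 1| ≤ 1 / 2 → c * η * A ≤ besselLaplace d (j + 1) ε w := by
  have hmass := sinMass_pos d
  refine ⟨1 / 3 * (1 / 4) ^ (d - 2) / sinMass d, by positivity,
    fun j ε η A hε hη hη1 hA hlow w hw hw1 => ?_⟩
  have hr0 := Real.sqrt_nonneg w
  have hr2 := Real.sq_sqrt hw
  have hw' := abs_le.1 hw1
  have hru : √w ≤ 3 / 2 := by nlinarith
  have hrl : 1 / 2 ≤ √w := by nlinarith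
  set s := Real.arccos (√w / 2) with hs
  have hcs : Real.cos s = √w / 2 := Real.cos_arccos (by linarith) (by linarith)
  have hs0 : 0 ≤ s := Real.arccos_nonneg _
  have hspi : s ≤ Real.pi / 2 := Real.arccos_le_pi_div_two.2 (by positivity)
  -- Here w ≤ 3/2 gives sin² s ≥ 5/8; the value 3/5 keeps sin t above 1/4 after a shift by η/3 ≤
  -- 1/3.
  have hsin : 3 / 5 ≤ Real.sin s := by
    rw [hs, Real.sin_arccos]
    refine Real.le_sqrt_of_sq_le ?_
    rw [div_pow (√w), hr2]
    linarith
  have h := le_besselLaplace_succ hd j hε hw (a := s) (b := s + η / 3) (m := A * (1 / 4) ^ (d - 2))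
    hs0 (by linarith) (by linarith [Real.pi_gt_three]) ?_
  · refine le_trans (le_of_eq ?_) h
    field_simp
    ring
  · intro t ht
    have htd : |t - s| ≤ η / 3 := by
      rw [abs_le]; constructor <;> linarith [ht.1, ht.2]
    have hcos : |Real.cos t - Real.cos s| ≤ η / 3 := (Real.abs_cos_sub_cos_le t s).trans htd
    have hsint : |Real.sin t - Real.sin s| ≤ η / 3 := (Real.abs_sin_sub_sin_le t s).trans htd
    have hst : 1 / 4 ≤ Real.sin t := by linarith [(abs_le.1 hsint).1]
    have hside : |sideSq (√w) t - 1| ≤ η := by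
      have e : sideSq (√w) t - 1 = -(2 * √w * (Real.cos t - Real.cos s)) := by
        rw [sideSq, hcs]; ring
      rw [e, abs_neg, abs_mul, abs_of_nonneg (by positivity : 0 ≤ 2 * √w)]
      calc _ ≤ 3 * (η / 3) := by gcongr; linarith
        _ = η := by ring
    have := hlow _ (sideSq_nonneg _ _) hside
    exact mul_le_mul this (pow_le_pow_left₀ (by norm_num) hst _) (by positivity) (hA.trans this)

/-- At the second step the window width δ cancels the height 1/δ, so the constant is free of δ.
Later steps use the fixed window 1/2. -/
theorem exists_le_besselLaplace {d : ℕ} (hd : 2 ≤ d) (j : ℕ) : ∃ c : ℝ, 0 < c ∧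
    ∀ δ : ℝ, 0 < δ → δ ≤ 1 → ∀ w : ℝ, 0 ≤ w → |w - 1| ≤ 1 / 2 →
      c ≤ besselLaplace d (j + 2) (δ ^ 2) w := by
  obtain ⟨c₁, hc₁, h₁⟩ := exists_le_besselLaplace_step hd
  induction j with
  | zero =>
    obtain ⟨c₀, hc₀, h₀⟩ := exists_le_besselLaplace_one hd
    refine ⟨c₁ * c₀, by positivity, fun δ hδ hδ1 w hw hw1 => ?_⟩
    have := h₁ 1 (δ ^ 2) δ (c₀ / δ) (by positivity) hδ hδ1 (by positivity) (h₀ δ hδ hδ1) w hw hw1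
    refine le_trans (le_of_eq ?_) this
    field_simp
  | succ j ih =>
    obtain ⟨c, hc, h⟩ := ih
    refine ⟨c₁ * (1 / 2) * c, by positivity, fun δ hδ hδ1 w hw hw1 => ?_⟩
    exact h₁ (j + 2) (δ ^ 2) (1 / 2) c (by positivity) (by norm_num) (by norm_num) hc.le
      (h δ hδ hδ1) w hw hw1

/-- An Abelian estimate: a lower bound for Gaussian means passes to the improper integral. -/
theorem le_improper_of_gaussian_le {g : ℝ → ℝ} (hg : Continuous g) {I c : ℝ}
    (hI : Tendsto (fun R : ℝ => ∫ x in (0 : ℝ)..R, g x) atTop (𝓝 I))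
    (hint : ∀ ε : ℝ, 0 < ε → IntegrableOn (fun x => g x * Real.exp (-ε * x ^ 2)) (Ioi 0))
    (hc : ∀ᶠ ε : ℝ in 𝓝[>] 0, c ≤ ∫ x in Ioi (0 : ℝ), g x * Real.exp (-ε * x ^ 2)) : c ≤ I := by
  refine le_of_forall_pos_le_add fun η hη => ?_
  set F : ℝ → ℝ := fun R => ∫ x in (0 : ℝ)..R, g x with hF
  have hFd : ∀ x, HasDerivAt F (g x) x := fun x => hg.integral_hasStrictDerivAt 0 x |>.hasDerivAt
  have hFc : Continuous F := continuous_iff_continuousAt.2 fun x => (hFd x).continuousAt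
  obtain ⟨R, hR, hR0⟩ : ∃ R, (∀ x, R ≤ x → F x ≤ I + η) ∧ 0 ≤ R := by
    obtain ⟨R, hR⟩ := eventually_atTop.1 (hI.eventually (ge_mem_nhds (by linarith : I < I + η)))
    exact ⟨max R 0, fun x hx => hR x ((le_max_left _ _).trans hx), le_max_right _ _⟩
  obtain ⟨K, hK⟩ := (isCompact_Icc (a := 0) (b := R)).exists_bound_of_continuousOn hFc.continuousOn
  have hK0 : 0 ≤ K := (norm_nonneg _).trans (hK 0 ⟨le_rfl, hR0⟩)
  have hed : ∀ ε x : ℝ, HasDerivAt (fun x => Real.exp (-ε * x ^ 2))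
      (-(2 * ε * x * Real.exp (-ε * x ^ 2))) x := fun ε x => by
    refine (((hasDerivAt_pow 2 x).const_mul (-ε)).exp).congr_deriv ?_
    norm_num
    ring
  have hec : ∀ ε : ℝ, Continuous fun x : ℝ => 2 * ε * x * Real.exp (-ε * x ^ 2) := fun ε => by
    fun_prop
  -- Integration by parts makes the Gaussian mean of g an average of F with weight 2εx exp(-εx²).
  -- The part up to R is O(ε), and beyond R one has F ≤ I + η.
  have hbound : ∀ ε : ℝ, 0 < ε → ∫ x in Ioi (0 : ℝ), g x * Real.exp (-ε * x ^ 2)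
      ≤ K * (ε * R ^ 2) + (I + η) * Real.exp (-ε * R ^ 2) := by
    intro ε hε
    have hexp : Tendsto (fun T : ℝ => Real.exp (-ε * T ^ 2)) atTop (𝓝 0) := by
      refine Real.tendsto_exp_atBot.comp ?_
      exact (tendsto_pow_atTop two_ne_zero).const_mul_atTop_of_neg (by linarith)
    have hlim : Tendsto (fun T => F T * Real.exp (-ε * T ^ 2) + K * (ε * R ^ 2)
        + (I + η) * (Real.exp (-ε * R ^ 2) - Real.exp (-ε * T ^ 2))) atTop
        (𝓝 (I * 0 + K * (ε * R ^ 2) + (I + η) * (Real.exp (-ε * R ^ 2) - 0))) :=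
      ((hI.mul hexp).add_const _).add ((hexp.const_sub _).const_mul _)
    have h := le_of_tendsto_of_tendsto
      (intervalIntegral_tendsto_integral_Ioi 0 (hint ε hε) tendsto_id) hlim ?_
    · simpa using h
    · filter_upwards [eventually_ge_atTop R] with T hT
      have hi : ∀ a b, IntervalIntegrable (fun x => F x * (2 * ε * x * Real.exp (-ε * x ^ 2)))
          volume a b := fun a b => (hFc.mul (hec ε)).intervalIntegrable _ _
      have hi2 : IntervalIntegrable (fun x => g x * Real.exp (-ε * x ^ 2)) volume 0 T :=
        (hg.mul (by fun_prop)).intervalIntegrable _ _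
      have hi3 : IntervalIntegrable (fun x => g x * Real.exp (-ε * x ^ 2)
          + F x * -(2 * ε * x * Real.exp (-ε * x ^ 2))) volume 0 T :=
        ((hg.mul (by fun_prop)).add (hFc.mul (hec ε).neg)).intervalIntegrable _ _
      have e1 : ∫ x in (0 : ℝ)..T, (g x * Real.exp (-ε * x ^ 2)
          + F x * -(2 * ε * x * Real.exp (-ε * x ^ 2))) = F T * Real.exp (-ε * T ^ 2) := by
        rw [intervalIntegral.integral_eq_sub_of_hasDerivAt
          (fun x _ => (hFd x).mul (hed ε x)) hi3]
        simp [hF]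
      have e2 : ∫ x in (0 : ℝ)..T, g x * Real.exp (-ε * x ^ 2) = F T * Real.exp (-ε * T ^ 2)
          + ((∫ x in (0 : ℝ)..R, F x * (2 * ε * x * Real.exp (-ε * x ^ 2)))
            + ∫ x in R..T, F x * (2 * ε * x * Real.exp (-ε * x ^ 2))) := by
        rw [intervalIntegral.integral_add_adjacent_intervals (hi _ _) (hi _ _), ← e1,
          ← intervalIntegral.integral_add hi3 (hi _ _)]
        exact intervalIntegral.integral_congr fun x _ => by ring
      have b1 : ∫ x in (0 : ℝ)..R, F x * (2 * ε * x * Real.exp (-ε * x ^ 2)) ≤ K * (ε * R ^ 2) := by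
        have : ∫ x in (0 : ℝ)..R, K * (2 * ε) * x = K * (ε * R ^ 2) := by
          rw [intervalIntegral.integral_const_mul, integral_id]; ring
        rw [← this]
        refine intervalIntegral.integral_mono_on hR0 (hi _ _)
          ((by fun_prop : Continuous fun x : ℝ => K * (2 * ε) * x).intervalIntegrable _ _)
          fun x hx => ?_
        have hFx : F x ≤ K := (le_abs_self _).trans (hK x hx)
        have hex : Real.exp (-ε * x ^ 2) ≤ 1 := Real.exp_le_one_iff.2 (by nlinarith [sq_nonneg x])
        have hx0 := hx.1
        calc F x * (2 * ε * x * Real.exp (-ε * x ^ 2)) ≤ K * (2 * ε * x * 1) := by gcongr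
          _ = _ := by ring
      have b2 : ∫ x in R..T, F x * (2 * ε * x * Real.exp (-ε * x ^ 2))
          ≤ (I + η) * (Real.exp (-ε * R ^ 2) - Real.exp (-ε * T ^ 2)) := by
        have : ∫ x in R..T, (I + η) * (2 * ε * x * Real.exp (-ε * x ^ 2))
            = (I + η) * (Real.exp (-ε * R ^ 2) - Real.exp (-ε * T ^ 2)) := by
          rw [intervalIntegral.integral_const_mul, intervalIntegral.integral_eq_sub_of_hasDerivAt
            (f := fun x => -Real.exp (-ε * x ^ 2))
            (fun x _ => by
              have := (hed ε x).neg
              rw [neg_neg] at this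
              exact this)
            ((hec ε).intervalIntegrable _ _)]
          ring
        rw [← this]
        refine intervalIntegral.integral_mono_on hT (hi _ _)
          ((continuous_const.mul (hec ε)).intervalIntegrable _ _) fun x hx => ?_
        have hx0 : 0 ≤ x := hR0.trans hx.1
        have := hR x hx.1
        gcongr
      simp only [id]
      rw [e2]
      linarith
  have hlim : Tendsto (fun ε : ℝ => K * (ε * R ^ 2) + (I + η) * Real.exp (-ε * R ^ 2)) (𝓝[>] 0)
      (𝓝 (I + η)) := by
    have : Continuous fun ε : ℝ => K * (ε * R ^ 2) + (I + η) * Real.exp (-ε * R ^ 2) := by fun_prop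
    have h := this.tendsto 0
    simp only [zero_mul, mul_zero, neg_zero, Real.exp_zero, mul_one, zero_add] at h
    exact h.mono_left nhdsWithin_le_nhds
  refine ge_of_tendsto hlim ?_
  filter_upwards [hc, self_mem_nhdsWithin] with ε h1 h2
  exact h1.trans (hbound ε h2)

/-- At w = 1 the leading factor is one more Φ(x), so `besselLaplace d (q - 1) ε 1` is the Gaussian
mean of the integrand. The estimate for at least two steps applies because q - 1 ≥ 2, with δ = √ε.
-/
theorem besselMoment_pos {d q : ℕ} (hd : 2 ≤ d) (hq : 3 ≤ q) {I : ℝ}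
    (hI : Tendsto (fun R : ℝ => ∫ x in (0 : ℝ)..R, besselScaledIntegrand d q x) atTop (𝓝 I)) :
    0 < I := by
  obtain ⟨j, rfl⟩ : ∃ j, q = j + 2 + 1 := ⟨q - 3, by omega⟩
  obtain ⟨c, hc, h⟩ := exists_le_besselLaplace hd j
  have e : ∀ ε x : ℝ, besselEntire ((d : ℝ) / 2) (x ^ 2 * 1)
      * besselEntire ((d : ℝ) / 2) (x ^ 2) ^ (j + 2) * (x ^ (d - 1) * Real.exp (-ε * x ^ 2))
      = besselScaledIntegrand d (j + 2 + 1) x * Real.exp (-ε * x ^ 2) := fun ε x => by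
    rw [besselScaledIntegrand, pow_succ, mul_one]; ring
  refine hc.trans_le (le_improper_of_gaussian_le (besselScaledIntegrand_continuous hd _) hI ?_ ?_)
  · intro ε hε
    refine Integrable.mono' (integrableOn_pow_mul_exp_neg_sq (d - 1) hε)
      ((besselScaledIntegrand_continuous hd _).mul (by fun_prop)).aestronglyMeasurable ?_
    refine (ae_restrict_iff' measurableSet_Ioi).2 (Eventually.of_forall fun x hx => ?_)
    rw [← e]
    exact besselLaplace_bound hd (j + 2) zero_le_one (mem_Ioi.1 hx).le
  · have hmem : Ioc (0 : ℝ) 1 ∈ 𝓝[>] (0 : ℝ) := Ioc_mem_nhdsGT one_pos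
    filter_upwards [hmem] with ε hε
    have h1 := h (√ε) (Real.sqrt_pos.2 hε.1) (Real.sqrt_le_one.2 hε.2) 1 zero_le_one (by norm_num)
    rw [Real.sq_sqrt hε.1.le, besselLaplace] at h1
    simpa only [e] using h1

/-! ### Legendre polynomials at the equator and Wallis' product. -/

/-- Rodrigues' formula, via the shifted Legendre polynomials. It turns equatorial values into Taylor
coefficients of (X(1 - X))^l at 1/2. -/
theorem gegenbauerShift_two_eq_hasseDeriv (l : ℕ) : gegenbauerShift 2 l
    = Polynomial.hasseDeriv l ((Polynomial.X * (1 - Polynomial.X)) ^ l) := by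
  have h1 : gegenbauerShift 2 l
      = (Polynomial.shiftedLegendre l).map (Int.castRingHom ℝ) := by
    ext k
    rw [gegenbauerShift_coeff, Polynomial.coeff_map, Polynomial.coeff_shiftedLegendre,
      gegenbauerCoeff]
    have h2 : ((2 : ℕ) : ℝ) / 2 = 1 := by norm_num
    have h3 : (l : ℝ) + (2 : ℕ) - 1 = ((l + 1 : ℕ) : ℝ) := by push_cast; ring
    rw [h2, h3, ascPochhammer_eval_one, ← ascPochhammer_eval_cast,
      ascPochhammer_nat_eq_ascFactorial, Nat.ascFactorial_eq_factorial_mul_choose,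
      Nat.choose_symm_add]
    have h4 : (k.factorial : ℝ) ≠ 0 := by positivity
    simp only [eq_intCast]
    push_cast
    field_simp
  have h5 := congrArg (Polynomial.map (Int.castRingHom ℝ))
    (Polynomial.factorial_mul_shiftedLegendre_eq l)
  rw [Polynomial.map_mul, ← h1, ← Polynomial.iterate_derivative_map, Polynomial.map_natCast]
    at h5
  simp only [← Polynomial.factorial_smul_hasseDeriv, Polynomial.map_mul, Polynomial.map_pow,
    Polynomial.map_sub, Polynomial.map_X, Polynomial.map_one,
    nsmul_eq_mul, ← mul_pow] at h5
  have h6 : (l.factorial : Polynomial ℝ) ≠ 0 := Nat.cast_ne_zero.2 l.factorial_ne_zero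
  exact mul_left_cancel₀ h6 (by simpa [nsmul_eq_mul] using h5)

/-- With X = Y + 1/2 one has X(1 - X) = -(Y² - 1/4), even in Y, so the Taylor coefficients are
binomial and vanish in odd degree. -/
theorem taylor_half_mul_one_sub_pow (l : ℕ) :
    Polynomial.taylor (1 / 2 : ℝ) ((Polynomial.X * (1 - Polynomial.X)) ^ l)
      = Polynomial.C ((-1) ^ l)
        * Polynomial.expand ℝ 2 ((Polynomial.X + Polynomial.C (-1 / 4)) ^ l) := by
  have h : Polynomial.taylor (1 / 2 : ℝ) (Polynomial.X * (1 - Polynomial.X))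
      = -1 * Polynomial.expand ℝ 2 (Polynomial.X + Polynomial.C (-1 / 4)) := by
    have h1 : Polynomial.C (-1 / 4 : ℝ) = - (Polynomial.C (1 / 2 : ℝ)) ^ 2 := by
      rw [← Polynomial.C_pow, ← Polynomial.C_neg]; norm_num
    have h2 : (1 : Polynomial ℝ) = 2 * Polynomial.C (1 / 2 : ℝ) := by
      rw [show (2 : Polynomial ℝ) = Polynomial.C 2 from rfl, ← Polynomial.C_mul]; norm_num
    rw [Polynomial.taylor_mul, map_sub, Polynomial.taylor_one, Polynomial.taylor_X, map_add,
      Polynomial.expand_X, Polynomial.expand_C, h1]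
    generalize Polynomial.C (1 / 2 : ℝ) = c at *
    simp only [map_one]
    linear_combination (Polynomial.X + c) * h2
  rw [Polynomial.taylor_pow, h, mul_pow, map_pow, map_pow, map_neg, map_one]

theorem gegenbauerShift_two_eval_half (l : ℕ) : (gegenbauerShift 2 l).eval (1 / 2)
    = if Even l then (-1) ^ l * ((-1 / 4) ^ (l - l / 2) * (l.choose (l / 2) : ℝ)) else 0 := by
  rw [gegenbauerShift_two_eq_hasseDeriv, ← Polynomial.taylor_coeff, taylor_half_mul_one_sub_pow,
    Polynomial.coeff_C_mul, Polynomial.coeff_expand two_pos, Polynomial.coeff_X_add_C_pow]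
  simp only [even_iff_two_dvd, mul_ite, mul_zero]

theorem gegenbauerShift_two_derivative_eval_half (l : ℕ) :
    (gegenbauerShift 2 l).derivative.eval (1 / 2)
    = if Even l then 0 else (l + 1) * ((-1) ^ l *
      ((-1 / 4) ^ (l - (l + 1) / 2) * (l.choose ((l + 1) / 2) : ℝ))) := by
  have h := LinearMap.congr_fun (Polynomial.hasseDeriv_comp (R := ℝ) 1 l)
    ((Polynomial.X * (1 - Polynomial.X)) ^ l)
  rw [LinearMap.comp_apply, Polynomial.hasseDeriv_one] at h
  rw [gegenbauerShift_two_eq_hasseDeriv, h, LinearMap.smul_apply, Polynomial.eval_smul,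
    add_comm 1 l,
    ← Polynomial.taylor_coeff, taylor_half_mul_one_sub_pow,
    Polynomial.coeff_C_mul, Polynomial.coeff_expand two_pos, Polynomial.coeff_X_add_C_pow]
  simp only [← even_iff_two_dvd, Nat.even_add_one]
  split_ifs <;> simp_all

/-- The Wallis ratio. -/
theorem wallis_ratio_sq (m : ℕ) :
    (((2 * m).choose m : ℝ) / 4 ^ m) ^ 2 = 1 / (Real.Wallis.W m * (2 * m + 1)) := by
  rw [Real.Wallis.W_eq_factorial_ratio]
  have h : ((2 * m).choose m : ℝ) = (2 * m).factorial / (m.factorial * m.factorial) := by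
    rw [Nat.cast_choose ℝ (by omega)]
    congr 4; omega
  rw [h, show (4 : ℝ) ^ m = 2 ^ (2 * m) by rw [pow_mul]; norm_num]
  have h1 : (m.factorial : ℝ) ≠ 0 := by positivity
  have h2 : ((2 * m).factorial : ℝ) ≠ 0 := by positivity
  have h3 : (2 * (m : ℝ) + 1) ≠ 0 := by positivity
  field_simp
  rw [← pow_mul]; ring

/-- The energy at the equator of the Legendre oscillator. -/
noncomputable def legendreEnergy (l : ℕ) : ℝ :=
  oscillatorEnergy (gegenbauerFreq 2 l) (gegenbauerOsc 2 l) (gegenbauerOscDeriv 2 l) (Real.pi / 2)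

theorem legendreEnergy_eq (l : ℕ) : legendreEnergy l
    = ((gegenbauerShift 2 l).derivative.eval (1 / 2) / 2) ^ 2
      + gegenbauerFreq 2 l ^ 2 * (gegenbauerShift 2 l).eval (1 / 2) ^ 2 := by
  simp [legendreEnergy, oscillatorEnergy, gegenbauerOsc, gegenbauerOscDeriv, gegenbauerAngle,
    gegenbauerAngleDeriv, Real.sin_pi_div_two, Real.cos_pi_div_two]
  ring

theorem neg_quarter_pow_sq (m : ℕ) : ((-1 / 4 : ℝ) ^ m) ^ 2 = 1 / (4 ^ m) ^ 2 := by
  rw [neg_div, neg_pow, mul_pow, ← pow_mul, mul_comm m 2, pow_mul]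
  simp

/-- By parity only the value survives at the equator for even degree, and only the derivative for
odd degree. Either way the square is a squared central binomial, hence a Wallis ratio. -/
theorem legendreEnergy_even (m : ℕ) : legendreEnergy (2 * m)
    = gegenbauerFreq 2 (2 * m) ^ 2 * (1 / (Real.Wallis.W m * (2 * m + 1))) := by
  rw [legendreEnergy_eq, gegenbauerShift_two_eval_half, gegenbauerShift_two_derivative_eval_half,
    if_pos (even_two_mul m), if_pos (even_two_mul m), ← wallis_ratio_sq,
    Nat.mul_div_cancel_left m two_pos, show 2 * m - m = m by omega, (even_two_mul m).neg_one_pow,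
    mul_pow, mul_pow, neg_quarter_pow_sq]
  ring

theorem legendreEnergy_odd (m : ℕ) : legendreEnergy (2 * m + 1)
    = 4 * ((m : ℝ) + 1) ^ 2 * (1 / (Real.Wallis.W (m + 1) * (2 * (m + 1 : ℕ) + 1))) := by
  have hodd : ¬ Even (2 * m + 1) := by simp
  -- The odd-degree binomial is half a central one, which reduces this case to the Wallis ratio at m
  -- + 1.
  have h : ((2 * (m + 1)).choose (m + 1) : ℝ) = 2 * ((2 * m + 1).choose (m + 1) : ℝ) := by
    have h1 := Nat.choose_succ_succ (2 * m + 1) m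
    have h2 := Nat.choose_symm_half m
    rw [show 2 * (m + 1) = (2 * m + 1).succ by omega]
    rw [Nat.succ_eq_add_one] at h1
    rw [Nat.succ_eq_add_one, h1, ← h2]
    push_cast
    simp only [Nat.succ_eq_add_one]
    ring
  rw [legendreEnergy_eq, gegenbauerShift_two_eval_half, gegenbauerShift_two_derivative_eval_half,
    if_neg hodd, if_neg hodd, ← wallis_ratio_sq, h,
    show (2 * m + 1 + 1) / 2 = m + 1 by omega, show 2 * m + 1 - (m + 1) = m by omega,
    (Nat.not_even_iff_odd.1 hodd).neg_one_pow]
  have h4 : (4 : ℝ) ^ m ≠ 0 := by positivity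
  push_cast
  generalize ((2 * m + 1).choose (m + 1) : ℝ) = c
  rw [pow_succ (4 : ℝ) m]
  calc _ = ((m : ℝ) + 1) ^ 2 * c ^ 2 * ((-1 / 4 : ℝ) ^ m) ^ 2 := by ring
    _ = _ := by rw [neg_quarter_pow_sq]; field_simp; ring

theorem tendsto_of_even_odd {α : Type*} {f : ℕ → α} {F : Filter α}
    (h0 : Tendsto (fun m => f (2 * m)) atTop F) (h1 : Tendsto (fun m => f (2 * m + 1)) atTop F) :
    Tendsto f atTop F := by
  intro s hs
  obtain ⟨a, ha⟩ := eventually_atTop.1 (h0 hs)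
  obtain ⟨b, hb⟩ := eventually_atTop.1 (h1 hs)
  refine eventually_atTop.2 ⟨2 * max a b + 1, fun n hn => ?_⟩
  rcases Nat.even_or_odd' n with ⟨m, rfl | rfl⟩
  · exact ha m (by omega)
  · exact hb m (by omega)

theorem tendsto_add_const_div_natCast (a b : ℝ) :
    Tendsto (fun m : ℕ => (2 * (m : ℝ) + a) / (2 * m + b)) atTop (𝓝 1) := by
  have h : Tendsto (fun m : ℕ => (2 : ℝ) * (m : ℝ) + b) atTop atTop :=
    tendsto_atTop_add_const_right _ _
      (tendsto_natCast_atTop_atTop.const_mul_atTop two_pos)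
  have h1 := (h.const_div_atTop (a - b)).const_add 1
  rw [add_zero] at h1
  refine h1.congr' ?_
  filter_upwards [h.eventually_gt_atTop 0] with m hm
  field_simp
  ring

/-- Both parities behave like 1/W, and W → π/2. -/
theorem legendreEnergy_div_tendsto :
    Tendsto (fun l => legendreEnergy l / gegenbauerFreq 2 l) atTop (𝓝 (2 / Real.pi)) := by
  have hW := Real.Wallis.tendsto_W_nhds_pi_div_two
  have hp : Real.pi / 2 ≠ 0 := by positivity
  have hf : ∀ l, gegenbauerFreq 2 l = l + 1 / 2 := fun l => by
    rw [gegenbauerFreq]; norm_num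
  have hWp := Real.Wallis.W_pos
  refine tendsto_of_even_odd ?_ ?_
  · have h := (hW.inv₀ hp).mul (tendsto_add_const_div_natCast (1 / 2) 1)
    rw [mul_one, inv_div] at h
    refine h.congr fun m => ?_
    rw [legendreEnergy_even, hf]
    have := (hWp m).ne'
    push_cast
    field_simp
  · have h := ((hW.comp (tendsto_add_atTop_nat 1)).inv₀ hp).mul
      ((tendsto_add_const_div_natCast 2 3).mul (tendsto_add_const_div_natCast 2 (3 / 2)))
    rw [mul_one, mul_one, inv_div] at h
    refine h.congr fun m => ?_
    rw [legendreEnergy_odd, hf]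
    have := (hWp (m + 1)).ne'
    have h2 : (2 * (m : ℝ) + 3) ≠ 0 := by positivity
    have h3 : (2 * (m : ℝ) + 3 / 2) ≠ 0 := by positivity
    simp only [Function.comp_apply]
    push_cast
    rw [show 2 * ((m : ℝ) + 1) + 1 = 2 * m + 3 by ring,
      show 2 * (m : ℝ) + 1 + 1 / 2 = 2 * m + 3 / 2 by ring]
    field_simp
    ring

/-! ### The logarithmic case d = 2, q = 4. -/

/-- On the interval 1/t ≤ 1/sin t ≤ cot t + 1, the second because sin + cos ≥ 1. Both bounds
integrate explicitly; log 4 ≤ 2 and π/2 ≤ 2 account for the constant. -/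
theorem abs_integral_inv_sin_sub_log_le {N : ℝ} (hN : 1 ≤ N) :
    |(∫ t in (1 / (2 * N))..(Real.pi / 2), 1 / Real.sin t) - Real.log N| ≤ 4 := by
  have hpi := Real.pi_gt_three
  have hpi4 := Real.pi_lt_four
  set a := 1 / (2 * N) with ha
  have ha0 : 0 < a := by positivity
  have ha1 : a ≤ 1 / 2 := by
    rw [ha, div_le_div_iff₀ (by positivity) two_pos]; linarith
  have hab : a ≤ Real.pi / 2 := by linarith
  have hs : ∀ t ∈ Icc a (Real.pi / 2), 0 < t ∧ 0 < Real.sin t ∧ 0 ≤ Real.cos t := fun t ht =>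
    ⟨ha0.trans_le ht.1, Real.sin_pos_of_pos_of_lt_pi (ha0.trans_le ht.1) (by linarith [ht.2]),
      Real.cos_nonneg_of_mem_Icc ⟨by linarith [ht.1], ht.2⟩⟩
  have hu : uIcc a (Real.pi / 2) = Icc a (Real.pi / 2) := uIcc_of_le hab
  have hc : ∀ f : ℝ → ℝ, (∀ t ∈ Icc a (Real.pi / 2), ContinuousAt f t) →
      IntervalIntegrable f volume a (Real.pi / 2) := fun f hf =>
    ContinuousOn.intervalIntegrable (by
      rw [hu]; exact fun t ht => (hf t ht).continuousWithinAt)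
  have hc1 : IntervalIntegrable (fun t => 1 / Real.sin t) volume a (Real.pi / 2) := hc _ fun t ht =>
    continuousAt_const.div Real.continuous_sin.continuousAt (hs t ht).2.1.ne'
  have hc2 : IntervalIntegrable (fun t : ℝ => t⁻¹) volume a (Real.pi / 2) := hc _ fun t ht =>
    continuousAt_id.inv₀ (hs t ht).1.ne'
  have hc3 : IntervalIntegrable (fun t : ℝ => Real.cos t / Real.sin t) volume a (Real.pi / 2) :=
    hc _ fun t ht => Real.continuous_cos.continuousAt.div Real.continuous_sin.continuousAt
      (hs t ht).2.1.ne'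
  have hl : Real.log (Real.pi / 2 / a) ≤ ∫ t in a..(Real.pi / 2), 1 / Real.sin t := by
    rw [← integral_inv_of_pos ha0 (by positivity)]
    refine intervalIntegral.integral_mono_on hab hc2 hc1 fun t ht => ?_
    rw [inv_eq_one_div]
    exact one_div_le_one_div_of_le (hs t ht).2.1 (Real.sin_le (hs t ht).1.le)
  have hr : (∫ t in a..(Real.pi / 2), 1 / Real.sin t)
      ≤ (∫ t in a..(Real.pi / 2), (Real.cos t / Real.sin t + 1)) := by
    refine intervalIntegral.integral_mono_on hab hc1 (hc3.add (by simp)) fun t ht => ?_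
    obtain ⟨-, h1, h2⟩ := hs t ht
    rw [div_add_one h1.ne']
    gcongr
    nlinarith [Real.sin_sq_add_cos_sq t]
  have hcot : (∫ t in a..(Real.pi / 2), Real.cos t / Real.sin t)
      = Real.log (Real.sin (Real.pi / 2)) - Real.log (Real.sin a) := by
    refine intervalIntegral.integral_eq_sub_of_hasDerivAt (f := fun t => Real.log (Real.sin t))
      (fun t ht => ?_) hc3
    rw [hu] at ht
    exact (Real.hasDerivAt_sin t).log (hs t ht).2.1.ne'
  rw [intervalIntegral.integral_add hc3 (by simp), hcot, Real.sin_pi_div_two, Real.log_one,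
    intervalIntegral.integral_const, smul_eq_mul, mul_one] at hr
  have h5 : Real.log N ≤ Real.log (Real.pi / 2 / a) := by
    apply Real.log_le_log (by positivity)
    rw [ha, div_div_eq_mul_div, div_one]
    nlinarith
  have h6 : Real.log (1 / (4 * N)) ≤ Real.log (Real.sin a) := by
    apply Real.log_le_log (by positivity)
    refine le_trans (le_of_eq ?_) (half_le_sin ha0.le hab)
    rw [ha, div_div]; ring_nf
  rw [one_div, Real.log_inv, Real.log_mul (by norm_num) (by positivity)] at h6
  have h7 : Real.log 4 ≤ 2 := by
    rw [show (4 : ℝ) = 2 ^ 2 by norm_num, Real.log_pow]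
    have := Real.log_two_lt_d9
    push_cast; linarith
  rw [abs_le]
  constructor <;> linarith

/-- The cap t ≤ 1/(2N) contributes at most 1/4 after multiplication by N². Beyond it the integrand
is u⁴/sin, and N² times the mean 3E²/(8N⁴) is 3/8 · (E/N)². -/
theorem abs_quartic_moment_sub_le (l : ℕ) :
    |gegenbauerMoment 2 4 l * gegenbauerFreq 2 l ^ 2
      - 3 / 8 * (legendreEnergy l / gegenbauerFreq 2 l) ^ 2
        * ∫ t in (1 / (2 * gegenbauerFreq 2 l))..(Real.pi / 2), 1 / Real.sin t|
      ≤ 1 + (16 + 88 * |gegenbauerExp 2 * (1 - gegenbauerExp 2)|) * gegenbauerAmp 2 ^ 4 := by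
  set N := gegenbauerFreq 2 l with hNdef
  have hN : 0 < N := gegenbauerFreq_pos le_rfl l
  set a := 1 / (2 * N) with ha
  have ha0 : 0 < a := by positivity
  have hab : a ≤ Real.pi / 2 := (inv_freq_mem le_rfl l).2
  have hpi := Real.pi_pos
  have hexp : gegenbauerExp 2 = 1 / 2 := by norm_num [gegenbauerExp]
  have hu : uIcc a (Real.pi / 2) = Icc a (Real.pi / 2) := uIcc_of_le hab
  have hs : ∀ t ∈ Icc a (Real.pi / 2), 0 < Real.sin t := fun t ht =>
    Real.sin_pos_of_pos_of_lt_pi (ha0.trans_le ht.1) (by linarith [ht.2])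
  have hcont : Continuous fun t => gegenbauerAngle 2 l t ^ 4 * Real.sin t ^ (2 - 1) :=
    ((gegenbauerAngle_continuous 2 l).pow 4).mul (Real.continuous_sin.pow _)
  have hosc := gegenbauerOsc_isOscillator le_rfl l
  have h1 : |∫ t in (0 : ℝ)..a, gegenbauerAngle 2 l t ^ 4 * Real.sin t ^ (2 - 1)| ≤ a * a := by
    have := intervalIntegral.norm_integral_le_of_norm_le_const (a := 0) (b := a) (C := a)
      (f := fun t => gegenbauerAngle 2 l t ^ 4 * Real.sin t ^ (2 - 1)) fun t ht => by
        rw [uIoc_of_le ha0.le] at ht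
        have h2 := abs_gegenbauerAngle_le_one le_rfl l ⟨ht.1.le, ht.2.trans hab⟩
        have h3 : |Real.sin t| ≤ a := by
          rw [abs_of_nonneg (Real.sin_nonneg_of_nonneg_of_le_pi ht.1.le (by linarith [ht.2]))]
          exact (Real.sin_le ht.1.le).trans ht.2
        rw [Real.norm_eq_abs, abs_mul, abs_pow, pow_one]
        calc _ ≤ (1 : ℝ) ^ 4 * a := by gcongr
          _ = a := by ring
    simpa [abs_of_pos ha0] using this
  have h2 : (∫ t in a..(Real.pi / 2), gegenbauerAngle 2 l t ^ 4 * Real.sin t ^ (2 - 1))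
      = ∫ t in a..(Real.pi / 2), gegenbauerOsc 2 l t ^ 4 / Real.sin t := by
    refine intervalIntegral.integral_congr fun t ht => ?_
    rw [hu] at ht
    have h3 := hs t ht
    have h4 := rpow_two_mul_gegenbauerExp (d := 2) le_rfl h3.le
    simp only [gegenbauerOsc, mul_pow]
    rw [show (Real.sin t ^ gegenbauerExp 2) ^ 4 = ((Real.sin t ^ gegenbauerExp 2) ^ 2) ^ 2 by ring,
      h4]
    field_simp
    simp
  have h3 := hosc.abs_integral_quartic_sub_le hN (m := gegenbauerAmp 2 * N ^ (-gegenbauerExp 2))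
    le_rfl hab le_rfl (fun t ht => abs_gegenbauerOsc_le le_rfl l ht)
    (fun t ht => abs_gegenbauerOscDeriv_le le_rfl l ht)
  have hc1 : IntervalIntegrable (fun t => gegenbauerOsc 2 l t ^ 4 / Real.sin t) volume a
      (Real.pi / 2) := by
    refine ContinuousOn.intervalIntegrable ?_
    rw [hu]
    refine ((hosc.continuousOn_left.mono fun t ht => ⟨ha0.trans_le ht.1, ?_⟩).pow 4).div
      Real.continuous_sin.continuousOn fun t ht => (hs t ht).ne'
    linarith [ht.2]
  have hc2 : IntervalIntegrable (fun t => 1 / Real.sin t) volume a (Real.pi / 2) := by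
    refine ContinuousOn.intervalIntegrable ?_
    rw [hu]
    exact continuousOn_const.div Real.continuous_sin.continuousOn fun t ht => (hs t ht).ne'
  have h4 : ∀ c : ℝ, (∫ t in a..(Real.pi / 2), (gegenbauerOsc 2 l t ^ 4 - c) / Real.sin t)
      = (∫ t in a..(Real.pi / 2), gegenbauerOsc 2 l t ^ 4 / Real.sin t)
        - c * ∫ t in a..(Real.pi / 2), 1 / Real.sin t := by
    intro c
    rw [← intervalIntegral.integral_const_mul, ← intervalIntegral.integral_sub hc1
      (hc2.const_mul c)]
    refine intervalIntegral.integral_congr fun t _ => ?_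
    ring
  rw [h4] at h3
  have h5 : (gegenbauerAmp 2 * N ^ (-gegenbauerExp 2)) ^ 4 = gegenbauerAmp 2 ^ 4 / N ^ 2 := by
    rw [mul_pow, ← Real.rpow_natCast (N ^ (-gegenbauerExp 2)), ← Real.rpow_mul hN.le, hexp,
      show (-(1 / 2 : ℝ) * (4 : ℕ)) = ((-2 : ℤ) : ℝ) by norm_num, Real.rpow_intCast,
      zpow_neg, div_eq_mul_inv]
    rfl
  rw [h5] at h3
  have h6 : gegenbauerMoment 2 4 l
      = (∫ t in (0 : ℝ)..a, gegenbauerAngle 2 l t ^ 4 * Real.sin t ^ (2 - 1))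
        + ∫ t in a..(Real.pi / 2), gegenbauerOsc 2 l t ^ 4 / Real.sin t := by
    rw [gegenbauerMoment_eq two_pos, ← h2]
    exact (intervalIntegral.integral_add_adjacent_intervals (hcont.intervalIntegrable _ _)
      (hcont.intervalIntegrable _ _)).symm
  rw [h6]
  change |(∫ t in a..(Real.pi / 2), gegenbauerOsc 2 l t ^ 4 / Real.sin t)
    - 3 * legendreEnergy l ^ 2 / (8 * N ^ 4) * ∫ t in a..(Real.pi / 2), 1 / Real.sin t| ≤ _ at h3
  generalize (∫ t in (0 : ℝ)..a, gegenbauerAngle 2 l t ^ 4 * Real.sin t ^ (2 - 1)) = A at *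
  generalize (∫ t in a..(Real.pi / 2), gegenbauerOsc 2 l t ^ 4 / Real.sin t) = B at *
  generalize (∫ t in a..(Real.pi / 2), 1 / Real.sin t) = L at *
  have h7 : (A + B) * N ^ 2 - 3 / 8 * (legendreEnergy l / N) ^ 2 * L
      = A * N ^ 2 + (B - 3 * legendreEnergy l ^ 2 / (8 * N ^ 4) * L) * N ^ 2 := by
    field_simp
    ring
  have hN2 : |N ^ 2| = N ^ 2 := abs_of_nonneg (sq_nonneg N)
  rw [h7]
  refine (abs_add_le _ _).trans (add_le_add ?_ ?_)
  · rw [abs_mul, hN2]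
    calc |A| * N ^ 2 ≤ a * a * N ^ 2 := by gcongr
      _ = 1 / 4 := by rw [ha]; field_simp; norm_num
      _ ≤ 1 := by norm_num
  · rw [abs_mul, hN2]
    refine (mul_le_mul_of_nonneg_right h3 (sq_nonneg N)).trans (le_of_eq ?_)
    field_simp

theorem isEquivalent_quartic_moment :
    (fun l : ℕ => gegenbauerMoment 2 4 l) ~[atTop]
      (fun l : ℕ => 3 / (2 * Real.pi ^ 2) * (Real.log (l : ℝ) / (l : ℝ) ^ 2)) := by
  have hN := gegenbauerFreq_tendsto 2
  have hlogl : Tendsto (fun l : ℕ => Real.log (l : ℝ)) atTop atTop :=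
    Real.tendsto_log_atTop.comp tendsto_natCast_atTop_atTop
  have hratio : Tendsto (fun l : ℕ => (l : ℝ) / gegenbauerFreq 2 l) atTop (𝓝 1) :=
    freq_div_tendsto_one le_rfl
  set L : ℕ → ℝ := fun l =>
    ∫ t in (1 / (2 * gegenbauerFreq 2 l))..(Real.pi / 2), 1 / Real.sin t with hL
  have hsmall : ∀ {f : ℕ → ℝ} {C : ℝ}, (∀ᶠ l in atTop, |f l| ≤ C) →
      Tendsto (fun l : ℕ => f l / Real.log (l : ℝ)) atTop (𝓝 0) := by
    intro f C hf
    refine squeeze_zero_norm' ?_ (hlogl.const_div_atTop C)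
    filter_upwards [hf, hlogl.eventually_gt_atTop 0] with l h1 h2
    rw [Real.norm_eq_abs, abs_div, abs_of_pos h2]
    gcongr
  have hlogratio : Tendsto (fun l : ℕ => Real.log ((l : ℝ) / gegenbauerFreq 2 l)) atTop (𝓝 0) := by
    have := (Real.continuousAt_log one_ne_zero).tendsto.comp hratio
    rwa [Real.log_one] at this
  have hL1 : Tendsto (fun l : ℕ => L l / Real.log (l : ℝ)) atTop (𝓝 1) := by
    have h1 : Tendsto (fun l : ℕ => (L l - Real.log l) / Real.log (l : ℝ)) atTop (𝓝 0) := by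
      refine hsmall (C := 5) ?_
      filter_upwards [hN.eventually_ge_atTop 1, eventually_gt_atTop 0,
        hlogratio.eventually (Metric.ball_mem_nhds 0 one_pos)] with l h1 h2 h3
      have h4 := abs_integral_inv_sin_sub_log_le h1
      have h2' : (0 : ℝ) < l := by exact_mod_cast h2
      rw [Real.dist_eq, sub_zero, Real.log_div h2'.ne' (by positivity)] at h3
      rw [abs_lt] at h3
      rw [abs_le] at h4 ⊢
      simp only [hL]
      constructor <;> linarith [h3.1, h3.2, h4.1, h4.2]
    have h2 := h1.add_const 1
    rw [zero_add] at h2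
    refine h2.congr' ?_
    filter_upwards [hlogl.eventually_gt_atTop 0] with l h
    field_simp
    ring
  have hM : Tendsto (fun l : ℕ => gegenbauerMoment 2 4 l * gegenbauerFreq 2 l ^ 2
      / Real.log (l : ℝ)) atTop (𝓝 (3 / (2 * Real.pi ^ 2))) := by
    have h1 := hsmall (f := fun l => gegenbauerMoment 2 4 l * gegenbauerFreq 2 l ^ 2
      - 3 / 8 * (legendreEnergy l / gegenbauerFreq 2 l) ^ 2 * L l)
      (.of_forall abs_quartic_moment_sub_le)
    have h2 := h1.add (((legendreEnergy_div_tendsto.pow 2).const_mul (3 / 8)).mul hL1)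
    have h3 : 0 + 3 / 8 * (2 / Real.pi) ^ 2 * 1 = 3 / (2 * Real.pi ^ 2) := by
      field_simp; norm_num
    rw [h3] at h2
    refine h2.congr fun l => ?_
    ring
  have hc : 3 / (2 * Real.pi ^ 2) ≠ 0 := by positivity
  have hfin := (hM.mul (hratio.pow 2)).div_const (3 / (2 * Real.pi ^ 2))
  rw [one_pow, mul_one, div_self hc] at hfin
  refine (isEquivalent_iff_tendsto_one ?_).2 (hfin.congr' ?_)
  · filter_upwards [hlogl.eventually_gt_atTop 0, eventually_gt_atTop 0] with l h1 h2
    have h2' : (0 : ℝ) < l := by exact_mod_cast h2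
    positivity
  · filter_upwards [hlogl.eventually_gt_atTop 0, eventually_gt_atTop 0] with l h1 h2
    have h2' : (0 : ℝ) < l := by exact_mod_cast h2
    have h3 := gegenbauerFreq_pos (d := 2) le_rfl l
    simp only [Pi.div_apply]
    field_simp

/-! ### The theorem. -/

theorem proposition1 :
    (∀ d q : ℕ, (d = 2 ∧ (q = 3 ∨ 5 ≤ q)) ∨ (3 ≤ d ∧ 3 ≤ q) →
      ((d, q) ≠ (2, 3) ∧ (d, q) ≠ (3, 3) → AbsolutelyConvergent (besselIntegrand d q)) ∧
      ((d, q) = (2, 3) ∨ (d, q) = (3, 3) → ConditionallyConvergent (besselIntegrand d q)) ∧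
      (fun l : ℕ => gegenbauerMoment d q l) ~[atTop]
        (fun l : ℕ => momentConst d q / (l : ℝ) ^ d)) ∧
    (fun l : ℕ => gegenbauerMoment 2 4 l) ~[atTop]
      (fun l : ℕ => 3 / (2 * Real.pi ^ 2) * (Real.log (l : ℝ) / (l : ℝ) ^ 2)) := by
  refine ⟨fun d q h => ?_, isEquivalent_quartic_moment⟩
  have hd : 2 ≤ d := by omega
  have hq : 3 ≤ q := by omega
  -- The inequality (q - 2)(d - 1) > 2 fails, among d ≥ 2 and q ≥ 3, only at (2, 3), (2, 4) and (3,
  -- 3); the pair (2, 4) is ruled out by the hypothesis on d and q.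
  have hexp : (d, q) ≠ (2, 3) ∧ (d, q) ≠ (3, 3) → 1 < ((q : ℝ) - 2) * gegenbauerExp d := by
    intro hne
    simp only [ne_eq, Prod.mk.injEq] at hne
    obtain ⟨a, rfl⟩ := Nat.exists_eq_add_of_le hd
    obtain ⟨b, rfl⟩ := Nat.exists_eq_add_of_le hq
    have h1 : 2 < (b + 1) * (a + 1) := by
      rcases Nat.lt_or_ge a 2 with h2 | h2
      · interval_cases a <;> omega
      · nlinarith
    have h2 : (2 : ℝ) < (b + 1) * (a + 1) := by exact_mod_cast h1
    rw [gegenbauerExp]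
    push_cast
    linarith
  refine ⟨fun hne => absolutelyConvergent_besselIntegrand hd (hexp hne), fun heq => ?_, ?_⟩
  · simp only [Prod.mk.injEq] at heq
    obtain rfl : q = 3 := by omega
    exact conditionallyConvergent_besselIntegrand hd (by omega)
  · have hcase : q = 3 ∨ 1 < ((q : ℝ) - 2) * gegenbauerExp d := by
      by_cases h3 : q = 3
      · exact .inl h3
      · exact .inr (hexp (by simp [h3]))
    obtain ⟨I, hI, hlim⟩ := exists_limit_moment hd hcase
    rw [momentConst_eq hd hI]
    exact isEquivalent_moment hd (besselMoment_pos hd hq hI).ne' hlim
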